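/- **Setting.** Let $(Y,J,\omega,\Omega)$ be a Calabi-Yau 3-fold with metric $g_Y$ (normalized by $\omega^3/3!=(-1)^{3}(i/2)^3\Omega\wedge\bar\Omega$), and let $Z_0\subset Y$ be an embedded special Lagrangian 3-sphere ($\omega|_{Z_0}=0$, $\mathrm{Im}\,\Omega|_{Z_0}=0$), oriented by $\mathrm{Re}\,\Omega$. Let $\Phi:U\to Y$ be a symplectomorphism from an open neighbourhood $U$ of the zero section of $T^*Z_0$ onto a neighbourhood of $Z_0$ which is the identity on the zero section and which maps the tangent space at $0$ of the fibre over $z$ to $J\cdot T_zZ_0$. Let $X$ be a closed oriented 3-manifold and $f:X\to Z_0$ a smooth orientation-preserving finite branched covering with branch loci $\tilde\Gamma=\coprod_{j=1}^{n}\tilde\Gamma_j\subset X$ and $\Gamma\subset Z_0$, that is simple and normalized: every $\tilde\Gamma_j$ is a circle, $f$ maps it diffeomorphically onto a component of $\Gamma$, of length $l_j$, and there are pairwise disjoint tubular neighbourhoods $\nu_j$ of the $\tilde\Gamma_j$ with coordinates $(x_1,x_2,x_3)$, and tubular neighbourhoods of the $f(\tilde\Gamma_j)$ with coordinates $(u_1,u_2,u_3)$,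 both with values in $\mathbb R^2\times\mathbb R/l_j$ (the circles being $x_1=x_2=0$ and $u_1=u_2=0$), in which $f$ is $u_1+iu_2=(x_1+ix_2)^{m_j}$, $u_3=x_3$ for an integer $m_j\ge2$, where $(\partial_{u_1},\partial_{u_2},\partial_{u_3})$ is orthonormal along $f(\tilde\Gamma_j)$. Let $R_0>0$ be such that the closed solid tori $\{|u_1+iu_2|\le R_0\}$ and $\{|x_1+ix_2|^{m_j}\le R_0\}$ lie in these neighbourhoods, and let $a_j>0$. Let $0<c_2<c_1$, $b_1^t=t^{c_1}$, $b_2^t=t^{c_2}$, and let $\chi^t:(0,R_0)\to[0,1]$, $t\in(0,\delta_0)$, be smooth functions that depend smoothly on $t$, where $b_2^t<R_0$ for these $t$ (and $b_1^t<b_2^t$), such that $\chi^t=1$ on $(0,b_1^t]$, $\chi^t=0$ on $[b_2^t,R_0)$, and, for a constant $C_0$ and all small $t$, $|(d/dr)^k\chi^t|\le C_0(b_2^t)^{-k}$ for $k=1,2,3$. Let $h^t:X\to\mathbb R$ be $$h^t=\chi^t\big(|x_1+ix_2|^{m_j}\big)\,t^{(m_j-1)/m_j}\,\tfrac{m_j}{m_j+1}\,a_j^{1/m_j}\,\mathrm{Re}\big((x_1+ix_2)^{m_j+1}\big)$$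 on $\{|x_1+ix_2|^{m_j}<R_0\}\subset\nu_j$ and $0$ elsewhere, and let $f^t=\Phi\circ f_!\circ dh^t:X\to Y$, where $f_!(\alpha)=\alpha\circ(df_x)^{-1}\in T^*_{f(x)}Z_0$ for $\alpha\in T_x^*X$, $x\notin\tilde\Gamma$, and $f_!\circ dh^t$ is extended continuously over $\tilde\Gamma$. Put $g^t=(f^t)^*g_Y$ and $\varepsilon^t=\mathrm{Im}\big((f^t)^*\Omega/\mathrm{vol}_{g^t}\big)$ (that is, $\varepsilon^t=\sin\alpha$ if the phase is $e^{i\alpha}$). Let $$P_j^t=\{|x_1+ix_2|^{m_j}\le b_1^t\},\quad Q_j^t=\{b_1^t\le|x_1+ix_2|^{m_j}\le b_2^t\}\ \subset\nu_j,\quad K^t=X-\bigcup_j(P_j^t\cup Q_j^t).$$ **Proposition (basic estimate).** There are $\delta\in(0,\delta_0]$ and a constant $C>0$ such that for all $t\in(0,\delta)$ the map $f^t$ is defined (that is, $f_!\circ dh^t$ has values in $U$) and is a smooth immersion, $\varepsilon^t$ is smooth, and, for all $j$, pointwise, $$|\varepsilon^t|\le\begin{cases}C\,t^{c_1}+C\,t^{(1-\frac1{m_j})+\frac{c_1}{m_j}}&\text{on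 }P_j^t,\\ C\,t^{1-\frac1{m_j}-2c_2}+C\,t^{(1-\frac1{m_j})(1-c_1)}&\text{on }Q_j^t,\\ 0&\text{on }K^t;\end{cases}$$ $$|d\varepsilon^t|\le\begin{cases}C+C\,t^{(m_j-1)(c_1-1)/m_j}&\text{on }P_j^t,\\ C\,t^{1-\frac1{m_j}-3c_2}+C\,t^{(1-\frac1{m_j})(1-c_1)-c_2}+C\,t^{(1-\frac1{m_j})-c_1(2-\frac1{m_j})}&\text{on }Q_j^t,\\ 0&\text{on }K^t,\end{cases}$$ where $|d\varepsilon^t|$ is computed with the metric $g^t$. -/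

import Mathlib

open Set Filter Topology Bundle Manifold
open scoped ContDiff

noncomputable section

namespace BranchedSL

/-! ### Model spaces -/

/-- The model space `ℂ³` of a complex threefold. -/
abbrev C3 : Type := EuclideanSpace ℂ (Fin 3)

/-- The model space `ℝ³` of a real 3-manifold. -/
abbrev R3 : Type := EuclideanSpace ℝ (Fin 3)

/-- The underlying real manifold of a complex threefold is smooth. -/
instance realSmooth (Y : Type*) [TopologicalSpace Y] [ChartedSpace C3 Y]
    [IsManifold 𝓘(ℂ, C3) ω Y] : IsManifold 𝓘(ℝ, C3) ∞ Y := by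
  apply isManifold_of_contDiffOn
  intro e e' he he'
  have h := (contDiffGroupoid ω 𝓘(ℂ, C3)).compatible he he'
  rw [contDiffGroupoid, mem_groupoid_of_pregroupoid] at h
  have h1 := h.1
  simp only [contDiffPregroupoid, modelWithCornersSelf_coe,
    modelWithCornersSelf_coe_symm, Function.id_comp, Function.comp_id, preimage_id, range_id,
    inter_univ] at h1
  have h2 := (h1.restrict_scalars ℝ).of_le (m := (∞ : WithTop ℕ∞)) le_top
  simpa using h2

/-! ### Calabi-Yau threefolds -/

section CalabiYau

variable {Y : Type*} [TopologicalSpace Y] [ChartedSpace C3 Y]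

/-- The complex structure `J` on the real tangent spaces of a complex manifold: multiplication
by `i` in the holomorphic charts. -/
def J (y : Y) : TangentSpace 𝓘(ℝ, C3) y →L[ℝ] TangentSpace 𝓘(ℝ, C3) y :=
  (Complex.I • ContinuousLinearMap.id ℝ C3 : C3 →L[ℝ] C3)

variable (Y) in
/-- A Calabi-Yau structure on a complex threefold `Y`: a Kähler metric `g` with Kähler form
`ω = g(J·, ·)`, and a holomorphic `(3,0)`-form `Ω`, normalized by
`ω³/3! = (-1)^{3·2/2} (i/2)³ Ω ∧ Ω̄`. -/
structure CalabiYau [IsManifold 𝓘(ℂ, C3) ω Y] where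
  /-- the Kähler metric -/
  g : ContMDiffRiemannianMetric 𝓘(ℝ, C3) ∞ C3 (fun y : Y => TangentSpace 𝓘(ℝ, C3) y)
  /-- the Kähler form -/
  kahler : ∀ y : Y, TangentSpace 𝓘(ℝ, C3) y [⋀^Fin 2]→L[ℝ] ℝ
  /-- the holomorphic volume form; it is complex trilinear, hence of type `(3,0)` -/
  Omega : ∀ y : Y, TangentSpace 𝓘(ℂ, C3) y [⋀^Fin 3]→L[ℂ] ℂ
  g_J : ∀ (y : Y) (v w : TangentSpace 𝓘(ℝ, C3) y), g.inner y (J y v) (J y w) = g.inner y v w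
  kahler_eq : ∀ (y : Y) (v w : TangentSpace 𝓘(ℝ, C3) y),
    kahler y ![v, w] = g.inner y (J y v) w
  /-- `dω = 0`, in every chart of the atlas -/
  kahler_closed : ∀ φ ∈ atlas C3 Y, ∀ z ∈ φ.target,
    extDeriv (fun z' : C3 => ((kahler (φ.symm z')).compContinuousLinearMap
      (mfderiv 𝓘(ℝ, C3) 𝓘(ℝ, C3) φ.symm z') : C3 [⋀^Fin 2]→L[ℝ] ℝ)) z = 0
  /-- in every chart `Ω = F dz₁ ∧ dz₂ ∧ dz₃` with `F` holomorphic -/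
  Omega_holomorphic : ∀ φ ∈ atlas C3 Y,
    DifferentiableOn ℂ (fun z : C3 => Omega (φ.symm z) (fun i =>
      mfderiv 𝓘(ℂ, C3) 𝓘(ℂ, C3) φ.symm z (EuclideanSpace.single i (1 : ℂ) : C3))) φ.target
  /-- the normalization of `Ω`: with the Hermitian form `h = g + i ω` it reads
  `|Ω(v₁, v₂, v₃)|² = det (h(vⱼ, vₖ))`, i.e. `|F|² = det (h_{jk})` in a holomorphic chart -/
  Omega_norm : ∀ (y : Y) (v : Fin 3 → TangentSpace 𝓘(ℝ, C3) y),
    (((‖Omega y v‖ ^ 2 : ℝ)) : ℂ) = Matrix.det (Matrix.of fun j k : Fin 3 =>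
      ((g.inner y (v j) (v k) : ℝ) : ℂ) + Complex.I * ((kahler y ![v j, v k] : ℝ) : ℂ))

end CalabiYau

/-- `Ω` evaluated on three real tangent vectors. -/
def CalabiYau.OmegaR {Y : Type*} [TopologicalSpace Y] [ChartedSpace C3 Y]
    [IsManifold 𝓘(ℂ, C3) ω Y] (cy : CalabiYau Y) (y : Y)
    (v : Fin 3 → TangentSpace 𝓘(ℝ, C3) y) : ℂ := cy.Omega y v

/-! ### Special Lagrangian submanifolds and their Lagrangian neighbourhoods -/

section Lagrangian

variable {Y : Type*} [TopologicalSpace Y] [ChartedSpace C3 Y] [IsManifold 𝓘(ℂ, C3) ω Y]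
  {Z : Type*} [TopologicalSpace Z] [ChartedSpace R3 Z] [IsManifold (𝓡 3) ∞ Z]

/-- `ι : Z → Y` is an embedded special Lagrangian submanifold:
a smooth embedding with `ι^* ω = 0` and `ι^* Im Ω = 0`. -/
structure IsSpecialLagrangian (cy : CalabiYau Y) (ι : Z → Y) : Prop where
  smooth : ContMDiff (𝓡 3) 𝓘(ℝ, C3) ∞ ι
  embedding : IsEmbedding ι
  immersion : ∀ z, Function.Injective (mfderiv (𝓡 3) 𝓘(ℝ, C3) ι z)
  lagrangian : ∀ (z : Z) (v w : TangentSpace (𝓡 3) z),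
    cy.kahler (ι z) ![mfderiv (𝓡 3) 𝓘(ℝ, C3) ι z v, mfderiv (𝓡 3) 𝓘(ℝ, C3) ι z w] = 0
  special : ∀ (z : Z) (v : Fin 3 → TangentSpace (𝓡 3) z),
    (cy.OmegaR (ι z) (fun i => mfderiv (𝓡 3) 𝓘(ℝ, C3) ι z (v i))).im = 0

variable (Z) in
/-- The cotangent bundle `T^*Z` of a 3-manifold. -/
abbrev Cotangent : Type _ :=
  TotalSpace (R3 →L[ℝ] ℝ) (fun z : Z => TangentSpace (𝓡 3) z →L[ℝ] ℝ)

/-- The canonical coordinates `(u, p) ↦ p₁ du₁ + p₂ du₂ + p₃ du₃` on `T^*Z` that belong to a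
chart `φ = (u₁, u₂, u₃)` of `Z`. -/
def canonicalCoord (φ : OpenPartialHomeomorph Z R3) (q : R3 × (R3 →L[ℝ] ℝ)) : Cotangent Z :=
  ⟨φ.symm q.1, (q.2 : R3 →L[ℝ] ℝ).comp
    (mfderiv (𝓡 3) 𝓘(ℝ, R3) φ (φ.symm q.1) : TangentSpace (𝓡 3) (φ.symm q.1) →L[ℝ] R3)⟩

/-- `Φ : U → Y` is a symplectomorphism from a neighbourhood `U` of the zero section of `T^*Z` onto a
neighbourhood of `ι Z` in `Y`, which restricts to `ι` on the zero section, where it maps the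
tangent space of the fibre of `T^*Z` at `z` to `J · T_z Z`. -/
structure IsLagrangianNeighbourhood (cy : CalabiYau Y) (ι : Z → Y)
    (U : Set (Cotangent Z)) (Φ : Cotangent Z → Y) : Prop where
  isOpen : IsOpen U
  zero_mem : ∀ z : Z, (⟨z, 0⟩ : Cotangent Z) ∈ U
  smooth : ContMDiffOn ((𝓡 3).prod 𝓘(ℝ, R3 →L[ℝ] ℝ)) 𝓘(ℝ, C3) ∞ Φ U
  injOn : InjOn Φ U
  isOpen_image : IsOpen (Φ '' U)
  /-- `Φ^* ω = du₁ ∧ dp₁ + du₂ ∧ dp₂ + du₃ ∧ dp₃` in all canonical coordinates -/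
  symplectic : ∀ φ ∈ IsManifold.maximalAtlas (𝓡 3) ∞ Z, ∀ q : R3 × (R3 →L[ℝ] ℝ),
    q.1 ∈ φ.target → canonicalCoord φ q ∈ U → ∀ v w : R3 × (R3 →L[ℝ] ℝ),
      cy.kahler (Φ (canonicalCoord φ q))
        ![mfderiv 𝓘(ℝ, R3 × (R3 →L[ℝ] ℝ)) 𝓘(ℝ, C3) (fun q' => Φ (canonicalCoord φ q')) q v,
          mfderiv 𝓘(ℝ, R3 × (R3 →L[ℝ] ℝ)) 𝓘(ℝ, C3) (fun q' => Φ (canonicalCoord φ q')) q w]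
        = w.2 v.1 - v.2 w.1
  zero_section : ∀ z : Z, Φ ⟨z, 0⟩ = ι z
  /-- the derivative at `0` of `Φ` restricted to the fibre over `z` has values in `J · T_z Z` -/
  fibre : ∀ (z : Z) (η : R3 →L[ℝ] ℝ), ∃ w : TangentSpace (𝓡 3) z,
    (mfderiv 𝓘(ℝ, R3 →L[ℝ] ℝ) 𝓘(ℝ, C3) (fun p : R3 →L[ℝ] ℝ => Φ (⟨z, p⟩ : Cotangent Z)) 0 η : C3)
      = J (ι z) (mfderiv (𝓡 3) 𝓘(ℝ, C3) ι z w)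

end Lagrangian

/-! ### Simple normalized branched coverings -/

/-- The atlas of the 3-manifold `X` is oriented. The tangent space of `X` at `x` is `ℝ³` by means of
the preferred chart at `x`, so its standard basis is then a positive basis. -/
class OrientedAtlas (X : Type*) [TopologicalSpace X] [ChartedSpace R3 X] : Prop where
  det_pos : ∀ e ∈ atlas R3 X, ∀ e' ∈ atlas R3 X, ∀ u ∈ (e.symm.trans e').source,
    0 < (fderiv ℝ (e.symm.trans e') u).det

/-- The standard, positively oriented basis of the tangent space `T_x X = ℝ³`. -/
def stdBasis {X : Type*} [TopologicalSpace X] [ChartedSpace R3 X] (x : X) (i : Fin 3) :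
    TangentSpace (𝓡 3) x := (EuclideanSpace.single i (1 : ℝ) : R3)

/-- The solid cylinder `{|z| < ρ} × ℝ`, the universal covering of a solid torus. -/
def cyl (ρ : ℝ) : Set (ℂ × ℝ) := {p | ‖p.1‖ < ρ}

/-- `ψ` induces a diffeomorphism of the solid torus `{|z| < ρ} × ℝ/l` onto an open subset of the
3-manifold `M`; its inverse is a coordinate system `(x₁ + i x₂, x₃)` with values in
`ℂ × ℝ/l` on a tubular neighbourhood of the circle `z = 0`. -/
structure IsTube {M : Type*} [TopologicalSpace M] [ChartedSpace R3 M]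
    (ρ l : ℝ) (ψ : ℂ × ℝ → M) : Prop where
  radius_pos : 0 < ρ
  length_pos : 0 < l
  smooth : ContMDiffOn 𝓘(ℝ, ℂ × ℝ) (𝓡 3) ∞ ψ (cyl ρ)
  bijective : ∀ p ∈ cyl ρ, Function.Bijective (mfderiv 𝓘(ℝ, ℂ × ℝ) (𝓡 3) ψ p)
  eq_iff : ∀ p ∈ cyl ρ, ∀ q ∈ cyl ρ, ψ p = ψ q ↔ p.1 = q.1 ∧ ∃ k : ℤ, p.2 - q.2 = k * l

section Covering

variable {Y : Type*} [TopologicalSpace Y] [ChartedSpace C3 Y] [IsManifold 𝓘(ℂ, C3) ω Y]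
  {Z : Type*} [TopologicalSpace Z] [ChartedSpace R3 Z] [IsManifold (𝓡 3) ∞ Z]
  {X : Type*} [TopologicalSpace X] [ChartedSpace R3 X]

/-- The local data of a branched covering: for each of the `n` components `Γ̃_j` of
the branch locus upstairs, the degree `m_j`, the length `l_j` of its image, and coordinate systems
(given by their inverses) on tubular neighbourhoods of `Γ̃_j` and of its image. -/
structure BranchData (X Z : Type*) (n : ℕ) where
  /-- the degree of the covering around `Γ̃_j` -/
  m : Fin n → ℕ
  /-- the length of the image of `Γ̃_j` -/
  l : Fin n → ℝ
  /-- the tubular neighbourhoods are `{|x₁ + i x₂|^{m_j} < R_j}` and `{|u₁ + i u₂| < R_j}` -/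
  R : Fin n → ℝ
  /-- inverse of the coordinates `(x₁ + i x₂, x₃)` around `Γ̃_j` -/
  up : Fin n → ℂ × ℝ → X
  /-- inverse of the coordinates `(u₁ + i u₂, u₃)` around the image of `Γ̃_j` -/
  down : Fin n → ℂ × ℝ → Z

/-- The branch locus `Γ̃` upstairs. -/
def BranchData.locusUp {X Z : Type*} {n : ℕ} (B : BranchData X Z n) : Set X :=
  {x | ∃ (j : Fin n) (s : ℝ), B.up j (0, s) = x}

/-- The branch locus `Γ` downstairs. -/
def BranchData.locusDown {X Z : Type*} {n : ℕ} (B : BranchData X Z n) : Set Z :=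
  {z | ∃ (j : Fin n) (s : ℝ), B.down j (0, s) = z}

/-- `f : X → Z ⊂ Y` is a simple normalized branched covering, orientation-preserving for the
orientation of `Z` as a special Lagrangian submanifold. -/
structure IsSimpleNormalizedBranchedCovering (cy : CalabiYau Y) (ι : Z → Y) (f : X → Z)
    {n : ℕ} (B : BranchData X Z n) : Prop where
  smooth : ContMDiff (𝓡 3) (𝓡 3) ∞ f
  /-- off the branch locus upstairs, `f` is a local diffeomorphism -/
  unramified : ∀ x ∉ B.locusUp, Function.Bijective (mfderiv (𝓡 3) (𝓡 3) f x)
  /-- off the branch locus downstairs, `f` is a covering map -/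
  covering : IsCoveringMapOn f (B.locusDown)ᶜ
  /-- `f` preserves the orientations; the one of `Z` is given by `Re Ω` -/
  oriented : ∀ x ∉ B.locusUp,
    0 < (cy.OmegaR (ι (f x)) (fun i => mfderiv (𝓡 3) 𝓘(ℝ, C3) ι (f x)
      (mfderiv (𝓡 3) (𝓡 3) f x (stdBasis x i)))).re
  two_le : ∀ j, 2 ≤ B.m j
  tube_up : ∀ j, IsTube (B.R j ^ (1 / (B.m j : ℝ))) (B.l j) (B.up j)
  tube_down : ∀ j, IsTube (B.R j) (B.l j) (B.down j)
  /-- the tubular neighbourhoods upstairs are disjoint -/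
  disjoint_up : ∀ j k, j ≠ k →
    Disjoint (B.up j '' cyl (B.R j ^ (1 / (B.m j : ℝ))))
      (B.up k '' cyl (B.R k ^ (1 / (B.m k : ℝ))))
  /-- the circles downstairs are the components of `Γ`: any two of them agree or are disjoint -/
  components_down : ∀ j k,
    range (fun s : ℝ => B.down j (0, s)) = range (fun s : ℝ => B.down k (0, s)) ∨
    Disjoint (range (fun s : ℝ => B.down j (0, s))) (range (fun s : ℝ => B.down k (0, s)))
  /-- along `Γ`, `(∂/∂u₁, ∂/∂u₂, ∂/∂u₃)` is an orthonormal frame -/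
  orthonormal : ∀ (j : Fin n) (s : ℝ) (v w : ℂ × ℝ),
    cy.g.inner (ι (B.down j (0, s)))
      (mfderiv (𝓡 3) 𝓘(ℝ, C3) ι (B.down j (0, s))
        (mfderiv 𝓘(ℝ, ℂ × ℝ) (𝓡 3) (B.down j) (0, s) v))
      (mfderiv (𝓡 3) 𝓘(ℝ, C3) ι (B.down j (0, s))
        (mfderiv 𝓘(ℝ, ℂ × ℝ) (𝓡 3) (B.down j) (0, s) w))
      = v.1.re * w.1.re + v.1.im * w.1.im + v.2 * w.2
  /-- `f` is `(x₁ + i x₂, x₃) ↦ ((x₁ + i x₂)^{m_j}, x₃)` -/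
  normal_form : ∀ (j : Fin n), ∀ p ∈ cyl (B.R j ^ (1 / (B.m j : ℝ))),
    f (B.up j p) = B.down j (p.1 ^ B.m j, p.2)

end Covering

/-! ### The cutoff functions -/

/-- A family of cutoff functions `χ^t : (0, R₀) → [0, 1]`, `0 < t < δ`, which depends
smoothly on `t`, is `1` on `(0, b₁^t]` and `0` on `[b₂^t, R₀)`, and whose first three derivatives are
bounded by `C₀ (b₂^t)^{-k}` for small `t`. -/
structure IsCutoffFamily (δ R₀ : ℝ) (b₁ b₂ : ℝ → ℝ) (χ : ℝ → ℝ → ℝ) : Prop where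
  b_lt : ∀ t ∈ Ioo 0 δ, 0 < b₁ t ∧ b₁ t < b₂ t ∧ b₂ t < R₀
  smooth : ContDiffOn ℝ ∞ (fun p : ℝ × ℝ => χ p.1 p.2) (Ioo 0 δ ×ˢ Ioo 0 R₀)
  mem_Icc : ∀ t ∈ Ioo 0 δ, ∀ r ∈ Ioo 0 R₀, χ t r ∈ Icc (0 : ℝ) 1
  eq_one : ∀ t ∈ Ioo 0 δ, ∀ r, 0 < r → r ≤ b₁ t → χ t r = 1
  eq_zero : ∀ t ∈ Ioo 0 δ, ∀ r, b₂ t ≤ r → r < R₀ → χ t r = 0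
  deriv_le : ∃ C₀ > 0, ∃ t₀ > 0, ∀ t ∈ Ioo 0 δ, t < t₀ → ∀ r ∈ Ioo 0 R₀,
    ∀ k ∈ ({1, 2, 3} : Set ℕ), |iteratedDeriv k (χ t) r| ≤ C₀ * (b₂ t)⁻¹ ^ k

/-! ### The deformations `f^t` -/

section Deformation

variable {Y : Type*} [TopologicalSpace Y] [ChartedSpace C3 Y] [IsManifold 𝓘(ℂ, C3) ω Y]
  {Z : Type*} [TopologicalSpace Z] [ChartedSpace R3 Z] [IsManifold (𝓡 3) ∞ Z]
  {X : Type*} [TopologicalSpace X] [ChartedSpace R3 X] {n : ℕ}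

/-- The function
`h^{j,t} = χ^t(|x₁ + i x₂|^m) t^{(m-1)/m} (m/(m+1)) a^{1/m} Re ((x₁ + i x₂)^{m+1})`
in the coordinates around `Γ̃_j`. -/
def localPotential (m : ℕ) (a : ℝ) (χ : ℝ → ℝ → ℝ) (t : ℝ) (z : ℂ) : ℝ :=
  χ t (‖z‖ ^ m) * (t ^ (((m : ℝ) - 1) / m) *
    ((m : ℝ) / (m + 1) * a ^ (1 / (m : ℝ)) * (z ^ (m + 1)).re))

open Classical in
/-- The function `h^t : X → ℝ`: it is `h^{j,t}` on the tubular neighbourhood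
`{|x₁ + i x₂|^{m_j} < R₀}` of `Γ̃_j`, and `0` off these neighbourhoods. -/
def potential (B : BranchData X Z n) (R₀ : ℝ) (a : Fin n → ℝ) (χ : ℝ → ℝ → ℝ) (t : ℝ) (x : X) :
    ℝ :=
  if hx : ∃ q : Fin n × (ℂ × ℝ), ‖q.2.1‖ ^ B.m q.1 < R₀ ∧ B.up q.1 q.2 = x then
    localPotential (B.m hx.choose.1) (a hx.choose.1) χ t hx.choose.2.1
  else 0

/-- The composition `f_! ∘ dh : X → T^*Z`. Where `f` is a local diffeomorphism, `f_!` maps the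
covector `α` at `x` to the covector `α ∘ (df_x)⁻¹` at `f x`. Where `df_x` is not invertible, i.e. on
the branch locus upstairs, `ContinuousLinearMap.inverse` is `0`; for `h = h^t` this is
the value of the continuous extension of `f_! ∘ dh`. -/
def pushGraph (f : X → Z) (h : X → ℝ) (x : X) : Cotangent Z :=
  ⟨f x, ((mfderiv (𝓡 3) 𝓘(ℝ, ℝ) h x : TangentSpace (𝓡 3) x →L[ℝ] ℝ)).comp
    (mfderiv (𝓡 3) (𝓡 3) f x).inverse⟩

/-- The deformation `f^t = Φ ∘ f_! ∘ dh^t : X → Y`. -/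
def deformation (Φ : Cotangent Z → Y) (f : X → Z) (B : BranchData X Z n) (R₀ : ℝ)
    (a : Fin n → ℝ) (χ : ℝ → ℝ → ℝ) (t : ℝ) (x : X) : Y :=
  Φ (pushGraph f (potential B R₀ a χ t) x)

/-- The pull-back `F^* g_Y` of the Calabi-Yau metric. -/
def pullbackMetric (cy : CalabiYau Y) (F : X → Y) (x : X) (v w : TangentSpace (𝓡 3) x) : ℝ :=
  cy.g.inner (F x) (mfderiv (𝓡 3) 𝓘(ℝ, C3) F x v) (mfderiv (𝓡 3) 𝓘(ℝ, C3) F x w)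

/-- The function `ε = sin α = Im (F^*Ω / vol)` of an immersion `F : X → Y` of an oriented
3-manifold, where `vol` is the volume form of `F^* g_Y`; both 3-forms are evaluated on a positive
basis of the tangent space. -/
def phase (cy : CalabiYau Y) (F : X → Y) (x : X) : ℝ :=
  (cy.OmegaR (F x) (fun i => mfderiv (𝓡 3) 𝓘(ℝ, C3) F x (stdBasis x i))
    / (Real.sqrt (Matrix.det (Matrix.of fun i k : Fin 3 =>
        pullbackMetric cy F x (stdBasis x i) (stdBasis x k))) : ℂ)).im

/-- `|dε| ≤ c` at `x`, where the norm of the covector `dε` is the one of the metric `F^* g_Y`. -/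
def DiffNormLE (cy : CalabiYau Y) (F : X → Y) (ε : X → ℝ) (x : X) (c : ℝ) : Prop :=
  ∀ v : TangentSpace (𝓡 3) x,
    abs (α := ℝ) (mfderiv (𝓡 3) 𝓘(ℝ, ℝ) ε x v) ≤ c * Real.sqrt (pullbackMetric cy F x v v)

/-- `P_j^t = {0 ≤ |x₁ + i x₂|^{m_j} ≤ b₁}` around `Γ̃_j`. -/
def partP (B : BranchData X Z n) (b₁ : ℝ) (j : Fin n) : Set X :=
  B.up j '' {p | ‖p.1‖ ^ B.m j ≤ b₁}

/-- `Q_j^t = {b₁ ≤ |x₁ + i x₂|^{m_j} ≤ b₂}` around `Γ̃_j`. -/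
def partQ (B : BranchData X Z n) (b₁ b₂ : ℝ) (j : Fin n) : Set X :=
  B.up j '' {p | b₁ ≤ ‖p.1‖ ^ B.m j ∧ ‖p.1‖ ^ B.m j ≤ b₂}

/-- `K^t`, the complement of all `P_j^t` and `Q_j^t`. -/
def partK (B : BranchData X Z n) (b₁ b₂ : ℝ) : Set X :=
  (⋃ j, (partP B b₁ j ∪ partQ B b₁ b₂ j))ᶜ

end Deformation

end BranchedSL

end

/-! In the tube coordinates around a branch circle the covector of `dh^t` has no component along the
circle, so `Φ` becomes a map of `(u, s, p)` in `(ℂ × ℝ) × ℂ` (`tubeMap`). On `p = 0` it is `ι`, and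
on the core `u = p = 0` its differential is `(w, p) ↦ w + i p` in an orthonormal frame
(`tubeDeriv_core`). The angle of a frame, `Im (Ω / vol)`, is smooth in point and frame and depends
only on the oriented space that the frame spans (`angle_frame_change`). It vanishes on two loci:
horizontal frames on the zero section (`planeAngle_horizontal`) and, over the core, tangent planes
of graphs of antiholomorphic functions (`planeAngle_core`). The mean value inequality turns each
vanishing into a bound for the angle and its differential by the distance to the locus, uniformly on
compact sets (`exists_bound_of_vanishing`).

On `P_j` the cutoff is one and the section is `z ↦ (z^m, A z̄)` with `A = a^{1/m} t^{1-1/m}`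
(`pushGraph_core`), an immersion even at `z = 0`. Its distance from the core is at most `|z|^m + A
|z|`, which bounds `ε`. In `dε` the direction `(m z^{m-1}, A)`, scaled to unit length, varies fast,
but exactly as fast as the distance from the core is small; hence `dε` is bounded
(`exists_core_estimate`).

On `Q_j` put `u = e^ξ`, `ρ = Re ξ`. Then `f` is the identity, three derivatives of the cutoff are
uniformly bounded (`exists_bound_logCutoff`), and `p` with its `ξ`-derivatives is `O(A e^{ρ/m})`;
each derivative in `u` costs a factor `e^{-ρ}`. The angle is `O(|p| + |dp/du|)` even for steep
graphs (`exists_bound_graphAngle`), so `ε = O(A e^{ρ/m - ρ})` and `dε = O(A e^{ρ/m - 2ρ})`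
(`exists_log_estimate`); `e^ρ ≥ t^{c₁}` gives the powers of `t`. These bounds suffice on `Q_j`: the
other summands of the claim are nonnegative.

On `K^t` the map is `ι ∘ f`, whose phase is zero (`phase_specialLagrangian`). -/

noncomputable section

namespace BranchedSL

/-! ### Real smoothness of a holomorphic coefficient. -/

section Holomorphic

variable {E : Type*} [NormedAddCommGroup E] [NormedSpace ℂ E]

/-- A nowhere vanishing holomorphic function with smooth modulus is smooth. -/
theorem contDiffOn_of_norm_sq {D : Set E} (hD : IsOpen D) {F : E → ℂ}
    (hF : DifferentiableOn ℂ F D) (h0 : ∀ z ∈ D, F z ≠ 0)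
    (hu : ContDiffOn ℝ ∞ (fun z => ‖F z‖ ^ 2) D) : ContDiffOn ℝ ∞ F D := by
  set u : E → ℝ := fun z => ‖F z‖ ^ 2 with hudef
  let mulI : E →L[ℝ] E := Complex.I • ContinuousLinearMap.id ℝ E
  let T : (E →L[ℝ] ℝ) → (E →L[ℝ] ℂ) := fun L =>
    Complex.ofRealCLM.comp L - Complex.I • Complex.ofRealCLM.comp (L.comp mulI)
  have hT : ∀ L v, T L v = (L v : ℂ) - Complex.I * (L (Complex.I • v) : ℂ) := fun L v => by
    simp [T, mulI]
  have hdiff : DifferentiableOn ℝ F D := hF.restrictScalars ℝ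
  -- From `u = F F̄` the complex linear part of `du` satisfies `du(v) - i du(iv) = 2 F̄ dF(v)`.
  -- Dividing by `2 F̄ = 2u / F` expresses `dF` by `F` and `du` alone.
  have hfd : ∀ z ∈ D, fderiv ℝ F z = (F z / (2 * (u z : ℂ))) • T (fderiv ℝ u z) := by
    intro z hz
    have hFz : DifferentiableAt ℂ F z := (hF z hz).differentiableAt (hD.mem_nhds hz)
    have hFr : HasFDerivAt F ((fderiv ℂ F z).restrictScalars ℝ) z :=
      hFz.hasFDerivAt.restrictScalars ℝ
    have hud : HasFDerivAt u (2 • (innerSL ℝ (F z)).comp ((fderiv ℂ F z).restrictScalars ℝ)) z :=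
      hFr.norm_sq
    rw [hFr.fderiv, hud.fderiv]
    ext v
    rw [_root_.smul_apply, hT]
    have e1 : ∀ w : E, (2 • (innerSL ℝ (F z)).comp ((fderiv ℂ F z).restrictScalars ℝ)) w
        = 2 * ((starRingEnd ℂ (F z)) * fderiv ℂ F z w).re := fun w => by
      simp [Complex.inner]
      ring
    rw [e1, e1]
    have hne := h0 z hz
    have hu' : ((u z : ℝ) : ℂ) = F z * starRingEnd ℂ (F z) := by
      rw [Complex.mul_conj, Complex.normSq_eq_norm_sq]
    have hcne : (starRingEnd ℂ) (F z) ≠ 0 := by simpa using hne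
    have e2 : ∀ c : ℂ, ((2 * c.re : ℝ) : ℂ) - Complex.I * ((2 * (Complex.I * c).re : ℝ) : ℂ)
        = 2 * c := fun c => by
      apply Complex.ext <;> simp
    have e3 : (starRingEnd ℂ) (F z) * (fderiv ℂ F z) (Complex.I • v)
        = Complex.I * ((starRingEnd ℂ) (F z) * (fderiv ℂ F z) v) := by
      rw [map_smul, smul_eq_mul]; ring
    rw [e3, e2, hu', smul_eq_mul]
    simp only [ContinuousLinearMap.coe_restrictScalars']
    field_simp
  rw [contDiffOn_infty]
  intro n
  -- Bootstrapping: if `F` is `C^n`, the formula for `dF` is `C^n` because `u` is smooth, so `F` is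
  -- `C^{n+1}`.
  induction n with
  | zero => exact contDiffOn_zero.2 hdiff.continuousOn
  | succ n ih =>
    rw [Nat.cast_succ, contDiffOn_succ_iff_fderiv_of_isOpen hD]
    refine ⟨hdiff, by simp, ?_⟩
    refine ContDiffOn.congr ?_ hfd
    have hun : ContDiffOn ℝ n u D := hu.of_le (by exact_mod_cast le_top)
    have hdu : ContDiffOn ℝ n (fderiv ℝ u) D :=
      hu.fderiv_of_isOpen hD (by exact_mod_cast le_top)
    have h1 : ContDiffOn ℝ n (fun z => (2 * (u z : ℂ))) D :=
      contDiffOn_const.mul (Complex.ofRealCLM.contDiff.comp_contDiffOn hun)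
    have hTd : ContDiffOn ℝ n (fun z => T (fderiv ℝ u z)) D :=
      (contDiffOn_const.clm_comp hdu).sub
        ((contDiffOn_const.clm_comp (hdu.clm_comp contDiffOn_const)).const_smul Complex.I)
    have hq : ContDiffOn ℝ n (fun z => F z / (2 * (u z : ℂ))) D := by
      refine (ih.mul (h1.inv fun z hz => ?_)).congr fun z _ => div_eq_mul_inv _ _
      have := h0 z hz
      simp [u, this]
    exact hq.smul hTd

end Holomorphic

/-! ### Smooth dependence of the metric on moving points and vectors. -/

section Smooth

variable {Y : Type*} [TopologicalSpace Y] [ChartedSpace C3 Y] [IsManifold 𝓘(ℂ, C3) ω Y]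
  {V : Type*} [NormedAddCommGroup V] [NormedSpace ℝ V]
  {P : Type*} [NormedAddCommGroup P] [NormedSpace ℝ P]

/-- Applying the derivative of a smooth map to a smoothly varying vector is smooth. -/
theorem contMDiffAt_mfderiv_vector {G : V → Y} {a w : P → V} {p₀ : P}
    (hG : ContMDiffAt 𝓘(ℝ, V) 𝓘(ℝ, C3) ∞ G (a p₀)) (ha : ContDiffAt ℝ ∞ a p₀)
    (hw : ContDiffAt ℝ ∞ w p₀) :
    ContMDiffAt 𝓘(ℝ, P) (𝓘(ℝ, C3).prod 𝓘(ℝ, C3)) ∞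
      (fun p => (⟨G (a p), mfderiv 𝓘(ℝ, V) 𝓘(ℝ, C3) G (a p) (w p)⟩ :
        TangentBundle 𝓘(ℝ, C3) Y)) p₀ := by
  have hG1 : ContMDiffAt 𝓘(ℝ, P) 𝓘(ℝ, C3) ∞ (fun p => G (a p)) p₀ :=
    ContMDiffAt.comp p₀ hG ha.contMDiffAt
  refine ContMDiffAt.clm_apply_of_inCoordinates (IM := 𝓘(ℝ, P)) (IB₁ := 𝓘(ℝ, V)) (F₁ := V) (E₁ := (TangentSpace 𝓘(ℝ, V) : V → Type _))
    (b₁ := a) (v := w) (ϕ := fun p => mfderiv 𝓘(ℝ, V) 𝓘(ℝ, C3) G (a p)) ?_ ?_ hG1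
  · exact (ContMDiffAt.mfderiv_const hG (m := ∞) (by simp)).comp p₀ ha.contMDiffAt
  · rw [Bundle.contMDiffAt_totalSpace]
    refine ⟨ha.contMDiffAt, ?_⟩
    simp
    exact hw.contMDiffAt

theorem contDiffAt_metric (cy : CalabiYau Y) {G : V → Y} {a v w : P → V} {p₀ : P}
    (hG : ContMDiffAt 𝓘(ℝ, V) 𝓘(ℝ, C3) ∞ G (a p₀)) (ha : ContDiffAt ℝ ∞ a p₀)
    (hv : ContDiffAt ℝ ∞ v p₀) (hw : ContDiffAt ℝ ∞ w p₀) :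
    ContDiffAt ℝ ∞ (fun p => cy.g.inner (G (a p)) (mfderiv 𝓘(ℝ, V) 𝓘(ℝ, C3) G (a p) (v p))
      (mfderiv 𝓘(ℝ, V) 𝓘(ℝ, C3) G (a p) (w p))) p₀ := by
  have h := cy.g.contMDiff (G (a p₀))
  have h1 := contMDiffAt_mfderiv_vector hG ha hv
  have h2 := contMDiffAt_mfderiv_vector hG ha hw
  have h3 := (h.comp (a p₀) hG).comp p₀ ha.contMDiffAt
  have := ContMDiffAt.clm_bundle_apply₂ (E₃ := Bundle.Trivial Y ℝ) (F₃ := ℝ) h3 h1 h2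
  rw [Bundle.contMDiffAt_totalSpace] at this
  have := this.2
  simp at this
  exact this.contDiffAt

/-- A complex derivative is a real derivative. -/
theorem mfderiv_real {E₁ E₂ : Type*} [NormedAddCommGroup E₁] [NormedSpace ℂ E₁]
    [NormedAddCommGroup E₂] [NormedSpace ℂ E₂] {M N : Type*} [TopologicalSpace M]
    [ChartedSpace E₁ M] [TopologicalSpace N] [ChartedSpace E₂ N] {f : M → N} {x : M}
    (h : MDifferentiableAt 𝓘(ℂ, E₁) 𝓘(ℂ, E₂) f x) (v : E₁) :
    (mfderiv 𝓘(ℝ, E₁) 𝓘(ℝ, E₂) f x (v : E₁) : E₂) =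
      (mfderiv 𝓘(ℂ, E₁) 𝓘(ℂ, E₂) f x (v : E₁) : E₂) := by
  let L : E₁ →L[ℂ] E₂ := mfderiv 𝓘(ℂ, E₁) 𝓘(ℂ, E₂) f x
  have h2 := h.hasMFDerivAt
  have h3 : HasFDerivWithinAt (writtenInExtChartAt 𝓘(ℂ, E₁) 𝓘(ℂ, E₂) x f) L _ _ := h2.2
  have h4 : HasMFDerivAt 𝓘(ℝ, E₁) 𝓘(ℝ, E₂) f x (L.restrictScalars ℝ :) :=
    ⟨h2.1, h3.restrictScalars ℝ⟩
  have h5 : (L.restrictScalars ℝ : E₁ →L[ℝ] E₂) = mfderiv 𝓘(ℝ, E₁) 𝓘(ℝ, E₂) f x := h4.mfderiv.symm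
  exact (congrArg (fun K : E₁ →L[ℝ] E₂ => K v) h5).symm

end Smooth

/-! ### Nondegeneracy of `Ω`. -/

section Hermitian

variable {Y : Type*} [TopologicalSpace Y] [ChartedSpace C3 Y] [IsManifold 𝓘(ℂ, C3) ω Y]
  (cy : CalabiYau Y)

omit [IsManifold 𝓘(ℂ, C3) ω Y] in
theorem J_J (y : Y) (v : TangentSpace 𝓘(ℝ, C3) y) : J y (J y v) = -v := by
  have h (c : C3) : Complex.I • Complex.I • c = -c := by
    rw [smul_smul, Complex.I_mul_I, neg_one_smul]
  exact h v

theorem g_J_left (y : Y) (v w : TangentSpace 𝓘(ℝ, C3) y) :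
    cy.g.inner y (J y v) w = - cy.g.inner y v (J y w) := by
  have := cy.g_J y v (J y w)
  rw [J_J, map_neg] at this
  linarith

/-- By the normalization, `Ω(v) = 0` makes the Hermitian Gram matrix singular. A kernel vector `x`
yields `w = ∑ x_k v_k` with `h(v_j, w) = 0` for all `j`, so `g(w, w) = 0` and `w = 0`, against
complex independence. -/
theorem Omega_ne_zero (y : Y) (v : Fin 3 → C3) (hv : LinearIndependent ℂ v) :
    cy.Omega y v ≠ 0 := by
  intro h0
  have hn := cy.Omega_norm y v
  have h1 : (cy.Omega y v) = 0 := h0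
  rw [h1] at hn
  simp only [norm_zero, ne_eq, OfNat.ofNat_ne_zero, not_false_eq_true, zero_pow,
    Complex.ofReal_zero] at hn
  obtain ⟨x, hx0, hx⟩ := Matrix.exists_mulVec_eq_zero_iff.2 hn.symm
  let g : C3 → C3 → ℝ := fun v w => cy.g.inner y v w
  let w : C3 := ∑ k, x k • v k
  have gadd : ∀ a b c, g a (b + c) = g a b + g a c := fun a b c => (cy.g.inner y a).map_add b c
  have gsmul : ∀ a (r : ℝ) c, g a (r • c) = r * g a c := fun a r c => (cy.g.inner y a).map_smul r c
  have gI : ∀ a c, g a (Complex.I • c) = - g (Complex.I • a) c := fun a c => by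
    have := g_J_left cy y a c
    change _ = - cy.g.inner y (J y a) c
    rw [this]; simp; rfl
  have gII : ∀ a c, g (Complex.I • a) (Complex.I • c) = g a c := fun a c => cy.g_J y a c
  have key : ∀ (a : C3) (z : ℂ) (c : C3), ((g a (z • c) : ℝ) : ℂ) + Complex.I * g (Complex.I • a) (z • c)
      = z * ((g a c : ℝ) + Complex.I * g (Complex.I • a) c) := by
    intro a z c
    have hz : z • c = z.re • c + z.im • (Complex.I • c) := by
      conv_lhs => rw [← Complex.re_add_im z]
      rw [add_smul, mul_smul]; rfl
    rw [hz, gadd, gadd, gsmul, gsmul, gsmul, gsmul, gI, gII]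
    apply Complex.ext <;> simp <;> ring
  have hrow : ∀ j, ((g (v j) w : ℝ) : ℂ) + Complex.I * g (Complex.I • v j) w = 0 := by
    intro j
    have := congrFun hx j
    simp only [Matrix.mulVec, dotProduct, Matrix.of_apply, Pi.zero_apply] at this
    rw [← this]
    have gsum : ∀ a, g a w = ∑ k, g a (x k • v k) := fun a => map_sum (cy.g.inner y a) _ _
    rw [gsum, gsum]
    push_cast
    rw [Finset.mul_sum, ← Finset.sum_add_distrib]
    refine Finset.sum_congr rfl fun k _ => ?_
    rw [key, mul_comm]
    congr 3
    exact congrArg Complex.ofReal (cy.kahler_eq y (v j) (v k)).symm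
  have hg : ∀ j, g (v j) w = 0 ∧ g (Complex.I • v j) w = 0 := fun j => by
    have := hrow j
    constructor
    · simpa using congrArg Complex.re this
    · simpa using congrArg Complex.im this
  have gsymm : ∀ a b, g a b = g b a := fun a b => cy.g.symm y a b
  have hww : g w w = 0 := by
    have gsum : ∀ a, g a w = ∑ k, g a (x k • v k) := fun a => map_sum (cy.g.inner y a) _ _
    rw [gsum]
    refine Finset.sum_eq_zero fun k _ => ?_
    have hz : x k • v k = (x k).re • v k + (x k).im • (Complex.I • v k) := by
      conv_lhs => rw [← Complex.re_add_im (x k)]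
      rw [add_smul, mul_smul]; rfl
    rw [hz, gadd, gsmul, gsmul, gsymm w, gsymm w, (hg k).1, (hg k).2]
    simp
  have hw0 : w = 0 := by
    by_contra hne
    exact (cy.g.pos y w hne).ne' hww
  exact hx0 (funext fun k => Fintype.linearIndependent_iff.1 hv x hw0 k)

end Hermitian


/-! ### Dependence of the angle on the frame. -/

section Frames

/-- An alternating form in top degree picks up the determinant under a change of frame. -/
theorem alternating_frame_change {R E : Type*} [CommRing R] [AddCommGroup E] [Module R E]
    (f : E [⋀^Fin 3]→ₗ[R] R) (v : Fin 3 → E) (M : Matrix (Fin 3) (Fin 3) R) :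
    f (fun i => ∑ k, M i k • v k) = M.det * f v := by
  have h := AlternatingMap.eq_smul_basis_det (Pi.basisFun R (Fin 3))
    (f.compLinearMap (Fintype.linearCombination R v))
  have h2 := congrArg (fun g => g (fun i => M i)) h
  simp only [AlternatingMap.compLinearMap_apply, AlternatingMap.smul_apply, smul_eq_mul,
    Pi.basisFun_det, Fintype.linearCombination_apply] at h2
  rw [h2, mul_comm]
  congr 1
  congr 1
  funext i
  simp [Pi.basisFun_apply, Pi.single_apply]

variable {Y : Type*} [TopologicalSpace Y] [ChartedSpace C3 Y] [IsManifold 𝓘(ℂ, C3) ω Y]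
  (cy : CalabiYau Y)

/-- The Gram matrix of three tangent vectors. -/
def gram (y : Y) (v : Fin 3 → TangentSpace 𝓘(ℝ, C3) y) : Matrix (Fin 3) (Fin 3) ℝ :=
  Matrix.of fun i k => cy.g.inner y (v i) (v k)

/-- `Im (Ω / vol)` evaluated on a frame. -/
def angle (y : Y) (v : Fin 3 → TangentSpace 𝓘(ℝ, C3) y) : ℝ :=
  (cy.OmegaR y v / (Real.sqrt (gram cy y v).det : ℂ)).im

theorem angle_eq (y : Y) (v : Fin 3 → TangentSpace 𝓘(ℝ, C3) y) :
    angle cy y v = (cy.OmegaR y v).im / Real.sqrt (gram cy y v).det := by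
  rw [angle, Complex.div_ofReal_im]

theorem OmegaR_frame_change (y : Y) (v : Fin 3 → TangentSpace 𝓘(ℝ, C3) y)
    (M : Matrix (Fin 3) (Fin 3) ℝ) :
    cy.OmegaR y (fun i => ∑ k, M i k • v k) = (M.det : ℂ) * cy.OmegaR y v := by
  have h := alternating_frame_change (R := ℂ) (E := C3) (cy.Omega y).toAlternatingMap v
    (M.map Complex.ofReal)
  have hd : (M.map Complex.ofReal).det = (M.det : ℂ) :=
    (RingHom.map_det Complex.ofRealHom M).symm
  rw [hd] at h
  exact h

theorem gram_frame_change (y : Y) (v : Fin 3 → TangentSpace 𝓘(ℝ, C3) y)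
    (M : Matrix (Fin 3) (Fin 3) ℝ) :
    gram cy y (fun i => ∑ k, M i k • v k) = M * gram cy y v * M.transpose := by
  ext i k
  simp only [gram, Matrix.of_apply, Matrix.mul_apply, Matrix.transpose_apply, map_sum, map_smul,
    _root_.sum_apply, _root_.smul_apply, smul_eq_mul, Finset.sum_mul]
  rw [Finset.sum_congr rfl fun c _ => Finset.mul_sum _ _ _]
  refine Finset.sum_congr rfl fun a _ => Finset.sum_congr rfl fun b _ => ?_
  ring

/-- `Ω` scales by `det M` and the volume by `|det M|`, so only the sign of the determinant survives.
-/
theorem angle_frame_change (y : Y) (v : Fin 3 → TangentSpace 𝓘(ℝ, C3) y)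
    (M : Matrix (Fin 3) (Fin 3) ℝ) :
    angle cy y (fun i => ∑ k, M i k • v k) = M.det / |M.det| * angle cy y v := by
  rw [angle_eq, angle_eq, OmegaR_frame_change, gram_frame_change, Matrix.det_mul, Matrix.det_mul,
    Matrix.det_transpose, Complex.im_ofReal_mul]
  have : M.det * (gram cy y v).det * M.det = M.det ^ 2 * (gram cy y v).det := by ring
  rw [this, Real.sqrt_mul (sq_nonneg _), Real.sqrt_sq_eq_abs, mul_div_mul_comm]

theorem gram_det_pos (y : Y) (v : Fin 3 → TangentSpace 𝓘(ℝ, C3) y)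
    (hv : LinearIndependent ℝ v) : 0 < (gram cy y v).det := by
  have : (gram cy y v).PosDef := by
    refine Matrix.PosDef.of_dotProduct_mulVec_pos ?_ fun x hx => ?_
    · ext i k
      simp [gram, cy.g.symm y (v k) (v i)]
    · have h1 : star x ⬝ᵥ (gram cy y v).mulVec x
          = cy.g.inner y (∑ i, x i • v i) (∑ i, x i • v i) := by
        simp only [gram, dotProduct, Matrix.mulVec, Matrix.of_apply, map_sum, map_smul,
          _root_.sum_apply, _root_.smul_apply, smul_eq_mul, star_trivial]
        refine Finset.sum_congr rfl fun a _ => ?_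
        rw [Finset.mul_sum, Finset.mul_sum]
        refine Finset.sum_congr rfl fun b _ => ?_
        rw [cy.g.symm y (v b) (v a)]
        ring
      rw [h1]
      refine cy.g.pos y _ fun h0 => hx ?_
      exact funext fun k => Fintype.linearIndependent_iff.1 hv x h0 k
  exact this.det_pos

end Frames

/-! ### Smoothness of `Ω` and of the angle on moving frames. -/

section FrameAngle

variable {Y : Type*} [TopologicalSpace Y] [ChartedSpace C3 Y] [IsManifold 𝓘(ℂ, C3) ω Y]
  (cy : CalabiYau Y)
  {V : Type*} [NormedAddCommGroup V] [NormedSpace ℝ V]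
  {P : Type*} [NormedAddCommGroup P] [NormedSpace ℝ P]

/-- The coefficient of `Ω` in a chart is smooth. -/
theorem contDiffOn_Omega_coeff {φ : OpenPartialHomeomorph Y C3} (hφ : φ ∈ atlas C3 Y) :
    ContDiffOn ℝ ∞ (fun z : C3 => cy.Omega (φ.symm z) (fun i =>
      mfderiv 𝓘(ℂ, C3) 𝓘(ℂ, C3) φ.symm z (EuclideanSpace.single i (1 : ℂ) : C3))) φ.target := by
  have hmem : φ ∈ IsManifold.maximalAtlas 𝓘(ℂ, C3) ω Y := IsManifold.subset_maximalAtlas hφ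
  have hmemR : φ ∈ IsManifold.maximalAtlas 𝓘(ℝ, C3) ∞ Y := IsManifold.subset_maximalAtlas hφ
  have hsymm : ∀ z ∈ φ.target, MDifferentiableAt 𝓘(ℂ, C3) 𝓘(ℂ, C3) φ.symm z := fun z hz =>
    ((contMDiffOn_symm_of_mem_maximalAtlas hmem).contMDiffAt
      (φ.open_target.mem_nhds hz)).mdifferentiableAt (by simp)
  have hsmooth : ∀ z ∈ φ.target, ContMDiffAt 𝓘(ℝ, C3) 𝓘(ℝ, C3) ∞ φ.symm z := fun z hz =>
    (contMDiffOn_symm_of_mem_maximalAtlas hmemR).contMDiffAt (φ.open_target.mem_nhds hz)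
  let e : Fin 3 → C3 := fun i => EuclideanSpace.single i (1 : ℂ)
  have heq : ∀ z ∈ φ.target, ∀ c : C3, (mfderiv 𝓘(ℂ, C3) 𝓘(ℂ, C3) φ.symm z (c : C3) : C3)
      = (mfderiv 𝓘(ℝ, C3) 𝓘(ℝ, C3) φ.symm z (c : C3) : C3) := fun z hz c =>
    (mfderiv_real (hsymm z hz) c).symm
  have hinj : ∀ z ∈ φ.target, Function.Injective (mfderiv 𝓘(ℂ, C3) 𝓘(ℂ, C3) φ.symm z) := by
    intro z hz
    have hd : φ ∈ IsManifold.maximalAtlas 𝓘(ℂ, C3) 1 Y :=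
      IsManifold.maximalAtlas_subset_of_le (by simp) hmem
    have h1 : MDifferentiableAt 𝓘(ℂ, C3) 𝓘(ℂ, C3) φ (φ.symm z) :=
      ((contMDiffOn_of_mem_maximalAtlas hmem).contMDiffAt
        (φ.open_source.mem_nhds (φ.map_target hz))).mdifferentiableAt (by simp)
    have h2 := mfderiv_comp z h1 (hsymm z hz)
    have h3 : mfderiv 𝓘(ℂ, C3) 𝓘(ℂ, C3) (φ ∘ φ.symm) z = ContinuousLinearMap.id ℂ C3 := by
      have : (φ ∘ φ.symm) =ᶠ[𝓝 z] id := by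
        filter_upwards [φ.open_target.mem_nhds hz] with w hw using φ.right_inv hw
      rw [this.mfderiv_eq, mfderiv_id]
      rfl
    rw [h3] at h2
    intro v w hvw
    have := congrArg (fun L : C3 →L[ℂ] C3 => L v) h2
    have h' := congrArg (fun L : C3 →L[ℂ] C3 => L w) h2
    refine (this.trans ?_).trans h'.symm
    exact congrArg (mfderiv 𝓘(ℂ, C3) 𝓘(ℂ, C3) φ (φ.symm z)) hvw
  refine contDiffOn_of_norm_sq φ.open_target (cy.Omega_holomorphic φ hφ) ?_ ?_
  · intro z hz
    refine Omega_ne_zero cy _ _ ?_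
    have hL : LinearIndependent ℂ e := by
      have := (EuclideanSpace.basisFun (Fin 3) ℂ).toBasis.linearIndependent
      have he : e = (EuclideanSpace.basisFun (Fin 3) ℂ).toBasis := by
        funext i
        simp [e]
      rw [he]
      exact this
    exact hL.map' (mfderiv 𝓘(ℂ, C3) 𝓘(ℂ, C3) φ.symm z : C3 →L[ℂ] C3).toLinearMap
      (LinearMap.ker_eq_bot.2 (hinj z hz))
  -- The normalization of `Ω` expresses `|F|²` by the metric. Since the derivative of the inverse
  -- chart is complex linear, `J` is multiplication by `i` on the chart side, and only real
  -- derivatives remain.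
  · have hreal : ∀ z ∈ φ.target, ‖cy.Omega (φ.symm z) (fun i =>
      mfderiv 𝓘(ℂ, C3) 𝓘(ℂ, C3) φ.symm z (e i))‖ ^ 2 = (Matrix.det (Matrix.of fun j k : Fin 3 =>
      ((cy.g.inner (φ.symm z) (mfderiv 𝓘(ℝ, C3) 𝓘(ℝ, C3) φ.symm z (e j))
          (mfderiv 𝓘(ℝ, C3) 𝓘(ℝ, C3) φ.symm z (e k)) : ℝ) : ℂ) + Complex.I *
      ((cy.g.inner (φ.symm z) (mfderiv 𝓘(ℝ, C3) 𝓘(ℝ, C3) φ.symm z (Complex.I • e j : C3))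
          (mfderiv 𝓘(ℝ, C3) 𝓘(ℝ, C3) φ.symm z (e k)) : ℝ) : ℂ))).re := by
      intro z hz
      have h := cy.Omega_norm (φ.symm z) (fun i => mfderiv 𝓘(ℝ, C3) 𝓘(ℝ, C3) φ.symm z (e i))
      have h' := congrArg Complex.re h
      rw [Complex.ofReal_re] at h'
      have hJ : ∀ j, J (φ.symm z) (mfderiv 𝓘(ℝ, C3) 𝓘(ℝ, C3) φ.symm z (e j))
          = mfderiv 𝓘(ℝ, C3) 𝓘(ℝ, C3) φ.symm z (Complex.I • e j : C3) := by
        intro j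
        have a1 := heq z hz (e j)
        have a2 := heq z hz (Complex.I • e j)
        have a3 : (mfderiv 𝓘(ℂ, C3) 𝓘(ℂ, C3) φ.symm z (Complex.I • e j : C3) : C3)
            = Complex.I • (mfderiv 𝓘(ℂ, C3) 𝓘(ℂ, C3) φ.symm z (e j : C3) : C3) :=
          (mfderiv 𝓘(ℂ, C3) 𝓘(ℂ, C3) φ.symm z : C3 →L[ℂ] C3).map_smul _ _
        rw [a1, a2] at a3
        exact a3.symm
      simp only [cy.kahler_eq, hJ] at h'
      have hfe : (fun i => (mfderiv 𝓘(ℂ, C3) 𝓘(ℂ, C3) φ.symm z (e i : C3) : C3))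
          = fun i => (mfderiv 𝓘(ℝ, C3) 𝓘(ℝ, C3) φ.symm z (e i : C3) : C3) :=
        funext fun i => heq z hz (e i)
      refine Eq.trans ?_ h'
      exact congrArg (fun c : Fin 3 → C3 => ‖cy.Omega (φ.symm z) c‖ ^ 2) hfe
    refine ContDiffOn.congr ?_ hreal
    intro z hz
    refine ContDiffAt.contDiffWithinAt ?_
    have hsm := hsmooth z hz
    have hent : ∀ a b : C3, ContDiffAt ℝ ∞ (fun z : C3 => cy.g.inner (φ.symm z)
        (mfderiv 𝓘(ℝ, C3) 𝓘(ℝ, C3) φ.symm z (a : C3))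
        (mfderiv 𝓘(ℝ, C3) 𝓘(ℝ, C3) φ.symm z (b : C3))) z := fun a b =>
      contDiffAt_metric cy (a := fun z => z) (v := fun _ => a) (w := fun _ => b) hsm
        contDiffAt_id contDiffAt_const contDiffAt_const
    have hof : ∀ {r : C3 → ℝ}, ContDiffAt ℝ ∞ r z → ContDiffAt ℝ ∞ (fun z => (r z : ℂ)) z :=
      fun h => Complex.ofRealCLM.contDiff.contDiffAt.comp z h
    have hre : ∀ {r : C3 → ℂ}, ContDiffAt ℝ ∞ r z → ContDiffAt ℝ ∞ (fun z => (r z).re) z :=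
      fun h => Complex.reCLM.contDiff.contDiffAt.comp z h
    apply hre
    simp only [Matrix.det_fin_three, Matrix.of_apply]
    have hE : ∀ j k, ContDiffAt ℝ ∞ (fun z : C3 =>
      ((cy.g.inner (φ.symm z) (mfderiv 𝓘(ℝ, C3) 𝓘(ℝ, C3) φ.symm z (e j))
          (mfderiv 𝓘(ℝ, C3) 𝓘(ℝ, C3) φ.symm z (e k)) : ℝ) : ℂ) + Complex.I *
      ((cy.g.inner (φ.symm z) (mfderiv 𝓘(ℝ, C3) 𝓘(ℝ, C3) φ.symm z (Complex.I • e j : C3))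
          (mfderiv 𝓘(ℝ, C3) 𝓘(ℝ, C3) φ.symm z (e k)) : ℝ) : ℂ)) z := fun j k =>
      (hof (hent _ _)).add (contDiffAt_const.mul (hof (hent _ _)))
    exact ((((((hE 0 0).mul (hE 1 1)).mul (hE 2 2)).sub (((hE 0 0).mul (hE 1 2)).mul (hE 2 1))).sub
      (((hE 0 1).mul (hE 1 0)).mul (hE 2 2))).add (((hE 0 1).mul (hE 1 2)).mul (hE 2 0))).add
      (((hE 0 2).mul (hE 1 0)).mul (hE 2 1)) |>.sub (((hE 0 2).mul (hE 1 1)).mul (hE 2 0))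

/-- `Ω` on the images of smoothly varying vectors is smooth. -/
theorem contDiffAt_OmegaR {G : V → Y} {a : P → V} {v : Fin 3 → P → V} {p₀ : P}
    (hG : ContMDiffAt 𝓘(ℝ, V) 𝓘(ℝ, C3) ∞ G (a p₀)) (ha : ContDiffAt ℝ ∞ a p₀)
    (hv : ∀ i, ContDiffAt ℝ ∞ (v i) p₀) :
    ContDiffAt ℝ ∞ (fun p => cy.OmegaR (G (a p))
      (fun i => mfderiv 𝓘(ℝ, V) 𝓘(ℝ, C3) G (a p) (v i p))) p₀ := by
  let φ := chartAt C3 (G (a p₀))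
  have hφ : φ ∈ atlas C3 Y := chart_mem_atlas _ _
  have hmem : φ ∈ IsManifold.maximalAtlas 𝓘(ℂ, C3) ω Y := IsManifold.subset_maximalAtlas hφ
  have hmemR : φ ∈ IsManifold.maximalAtlas 𝓘(ℝ, C3) ∞ Y := IsManifold.subset_maximalAtlas hφ
  let e : Fin 3 → C3 := fun i => EuclideanSpace.single i (1 : ℂ)
  let F : C3 → ℂ := fun z => cy.Omega (φ.symm z) (fun i =>
      mfderiv 𝓘(ℂ, C3) 𝓘(ℂ, C3) φ.symm z (e i : C3))
  let H : V → C3 := fun q => φ (G q)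
  have hsrc : G (a p₀) ∈ φ.source := mem_chart_source _ _
  have hH : ContDiffAt ℝ ∞ H (a p₀) := by
    have h1 : ContMDiffAt 𝓘(ℝ, C3) 𝓘(ℝ, C3) ∞ φ (G (a p₀)) :=
      (contMDiffOn_of_mem_maximalAtlas hmemR).contMDiffAt (φ.open_source.mem_nhds hsrc)
    exact (h1.comp (a p₀) hG).contDiffAt
  have hGev : ∀ᶠ q in 𝓝 (a p₀), ContMDiffAt 𝓘(ℝ, V) 𝓘(ℝ, C3) 1 G q :=
    (contMDiffAt_iff_contMDiffAt_nhds (by simp)).1 (hG.of_le (by simp))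
  have hsev : ∀ᶠ q in 𝓝 (a p₀), G q ∈ φ.source :=
    hG.continuousAt.eventually (φ.open_source.mem_nhds hsrc)
  -- In a holomorphic chart `Ω = F dz₁ ∧ dz₂ ∧ dz₃`; the determinant is that of the chart components
  -- of the three vectors.
  have hformula : ∀ᶠ q in 𝓝 (a p₀), ∀ w : Fin 3 → V,
      cy.OmegaR (G q) (fun i => mfderiv 𝓘(ℝ, V) 𝓘(ℝ, C3) G q (w i))
        = (Matrix.of fun i k => (fderiv ℝ H q (w i)) k).det * F (H q) := by
    filter_upwards [hGev, hsev] with q hq hs w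
    have hz : φ (G q) ∈ φ.target := φ.map_source hs
    have hsymm : MDifferentiableAt 𝓘(ℂ, C3) 𝓘(ℂ, C3) φ.symm (φ (G q)) :=
      ((contMDiffOn_symm_of_mem_maximalAtlas hmem).contMDiffAt
        (φ.open_target.mem_nhds hz)).mdifferentiableAt (by simp)
    have hsymmR : MDifferentiableAt 𝓘(ℝ, C3) 𝓘(ℝ, C3) φ.symm (φ (G q)) :=
      ((contMDiffOn_symm_of_mem_maximalAtlas hmemR).contMDiffAt
        (φ.open_target.mem_nhds hz)).mdifferentiableAt (by simp)
    have hchart : MDifferentiableAt 𝓘(ℝ, C3) 𝓘(ℝ, C3) φ (G q) :=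
      ((contMDiffOn_of_mem_maximalAtlas hmemR).contMDiffAt
        (φ.open_source.mem_nhds hs)).mdifferentiableAt (by simp)
    have hHm : MDifferentiableAt 𝓘(ℝ, V) 𝓘(ℝ, C3) H q :=
      hchart.comp q (hq.mdifferentiableAt (by simp))
    have hcomp : G =ᶠ[𝓝 q] φ.symm ∘ H := by
      filter_upwards [hq.continuousAt.eventually (φ.open_source.mem_nhds hs)] with q' hq'
      exact (φ.left_inv hq').symm
    let A : C3 →L[ℂ] C3 := mfderiv 𝓘(ℂ, C3) 𝓘(ℂ, C3) φ.symm (φ (G q))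
    have hy : φ.symm (φ (G q)) = G q := φ.left_inv hs
    have hd : ∀ x : V, (mfderiv 𝓘(ℝ, V) 𝓘(ℝ, C3) G q (x : V) : C3) = A (fderiv ℝ H q x) := by
      intro x
      have h1 : (mfderiv 𝓘(ℝ, V) 𝓘(ℝ, C3) G q : V →L[ℝ] C3)
          = mfderiv 𝓘(ℝ, V) 𝓘(ℝ, C3) (φ.symm ∘ H) q := hcomp.mfderiv_eq
      have h2 := mfderiv_comp q hsymmR hHm
      rw [mfderiv_eq_fderiv] at h2
      have h3 := mfderiv_real hsymm (fderiv ℝ H q x)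
      refine Eq.trans ?_ h3
      exact congrArg (fun L : V →L[ℝ] C3 => L x) (h1.trans h2)
    have hsum : ∀ x : C3, A x = ∑ k, x k • A (e k) := by
      intro x
      have hx : x = ∑ k, x k • e k := by
        have := (EuclideanSpace.basisFun (Fin 3) ℂ).sum_repr x
        simpa [e] using this.symm
      conv_lhs => rw [hx]
      rw [map_sum]
      simp only [map_smul]
    have hfr := alternating_frame_change (R := ℂ) (E := C3) (cy.Omega (G q)).toAlternatingMap
      (fun k => A (e k)) (Matrix.of fun i k => (fderiv ℝ H q (w i)) k)
    have hF : F (H q) = (cy.Omega (G q)).toAlternatingMap (fun k => A (e k)) := by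
      have : ∀ y, y = G q → (cy.Omega y (fun k => A (e k)) : ℂ)
          = cy.Omega (G q) (fun k => A (e k)) := by
        rintro y rfl; rfl
      exact this _ hy
    rw [hF]
    refine Eq.trans ?_ hfr
    refine congrArg (fun c : Fin 3 → C3 => cy.Omega (G q) c) (funext fun i => ?_)
    exact (hd (w i)).trans (hsum _)
  have hev := ha.continuousAt.eventually hformula
  refine ContDiffAt.congr_of_eventuallyEq ?_ (hev.mono fun p hp => hp fun i => v i p)
  have hFs : ContDiffAt ℝ ∞ F (H (a p₀)) := (contDiffOn_Omega_coeff cy hφ).contDiffAt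
    (φ.open_target.mem_nhds (φ.map_source hsrc))
  have hFc : ContDiffAt ℝ ∞ (fun p => F (H (a p))) p₀ :=
    ContDiffAt.comp (g := F) (f := fun p => H (a p)) p₀ hFs
      (ContDiffAt.comp (g := H) (f := a) p₀ hH ha)
  refine ContDiffAt.mul ?_ hFc
  have hE : ∀ i k, ContDiffAt ℝ ∞ (fun p => (fderiv ℝ H (a p) (v i p)) k) p₀ := by
    intro i k
    have h1 : ContDiffAt ℝ ∞ (fun p => fderiv ℝ H (a p)) p₀ :=
      (hH.fderiv_right (m := ∞) (by simp)).comp p₀ ha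
    have h2 := h1.clm_apply (hv i)
    exact ((EuclideanSpace.proj k : C3 →L[ℂ] ℂ).restrictScalars ℝ).contDiff.contDiffAt.comp p₀ h2
  simp only [Matrix.det_fin_three, Matrix.of_apply]
  exact ((((((hE 0 0).mul (hE 1 1)).mul (hE 2 2)).sub (((hE 0 0).mul (hE 1 2)).mul (hE 2 1))).sub
    (((hE 0 1).mul (hE 1 0)).mul (hE 2 2))).add (((hE 0 1).mul (hE 1 2)).mul (hE 2 0))).add
    (((hE 0 2).mul (hE 1 0)).mul (hE 2 1)) |>.sub (((hE 0 2).mul (hE 1 1)).mul (hE 2 0))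

/-- The angle of the images of smoothly varying vectors is smooth. -/
theorem contDiffAt_angle {G : V → Y} {a : P → V} {v : Fin 3 → P → V} {p₀ : P}
    (hG : ContMDiffAt 𝓘(ℝ, V) 𝓘(ℝ, C3) ∞ G (a p₀)) (ha : ContDiffAt ℝ ∞ a p₀)
    (hv : ∀ i, ContDiffAt ℝ ∞ (v i) p₀)
    (hdet : 0 < (gram cy (G (a p₀))
      fun i => mfderiv 𝓘(ℝ, V) 𝓘(ℝ, C3) G (a p₀) (v i p₀)).det) :
    ContDiffAt ℝ ∞ (fun p => angle cy (G (a p))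
      (fun i => mfderiv 𝓘(ℝ, V) 𝓘(ℝ, C3) G (a p) (v i p))) p₀ := by
  simp only [angle_eq]
  have h1 : ContDiffAt ℝ ∞ (fun p => (cy.OmegaR (G (a p))
      (fun i => mfderiv 𝓘(ℝ, V) 𝓘(ℝ, C3) G (a p) (v i p))).im) p₀ :=
    Complex.imCLM.contDiff.contDiffAt.comp p₀ (contDiffAt_OmegaR cy hG ha hv)
  have h2 : ContDiffAt ℝ ∞ (fun p => (gram cy (G (a p))
      fun i => mfderiv 𝓘(ℝ, V) 𝓘(ℝ, C3) G (a p) (v i p)).det) p₀ := by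
    have hE : ∀ i k, ContDiffAt ℝ ∞ (fun p => cy.g.inner (G (a p))
        (mfderiv 𝓘(ℝ, V) 𝓘(ℝ, C3) G (a p) (v i p))
        (mfderiv 𝓘(ℝ, V) 𝓘(ℝ, C3) G (a p) (v k p))) p₀ := fun i k =>
      contDiffAt_metric cy hG ha (hv i) (hv k)
    simp only [gram, Matrix.det_fin_three, Matrix.of_apply]
    exact ((((((hE 0 0).mul (hE 1 1)).mul (hE 2 2)).sub (((hE 0 0).mul (hE 1 2)).mul (hE 2 1))).sub
      (((hE 0 1).mul (hE 1 0)).mul (hE 2 2))).add (((hE 0 1).mul (hE 1 2)).mul (hE 2 0))).add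
      (((hE 0 2).mul (hE 1 0)).mul (hE 2 1)) |>.sub (((hE 0 2).mul (hE 1 1)).mul (hE 2 0))
  exact h1.div (h2.sqrt hdet.ne') (Real.sqrt_pos.2 hdet).ne'

end FrameAngle


/-! ### Parametrizations of a manifold and the inverse function theorem. -/

section LocalParametrization

variable {E : Type*} [NormedAddCommGroup E] [NormedSpace ℝ E] [CompleteSpace E]
  {X : Type*} [TopologicalSpace X] [ChartedSpace R3 X] [IsManifold (𝓡 3) ∞ X]

-- Tangent vectors at `ψ w` are read in the preferred chart at `ψ w` itself, a chart that changes
-- with `w`.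
omit [CompleteSpace E] [IsManifold (𝓡 3) ∞ X] in
theorem mfderiv_eq_fderiv_chart {ψ : E → X} {w : E}
    (hψ : MDifferentiableAt 𝓘(ℝ, E) (𝓡 3) ψ w) :
    (mfderiv 𝓘(ℝ, E) (𝓡 3) ψ w : E →L[ℝ] R3) = fderiv ℝ (fun w' => chartAt R3 (ψ w) (ψ w')) w := by
  rw [hψ.mfderiv]
  simp [writtenInExtChartAt, Function.comp_def]
  rfl

omit [CompleteSpace E] in
theorem contDiffAt_chart_comp {ψ : E → X} {w : E} {n : ℕ∞}
    (hψ : ContMDiffAt 𝓘(ℝ, E) (𝓡 3) n ψ w)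
    {e : OpenPartialHomeomorph X R3} (he : e ∈ atlas R3 X) (hw : ψ w ∈ e.source) :
    ContDiffAt ℝ n (fun w' => e (ψ w')) w := by
  have hmem : e ∈ IsManifold.maximalAtlas (𝓡 3) ∞ X := IsManifold.subset_maximalAtlas he
  have h1 : ContMDiffAt (𝓡 3) 𝓘(ℝ, R3) n e (ψ w) :=
    ((contMDiffOn_of_mem_maximalAtlas hmem).contMDiffAt (e.open_source.mem_nhds hw)).of_le
      (by exact_mod_cast le_top)
  exact (h1.comp w hψ).contDiffAt

/-- The inverse function theorem for a parametrization of a manifold. -/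
theorem exists_local_inverse {ψ : E → X} {w₀ : E}
    (hψ : ContMDiffAt 𝓘(ℝ, E) (𝓡 3) ∞ ψ w₀)
    (hb : Function.Bijective (mfderiv 𝓘(ℝ, E) (𝓡 3) ψ w₀)) :
    ∃ σ : X → E, ContMDiffAt (𝓡 3) 𝓘(ℝ, E) ∞ σ (ψ w₀) ∧ σ (ψ w₀) = w₀ ∧
      (∀ᶠ w in 𝓝 w₀, σ (ψ w) = w) ∧ ∀ᶠ x in 𝓝 (ψ w₀), ψ (σ x) = x := by
  let e := chartAt R3 (ψ w₀)
  let k : E → R3 := fun w => e (ψ w)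
  have hk : ContDiffAt ℝ ∞ k w₀ :=
    contDiffAt_chart_comp hψ (chart_mem_atlas _ _) (mem_chart_source _ _)
  have hD : (mfderiv 𝓘(ℝ, E) (𝓡 3) ψ w₀ : E →L[ℝ] R3) = fderiv ℝ k w₀ :=
    mfderiv_eq_fderiv_chart (hψ.mdifferentiableAt (by simp))
  have hb' : Function.Bijective (fderiv ℝ k w₀) := by
    rw [← hD]; exact hb
  let L : E ≃L[ℝ] R3 := ContinuousLinearEquiv.ofBijective (fderiv ℝ k w₀)
    (LinearMap.ker_eq_bot.2 hb'.1) (LinearMap.range_eq_top.2 hb'.2)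
  have hL : HasFDerivAt k (L : E →L[ℝ] R3) w₀ := by
    have : (L : E →L[ℝ] R3) = fderiv ℝ k w₀ := by
      ext; simp [L]
    rw [this]
    exact (hk.differentiableAt (by simp)).hasFDerivAt
  let τ := hk.localInverse hL (by simp)
  have hτ : ContDiffAt ℝ ∞ τ (k w₀) := hk.to_localInverse hL (by simp)
  let Λ := hk.toOpenPartialHomeomorph k hL (by simp)
  have hsrc : w₀ ∈ Λ.source := hk.mem_toOpenPartialHomeomorph_source hL (by simp)
  have hτk : ∀ᶠ w in 𝓝 w₀, τ (k w) = w := by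
    filter_upwards [Λ.open_source.mem_nhds hsrc] with w hw using Λ.left_inv hw
  have hkτ : ∀ᶠ y in 𝓝 (k w₀), k (τ y) = y := by
    filter_upwards [Λ.open_target.mem_nhds (Λ.map_source hsrc)] with y hy using Λ.right_inv hy
  have hτ0 : τ (k w₀) = w₀ := hτk.self_of_nhds
  have he : ContMDiffAt (𝓡 3) 𝓘(ℝ, R3) ∞ e (ψ w₀) := contMDiffAt_of_mem_maximalAtlas
    (IsManifold.chart_mem_maximalAtlas _) (mem_chart_source _ _)
  have hσ : ContMDiffAt (𝓡 3) 𝓘(ℝ, E) ∞ (fun x => τ (e x)) (ψ w₀) :=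
    ContMDiffAt.comp (I' := 𝓘(ℝ, R3)) (g := τ) (ψ w₀) hτ.contMDiffAt he
  refine ⟨fun x => τ (e x), hσ, hτ0, hτk, ?_⟩
  have h1 : ∀ᶠ x in 𝓝 (ψ w₀), k (τ (e x)) = e x := he.continuousAt.eventually hkτ
  -- `h1` only identifies images under `e`; to cancel `e` the point `ψ (τ (e x))` must also lie in
  -- its source.
  have h2 : ∀ᶠ x in 𝓝 (ψ w₀), ψ (τ (e x)) ∈ e.source := by
    have hc : ContinuousAt (fun x => ψ (τ (e x))) (ψ w₀) := by
      refine ContinuousAt.comp (f := fun x => τ (e x)) (g := ψ) ?_ hσ.continuousAt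
      have : τ (e (ψ w₀)) = w₀ := hτ0
      rw [this]
      exact hψ.continuousAt
    refine hc.eventually (e.open_source.mem_nhds ?_)
    change ψ (τ (k w₀)) ∈ e.source
    rw [hτ0]
    exact mem_chart_source _ _
  filter_upwards [h1, h2, e.open_source.mem_nhds (mem_chart_source R3 (ψ w₀))] with x hx1 hx2 hx3
  exact e.injOn hx2 hx3 hx1

/-- Smoothness may be checked in a parametrization. -/
theorem contMDiffAt_of_param {E' : Type*} [NormedAddCommGroup E'] [NormedSpace ℝ E']
    {H' : Type*} [TopologicalSpace H'] {I' : ModelWithCorners ℝ E' H'}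
    {N : Type*} [TopologicalSpace N] [ChartedSpace H' N] {ψ : E → X} {w₀ : E}
    (hψ : ContMDiffAt 𝓘(ℝ, E) (𝓡 3) ∞ ψ w₀)
    (hb : Function.Bijective (mfderiv 𝓘(ℝ, E) (𝓡 3) ψ w₀)) {F : X → N} {H : E → N}
    (hH : ContMDiffAt 𝓘(ℝ, E) I' ∞ H w₀) (hFH : ∀ᶠ w in 𝓝 w₀, F (ψ w) = H w) :
    ContMDiffAt (𝓡 3) I' ∞ F (ψ w₀) := by
  obtain ⟨σ, hσ, hσ0, -, hr⟩ := exists_local_inverse hψ hb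
  have h1 : ContMDiffAt (𝓡 3) I' ∞ (H ∘ σ) (ψ w₀) := by
    refine ContMDiffAt.comp (ψ w₀) ?_ hσ
    rw [hσ0]; exact hH
  refine h1.congr_of_eventuallyEq ?_
  have h2 := hσ.continuousAt.eventually (by rw [hσ0]; exact hFH)
  filter_upwards [h2, hr] with x hx hx'
  rw [hx'] at hx
  exact hx

theorem mfderiv_param {E' : Type*} [NormedAddCommGroup E'] [NormedSpace ℝ E']
    {H' : Type*} [TopologicalSpace H'] {I' : ModelWithCorners ℝ E' H'}
    {N : Type*} [TopologicalSpace N] [ChartedSpace H' N] {ψ : E → X} {w₀ : E}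
    (hψ : ContMDiffAt 𝓘(ℝ, E) (𝓡 3) ∞ ψ w₀)
    (hb : Function.Bijective (mfderiv 𝓘(ℝ, E) (𝓡 3) ψ w₀)) {F : X → N} {H : E → N}
    (hH : ContMDiffAt 𝓘(ℝ, E) I' ∞ H w₀) (hFH : ∀ᶠ w in 𝓝 w₀, F (ψ w) = H w) (v : E) :
    (mfderiv (𝓡 3) I' F (ψ w₀) (mfderiv 𝓘(ℝ, E) (𝓡 3) ψ w₀ v) : E') = mfderiv 𝓘(ℝ, E) I' H w₀ v := by
  have hF := contMDiffAt_of_param hψ hb hH hFH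
  have h1 := mfderiv_comp w₀ (hF.mdifferentiableAt (by simp)) (hψ.mdifferentiableAt (by simp))
  have h2 : F ∘ ψ =ᶠ[𝓝 w₀] H := hFH
  have h3 : (mfderiv 𝓘(ℝ, E) I' H w₀ : E →L[ℝ] E') = mfderiv 𝓘(ℝ, E) I' (F ∘ ψ) w₀ :=
    h2.symm.mfderiv_eq
  exact (congrArg (fun L : E →L[ℝ] E' => L v) (h3.trans h1)).symm

end LocalParametrization

/-! ### The phase in a parametrization. -/

section Phase

variable {Y : Type*} [TopologicalSpace Y] [ChartedSpace C3 Y] [IsManifold 𝓘(ℂ, C3) ω Y]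
  (cy : CalabiYau Y)
  {E : Type*} [NormedAddCommGroup E] [NormedSpace ℝ E] [FiniteDimensional ℝ E]
  {X : Type*} [TopologicalSpace X] [ChartedSpace R3 X] [IsManifold (𝓡 3) ∞ X]

/-- The angle of the image of a frame `b` under the derivative of `H`. -/
def frameAngle (H : E → Y) (b : Fin 3 → E) (w : E) : ℝ :=
  angle cy (H w) fun i => mfderiv 𝓘(ℝ, E) 𝓘(ℝ, C3) H w (b i)

/-- The determinant of three vectors of `ℝ³`. -/
def det3 (v : Fin 3 → R3) : ℝ := (Matrix.of fun i k => v i k).det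

theorem det3_eq (v : Fin 3 → R3) : det3 v = (EuclideanSpace.basisFun (Fin 3) ℝ).toBasis.det v := by
  rw [Module.Basis.det_apply, det3, ← Matrix.det_transpose]
  rfl

theorem det3_comp (T : R3 →L[ℝ] R3) (v : Fin 3 → R3) :
    det3 (fun i => T (v i)) = T.det * det3 v := by
  rw [det3_eq, det3_eq]
  exact Module.Basis.det_comp _ (T : R3 →ₗ[ℝ] R3) v

theorem det3_ne_zero {v : Fin 3 → R3} (hv : LinearIndependent ℝ v) : det3 v ≠ 0 := by
  intro h
  obtain ⟨x, hx0, hx⟩ := Matrix.exists_vecMul_eq_zero_iff.2 h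
  refine hx0 (funext fun k => Fintype.linearIndependent_iff.1 hv x ?_ k)
  ext j
  have := congrFun hx j
  simpa [Matrix.vecMul, dotProduct] using this

theorem sum_single (c : R3) : ∑ k, c k • (EuclideanSpace.single k (1 : ℝ) : R3) = c := by
  have := (EuclideanSpace.basisFun (Fin 3) ℝ).sum_repr c
  simpa using this

variable [OrientedAtlas X]

/-- In a parametrization the phase is, up to a locally constant sign, the angle of the image
of a constant frame. -/
theorem exists_phase_eq {ψ : E → X} {w₀ : E} (hψ : ContMDiffAt 𝓘(ℝ, E) (𝓡 3) ∞ ψ w₀)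
    (hb : Function.Bijective (mfderiv 𝓘(ℝ, E) (𝓡 3) ψ w₀)) {b : Fin 3 → E}
    (hbas : LinearIndependent ℝ b) {F : X → Y} {H : E → Y}
    (hH : ContMDiffAt 𝓘(ℝ, E) 𝓘(ℝ, C3) ∞ H w₀) (hFH : ∀ᶠ w in 𝓝 w₀, F (ψ w) = H w) :
    ∃ s : ℝ, |s| = 1 ∧ ∀ᶠ w in 𝓝 w₀, phase cy F (ψ w) = s * frameAngle cy H b w := by
  let e := chartAt R3 (ψ w₀)
  -- `phase` uses the standard basis of the preferred chart at each point, which need not vary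
  -- continuously. Measured in the one chart `e` the determinant is continuous and nonzero, and
  -- passing to the preferred chart multiplies it by a positive factor, so the sign of `M.det` below
  -- is locally constant.
  let D : E → ℝ := fun w => det3 fun i => fderiv ℝ (fun w' => e (ψ w')) w (b i)
  have hF := contMDiffAt_of_param hψ hb hH hFH
  have hk : ContDiffAt ℝ ∞ (fun w' => e (ψ w')) w₀ :=
    contDiffAt_chart_comp hψ (chart_mem_atlas _ _) (mem_chart_source _ _)
  have hDc : ContinuousAt D w₀ := by
    have h1 : ContDiffAt ℝ ∞ (fun w => fderiv ℝ (fun w' => e (ψ w')) w) w₀ :=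
      hk.fderiv_right (m := ∞) (by simp)
    have hE : ∀ i k, ContinuousAt (fun w => (fderiv ℝ (fun w' => e (ψ w')) w (b i)) k) w₀ := by
      intro i k
      have h2 := (h1.clm_apply (contDiffAt_const (c := b i))).continuousAt
      exact (EuclideanSpace.proj k : R3 →L[ℝ] ℝ).continuous.continuousAt.comp h2
    simp only [D, det3, Matrix.det_fin_three, Matrix.of_apply]
    exact ((((((hE 0 0).mul (hE 1 1)).mul (hE 2 2)).sub (((hE 0 0).mul (hE 1 2)).mul (hE 2 1))).sub
      (((hE 0 1).mul (hE 1 0)).mul (hE 2 2))).add (((hE 0 1).mul (hE 1 2)).mul (hE 2 0))).add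
      (((hE 0 2).mul (hE 1 0)).mul (hE 2 1)) |>.sub (((hE 0 2).mul (hE 1 1)).mul (hE 2 0))
  have hD0 : D w₀ ≠ 0 := by
    have hD : (mfderiv 𝓘(ℝ, E) (𝓡 3) ψ w₀ : E →L[ℝ] R3) = fderiv ℝ (fun w' => e (ψ w')) w₀ :=
      mfderiv_eq_fderiv_chart (hψ.mdifferentiableAt (by simp))
    refine det3_ne_zero ?_
    refine hbas.map' (fderiv ℝ (fun w' => e (ψ w')) w₀).toLinearMap (LinearMap.ker_eq_bot.2 ?_)
    have h2 : Function.Injective (fderiv ℝ (fun w' => e (ψ w')) w₀) := by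
      rw [← hD]; exact hb.1
    exact h2
  let s := D w₀ / |D w₀|
  have hs : |s| = 1 := by
    rw [abs_div, abs_abs, div_self (abs_ne_zero.2 hD0)]
  have hsign : ∀ᶠ w in 𝓝 w₀, D w / |D w| = s := by
    rcases lt_or_gt_of_ne hD0 with h | h
    · filter_upwards [hDc.eventually_lt continuousAt_const h] with w hw
      rw [abs_of_neg hw, div_neg, div_self hw.ne]
      change -1 = D w₀ / |D w₀|
      rw [abs_of_neg h, div_neg, div_self h.ne]
    · filter_upwards [continuousAt_const.eventually_lt hDc h] with w hw
      rw [abs_of_pos hw, div_self hw.ne']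
      change 1 = D w₀ / |D w₀|
      rw [abs_of_pos h, div_self h.ne']
  have hne : ∀ᶠ w in 𝓝 w₀, D w ≠ 0 := hDc.eventually_ne hD0
  have hψ1 : ∀ᶠ w in 𝓝 w₀, ContMDiffAt 𝓘(ℝ, E) (𝓡 3) 1 ψ w :=
    (contMDiffAt_iff_contMDiffAt_nhds (by simp)).1 (hψ.of_le (by simp))
  have hF1 : ∀ᶠ w in 𝓝 w₀, ContMDiffAt (𝓡 3) 𝓘(ℝ, C3) 1 F (ψ w) :=
    hψ.continuousAt.eventually ((contMDiffAt_iff_contMDiffAt_nhds (by simp)).1 (hF.of_le (by simp)))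
  have hsrc : ∀ᶠ w in 𝓝 w₀, ψ w ∈ e.source :=
    hψ.continuousAt.eventually (e.open_source.mem_nhds (mem_chart_source _ _))
  refine ⟨s, hs, ?_⟩
  filter_upwards [hsign, hne, hψ1, hF1, hsrc, hFH.eventually_nhds]
    with w hw1 hw2 hw3 hw4 hw5 hw6
  let e' := chartAt R3 (ψ w)
  let v : Fin 3 → R3 := fun i => mfderiv 𝓘(ℝ, E) (𝓡 3) ψ w (b i)
  let M : Matrix (Fin 3) (Fin 3) ℝ := Matrix.of fun i k => v i k
  let T : R3 →L[ℝ] R3 := fderiv ℝ (e'.symm.trans e) (e' (ψ w))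
  have hsrc' : e' (ψ w) ∈ (e'.symm.trans e).source := by
    rw [OpenPartialHomeomorph.trans_source]
    refine ⟨e'.map_source (mem_chart_source _ _), ?_⟩
    change e'.symm (e' (ψ w)) ∈ e.source
    rw [e'.left_inv (mem_chart_source _ _)]
    exact hw5
  have hT : 0 < T.det := OrientedAtlas.det_pos e' (chart_mem_atlas _ _) e (chart_mem_atlas _ _)
    _ hsrc'
  have hk' : DifferentiableAt ℝ (fun w' => e' (ψ w')) w :=
    (contDiffAt_chart_comp (n := 1) hw3 (chart_mem_atlas _ _) (mem_chart_source _ _)).differentiableAt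
      (by simp)
  have hve : ∀ c : E, (mfderiv 𝓘(ℝ, E) (𝓡 3) ψ w c : R3) = fderiv ℝ (fun w' => e' (ψ w')) w c :=
    fun c => congrArg (fun L : E →L[ℝ] R3 => L c)
      (mfderiv_eq_fderiv_chart (hw3.mdifferentiableAt (by simp)))
  have htr : DifferentiableAt ℝ (e'.symm.trans e) (e' (ψ w)) := by
    have hg := (contDiffGroupoid ∞ (𝓡 3)).compatible (chart_mem_atlas R3 (ψ w))
      (chart_mem_atlas R3 (ψ w₀))
    rw [contDiffGroupoid, mem_groupoid_of_pregroupoid] at hg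
    have h1 := hg.1
    simp only [contDiffPregroupoid, modelWithCornersSelf_coe,
      modelWithCornersSelf_coe_symm, Function.id_comp, Function.comp_id, preimage_id, range_id,
      inter_univ] at h1
    exact (h1.contDiffAt ((e'.symm.trans e).open_source.mem_nhds hsrc')).differentiableAt (by simp)
  have hchain : ∀ c : E, fderiv ℝ (fun w' => e (ψ w')) w c = T (mfderiv 𝓘(ℝ, E) (𝓡 3) ψ w c) := by
    intro c
    rw [hve]
    have h1 : (fun w' => e (ψ w')) =ᶠ[𝓝 w] (e'.symm.trans e) ∘ fun w' => e' (ψ w') := by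
      filter_upwards [hw3.continuousAt.eventually
        (e'.open_source.mem_nhds (mem_chart_source R3 (ψ w)))] with w' hw'
      change e (ψ w') = e (e'.symm (e' (ψ w')))
      rw [e'.left_inv hw']
    rw [h1.fderiv_eq, fderiv_comp w htr hk']
    rfl
  have hDM : D w = T.det * M.det := by
    rw [← show det3 v = M.det from rfl, ← det3_comp]
    exact congrArg det3 (funext fun i => hchain (b i))
  have hMs : M.det / |M.det| = s := by
    rw [← hw1, hDM, abs_mul, abs_of_pos hT, mul_div_mul_left _ _ hT.ne']
  have hFw : F (ψ w) = H w := hw6.self_of_nhds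
  have hmf : ∀ c : E, (mfderiv 𝓘(ℝ, E) 𝓘(ℝ, C3) H w c : C3)
      = mfderiv (𝓡 3) 𝓘(ℝ, C3) F (ψ w) (mfderiv 𝓘(ℝ, E) (𝓡 3) ψ w c) := by
    intro c
    have h1 := mfderiv_comp w (hw4.mdifferentiableAt (by simp)) (hw3.mdifferentiableAt (by simp))
    have h2 : F ∘ ψ =ᶠ[𝓝 w] H := hw6
    have h3 : (mfderiv 𝓘(ℝ, E) 𝓘(ℝ, C3) H w : E →L[ℝ] C3) = mfderiv 𝓘(ℝ, E) 𝓘(ℝ, C3) (F ∘ ψ) w :=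
      h2.symm.mfderiv_eq
    exact congrArg (fun L : E →L[ℝ] C3 => L c) (h3.trans h1)
  let S : R3 →L[ℝ] C3 := mfderiv (𝓡 3) 𝓘(ℝ, C3) F (ψ w)
  have hframe : (fun i => (mfderiv 𝓘(ℝ, E) 𝓘(ℝ, C3) H w (b i) : C3))
      = fun i => ∑ k, M i k • S (EuclideanSpace.single k (1 : ℝ) : R3) := by
    funext i
    have h1 : S (v i) = ∑ k, M i k • S (EuclideanSpace.single k (1 : ℝ) : R3) := by
      conv_lhs => rw [← sum_single (v i)]
      rw [map_sum]
      simp only [map_smul]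
      rfl
    exact (hmf (b i)).trans h1
  have hkey := angle_frame_change cy (F (ψ w))
    (fun k => mfderiv (𝓡 3) 𝓘(ℝ, C3) F (ψ w) (stdBasis (ψ w) k)) M
  rw [hMs] at hkey
  have hHF : frameAngle cy H b w = s * phase cy F (ψ w) := by
    refine Eq.trans ?_ hkey
    have : ∀ y : Y, y = H w → ∀ c : Fin 3 → C3,
        (fun i => (mfderiv 𝓘(ℝ, E) 𝓘(ℝ, C3) H w (b i) : C3)) = c →
        frameAngle cy H b w = angle cy y c := by
      rintro y rfl c rfl; rfl
    exact this _ hFw _ hframe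
  rw [hHF, ← mul_assoc]
  have : s * s = 1 := by rw [← abs_mul_abs_self, hs, one_mul]
  rw [this, one_mul]

omit [OrientedAtlas X] [FiniteDimensional ℝ E] in
theorem contDiffAt_frameAngle {w₀ : E} {b : Fin 3 → E}
    (hbas : LinearIndependent ℝ b) {H : E → Y} (hH : ContMDiffAt 𝓘(ℝ, E) 𝓘(ℝ, C3) ∞ H w₀)
    (hinj : Function.Injective (mfderiv 𝓘(ℝ, E) 𝓘(ℝ, C3) H w₀)) :
    ContDiffAt ℝ ∞ (frameAngle cy H b) w₀ := by
  refine contDiffAt_angle cy (a := fun w => w) (v := fun i _ => b i) hH contDiffAt_id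
    (fun i => contDiffAt_const) (gram_det_pos cy _ _ ?_)
  exact hbas.map' (mfderiv 𝓘(ℝ, E) 𝓘(ℝ, C3) H w₀ : E →L[ℝ] C3).toLinearMap
    (LinearMap.ker_eq_bot.2 hinj)

/-- A map that is an immersion in a parametrization: smoothness of the map and of its phase, and
the comparison of the phase and its differential with the angle in the parametrization. -/
theorem phase_param {ψ : E → X} {w₀ : E} (hψ : ContMDiffAt 𝓘(ℝ, E) (𝓡 3) ∞ ψ w₀)
    (hb : Function.Bijective (mfderiv 𝓘(ℝ, E) (𝓡 3) ψ w₀)) {b : Fin 3 → E}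
    (hbas : LinearIndependent ℝ b) {F : X → Y} {H : E → Y}
    (hH : ContMDiffAt 𝓘(ℝ, E) 𝓘(ℝ, C3) ∞ H w₀)
    (hinj : Function.Injective (mfderiv 𝓘(ℝ, E) 𝓘(ℝ, C3) H w₀))
    (hFH : ∀ᶠ w in 𝓝 w₀, F (ψ w) = H w) :
    ContMDiffAt (𝓡 3) 𝓘(ℝ, C3) ∞ F (ψ w₀) ∧
    Function.Injective (mfderiv (𝓡 3) 𝓘(ℝ, C3) F (ψ w₀)) ∧
    ContMDiffAt (𝓡 3) 𝓘(ℝ, ℝ) ∞ (phase cy F) (ψ w₀) ∧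
    |phase cy F (ψ w₀)| = |frameAngle cy H b w₀| ∧
    ∀ c : ℝ, (∀ v : E, |fderiv ℝ (frameAngle cy H b) w₀ v| ≤
      c * Real.sqrt (cy.g.inner (H w₀) (mfderiv 𝓘(ℝ, E) 𝓘(ℝ, C3) H w₀ v)
        (mfderiv 𝓘(ℝ, E) 𝓘(ℝ, C3) H w₀ v))) → DiffNormLE cy F (phase cy F) (ψ w₀) c := by
  have hF := contMDiffAt_of_param hψ hb hH hFH
  have hmf := mfderiv_param hψ hb hH hFH
  obtain ⟨s, hs, hphase⟩ := exists_phase_eq cy hψ hb hbas hH hFH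
  have hsm := contDiffAt_frameAngle cy hbas hH hinj
  have hsm' : ContDiffAt ℝ ∞ (fun w => s * frameAngle cy H b w) w₀ := contDiffAt_const.mul hsm
  have hFw : F (ψ w₀) = H w₀ := hFH.self_of_nhds
  refine ⟨hF, ?_, contMDiffAt_of_param hψ hb hsm'.contMDiffAt hphase, ?_, ?_⟩
  · intro v v' hvv
    obtain ⟨w, rfl⟩ := hb.2 v
    obtain ⟨w', rfl⟩ := hb.2 v'
    have h1 := (hmf w).symm.trans (hvv.trans (hmf w'))
    rw [hinj h1]
  · rw [hphase.self_of_nhds, abs_mul, hs, one_mul]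
  · intro c hc v
    obtain ⟨w, rfl⟩ := hb.2 v
    have h1 := mfderiv_param hψ hb hsm'.contMDiffAt hphase w
    have h2 : (mfderiv 𝓘(ℝ, E) 𝓘(ℝ, ℝ) (fun w => s * frameAngle cy H b w) w₀ w : ℝ)
        = s * fderiv ℝ (frameAngle cy H b) w₀ w := by
      rw [mfderiv_eq_fderiv, fderiv_const_mul (hsm.differentiableAt (by simp))]
      rfl
    have h3 : pullbackMetric cy F (ψ w₀) (mfderiv 𝓘(ℝ, E) (𝓡 3) ψ w₀ w)
        (mfderiv 𝓘(ℝ, E) (𝓡 3) ψ w₀ w) = cy.g.inner (H w₀) (mfderiv 𝓘(ℝ, E) 𝓘(ℝ, C3) H w₀ w)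
        (mfderiv 𝓘(ℝ, E) 𝓘(ℝ, C3) H w₀ w) := by
      have : ∀ y : Y, y = H w₀ → ∀ c : C3, c = mfderiv 𝓘(ℝ, E) 𝓘(ℝ, C3) H w₀ w →
          cy.g.inner y c c = cy.g.inner (H w₀) (mfderiv 𝓘(ℝ, E) 𝓘(ℝ, C3) H w₀ w)
            (mfderiv 𝓘(ℝ, E) 𝓘(ℝ, C3) H w₀ w) := by
        rintro y rfl c rfl; rfl
      exact this _ hFw _ (hmf w)
    rw [h3]
    refine le_trans (le_of_eq ?_) (hc w)
    refine (congrArg (fun r : ℝ => |r|) (h1.trans h2)).trans ?_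
    rw [abs_mul, hs, one_mul]

end Phase


/-! ### Smoothness of lifts to the cotangent bundle. -/

section CotangentLift

variable {Z : Type*} [TopologicalSpace Z] [ChartedSpace R3 Z] [IsManifold (𝓡 3) ∞ Z]
  {W : Type*} [NormedAddCommGroup W] [NormedSpace ℝ W] [CompleteSpace W]
  {P : Type*} [NormedAddCommGroup P] [NormedSpace ℝ P]

/-- The map between cotangent bundles induced by a parametrization. -/
def cotangentLift (ψ : W → Z) (w : W) (η : W →L[ℝ] ℝ) : Cotangent Z :=
  ⟨ψ w, (η : W →L[ℝ] ℝ).comp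
    ((mfderiv 𝓘(ℝ, W) (𝓡 3) ψ w : W →L[ℝ] R3).inverse :
      TangentSpace (𝓡 3) (ψ w) →L[ℝ] W)⟩

/-- The derivative of a parametrization as a continuous linear equivalence. -/
def paramEquiv {ψ : W → Z} {w : W} (hb : Function.Bijective (mfderiv 𝓘(ℝ, W) (𝓡 3) ψ w)) :
    W ≃L[ℝ] R3 :=
  ContinuousLinearEquiv.ofBijective (mfderiv 𝓘(ℝ, W) (𝓡 3) ψ w : W →L[ℝ] R3)
    (LinearMap.ker_eq_bot.2 hb.1) (LinearMap.range_eq_top.2 hb.2)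

omit [IsManifold (𝓡 3) ∞ Z] in
theorem paramEquiv_coe {ψ : W → Z} {w : W}
    (hb : Function.Bijective (mfderiv 𝓘(ℝ, W) (𝓡 3) ψ w)) :
    (paramEquiv hb : W →L[ℝ] R3) = (mfderiv 𝓘(ℝ, W) (𝓡 3) ψ w : W →L[ℝ] R3) := by
  ext1 v; rfl

/-- In trivializations the covector is `η ∘ T⁻¹`, where `T` is the coordinate form of `dψ`. It
depends smoothly on the point and is invertible nearby, and inversion is smooth at equivalences. -/
theorem contMDiffAt_cotangentLift {ψ : W → Z} {a : P → W} {η : P → W →L[ℝ] ℝ} {p₀ : P}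
    (hψ : ContMDiffAt 𝓘(ℝ, W) (𝓡 3) ∞ ψ (a p₀))
    (hb : ∀ᶠ w in 𝓝 (a p₀), Function.Bijective (mfderiv 𝓘(ℝ, W) (𝓡 3) ψ w))
    (ha : ContDiffAt ℝ ∞ a p₀) (hη : ContDiffAt ℝ ∞ η p₀) :
    ContMDiffAt 𝓘(ℝ, P) ((𝓡 3).prod 𝓘(ℝ, R3 →L[ℝ] ℝ)) ∞
      (fun p => cotangentLift ψ (a p) (η p)) p₀ := by
  have hψa : ContMDiffAt 𝓘(ℝ, P) (𝓡 3) ∞ (fun p => ψ (a p)) p₀ :=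
    ContMDiffAt.comp p₀ hψ ha.contMDiffAt
  have := (contMDiffAt_hom_bundle (n := ∞) (IM := 𝓘(ℝ, P)) (IB := 𝓡 3) (F₁ := R3) (F₂ := ℝ)
    (E₁ := (TangentSpace (𝓡 3) : Z → Type _)) (E₂ := Bundle.Trivial Z ℝ) (x₀ := p₀)
    (fun p => cotangentLift ψ (a p) (η p)))
  refine this.2 ⟨hψa, ?_⟩
  let T : W → W →L[ℝ] R3 := inTangentCoordinates 𝓘(ℝ, W) (𝓡 3) id ψ
    (fun w => mfderiv 𝓘(ℝ, W) (𝓡 3) ψ w) (a p₀)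
  have hT : ContDiffAt ℝ ∞ T (a p₀) :=
    (ContMDiffAt.mfderiv_const hψ (m := ∞) (by simp)).contDiffAt
  let τ := trivializationAt R3 (TangentSpace (𝓡 3) : Z → Type _) (ψ (a p₀))
  have hbase : ∀ᶠ w in 𝓝 (a p₀), ψ w ∈ τ.baseSet :=
    hψ.continuousAt.eventually (τ.open_baseSet.mem_nhds
      (FiberBundle.mem_baseSet_trivializationAt' (ψ (a p₀))))
  have hTe : ∀ᶠ w in 𝓝 (a p₀), ∃ (hw : ψ w ∈ τ.baseSet)
      (hbw : Function.Bijective (mfderiv 𝓘(ℝ, W) (𝓡 3) ψ w)),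
      T w = ((paramEquiv hbw).trans (τ.continuousLinearEquivAt ℝ (ψ w) hw) : W ≃L[ℝ] R3) := by
    filter_upwards [hbase, hb] with w hw hbw
    refine ⟨hw, hbw, ?_⟩
    ext1 v
    simp only [T, inTangentCoordinates, id_eq]
    have hmw : w ∈ (trivializationAt W (TangentSpace 𝓘(ℝ, W)) (a p₀)).baseSet := by
      change w ∈ (chartAt W (a p₀)).source
      rw [chartAt_self_eq]
      trivial
    rw [ContinuousLinearMap.inCoordinates_eq hmw hw]
    have hs : (trivializationAt W (TangentSpace 𝓘(ℝ, W)) (a p₀)).symmL ℝ w v = (v : W) := by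
      rw [TangentBundle.symmL_model_space]
      rfl
    refine congrArg (fun c : W => τ.continuousLinearEquivAt ℝ (ψ w) hw
      (mfderiv 𝓘(ℝ, W) (𝓡 3) ψ w c)) (Eq.trans ?_ hs)
    exact (Trivialization.symmL_apply (hb := hmw) ..).symm
  have hinv : ContDiffAt ℝ ∞ (fun w => (T w).inverse) (a p₀) := by
    obtain ⟨hw, hbw, he⟩ := hTe.self_of_nhds
    have h1 := contDiffAt_map_inverse (n := ∞)
      ((paramEquiv hbw).trans (τ.continuousLinearEquivAt ℝ (ψ (a p₀)) hw) : W ≃L[ℝ] R3)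
    rw [← he] at h1
    exact h1.comp (a p₀) hT
  have hmain : ContDiffAt ℝ ∞ (fun p => (η p).comp (T (a p)).inverse) p₀ :=
    hη.clm_comp (hinv.comp p₀ ha)
  refine hmain.contMDiffAt.congr_of_eventuallyEq ?_
  filter_upwards [ha.continuousAt.eventually hTe] with p ⟨hw, hbw, he⟩
  rw [he, ContinuousLinearMap.inverse_equiv]
  ext1 v
  simp only [cotangentLift]
  rw [ContinuousLinearMap.inCoordinates_eq hw (by simp)]
  have hi : (mfderiv 𝓘(ℝ, W) (𝓡 3) ψ (a p) : W →L[ℝ] R3).inverse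
      = ((paramEquiv hbw).symm : R3 →L[ℝ] W) := by
    exact (congrArg ContinuousLinearMap.inverse (paramEquiv_coe hbw)).symm.trans
      (ContinuousLinearMap.inverse_equiv _)
  exact congrArg (fun L : R3 →L[ℝ] W => η p (L ((τ.continuousLinearEquivAt ℝ (ψ (a p)) hw).symm v))) hi

end CotangentLift


/-! ### First order behaviour of `Φ` along the zero section. -/

section LagrangianNeighbourhood

variable {Y : Type*} [TopologicalSpace Y] [ChartedSpace C3 Y] [IsManifold 𝓘(ℂ, C3) ω Y]
  {Z : Type*} [TopologicalSpace Z] [ChartedSpace R3 Z] [IsManifold (𝓡 3) ∞ Z]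
  {cy : CalabiYau Y} {ι : Z → Y} {U : Set (Cotangent Z)} {Φ : Cotangent Z → Y}
  {W : Type*} [NormedAddCommGroup W] [NormedSpace ℝ W] [CompleteSpace W]
  {P : Type*} [NormedAddCommGroup P] [NormedSpace ℝ P]

theorem contMDiffAt_lift (hΦ : IsLagrangianNeighbourhood cy ι U Φ) {ψ : W → Z} {a : P → W}
    {η : P → W →L[ℝ] ℝ} {p₀ : P} (hψ : ContMDiffAt 𝓘(ℝ, W) (𝓡 3) ∞ ψ (a p₀))
    (hb : ∀ᶠ w in 𝓝 (a p₀), Function.Bijective (mfderiv 𝓘(ℝ, W) (𝓡 3) ψ w))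
    (ha : ContDiffAt ℝ ∞ a p₀) (hη : ContDiffAt ℝ ∞ η p₀)
    (hU : cotangentLift ψ (a p₀) (η p₀) ∈ U) :
    ContMDiffAt 𝓘(ℝ, P) 𝓘(ℝ, C3) ∞ (fun p => Φ (cotangentLift ψ (a p) (η p))) p₀ :=
  ContMDiffAt.comp p₀ (hΦ.smooth.contMDiffAt (hΦ.isOpen.mem_nhds hU))
    (contMDiffAt_cotangentLift hψ hb ha hη)

omit [IsManifold (𝓡 3) ∞ Z] [CompleteSpace W] in
theorem cotangentLift_zero (ψ : W → Z) (w : W) : cotangentLift ψ w 0 = ⟨ψ w, 0⟩ := by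
  rfl

/-- The derivative at `0` of `Φ` on the fibre over `z`. -/
def fibreDeriv (Φ : Cotangent Z → Y) (z : Z) : (R3 →L[ℝ] ℝ) →L[ℝ] C3 :=
  mfderiv 𝓘(ℝ, R3 →L[ℝ] ℝ) 𝓘(ℝ, C3) (fun p : R3 →L[ℝ] ℝ => Φ (⟨z, p⟩ : Cotangent Z)) 0

/-- The derivative of the immersion `ι`. -/
def baseDeriv (ι : Z → Y) (z : Z) : R3 →L[ℝ] C3 := mfderiv (𝓡 3) 𝓘(ℝ, C3) ι z

/-- The derivative of a parametrization. -/
def paramDeriv (ψ : W → Z) (w : W) : W →L[ℝ] R3 := mfderiv 𝓘(ℝ, W) (𝓡 3) ψ w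

/-- Along the zero section `Φ` is `ι`, and in the fibre direction its derivative is `fibreDeriv`.
The linear map `T` lets one formula serve both the full fibres and the covectors given by `pairing`.
-/
theorem mfderiv_lift_zero (hι : IsSpecialLagrangian cy ι)
    (hΦ : IsLagrangianNeighbourhood cy ι U Φ) {ψ : W → Z} {w₀ : W}
    (hψ : ContMDiffAt 𝓘(ℝ, W) (𝓡 3) ∞ ψ w₀)
    (hb : ∀ᶠ w in 𝓝 w₀, Function.Bijective (mfderiv 𝓘(ℝ, W) (𝓡 3) ψ w))
    (T : P →L[ℝ] W →L[ℝ] ℝ) (w : W) (p : P) :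
    (mfderiv 𝓘(ℝ, W × P) 𝓘(ℝ, C3)
      (fun q : W × P => Φ (cotangentLift ψ q.1 (T q.2))) (w₀, 0) (w, p) : C3)
      = baseDeriv ι (ψ w₀) (paramDeriv ψ w₀ w)
        + fibreDeriv Φ (ψ w₀) ((T p).comp (paramDeriv ψ w₀).inverse) := by
  let G : W × P → Y := fun q => Φ (cotangentLift ψ q.1 (T q.2))
  have hz : (⟨ψ w₀, 0⟩ : Cotangent Z) ∈ U := hΦ.zero_mem _
  have hG : ContMDiffAt 𝓘(ℝ, W × P) 𝓘(ℝ, C3) ∞ G (w₀, 0) := by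
    refine contMDiffAt_lift hΦ (a := fun q : W × P => q.1) (η := fun q : W × P => T q.2) hψ hb
      contDiffAt_fst (T.contDiff.contDiffAt.comp _ contDiffAt_snd) ?_
    simpa [cotangentLift_zero] using hz
  have hGd : MDifferentiableAt 𝓘(ℝ, W × P) 𝓘(ℝ, C3) G (w₀, 0) := hG.mdifferentiableAt (by simp)
  let D : W × P →L[ℝ] C3 := mfderiv 𝓘(ℝ, W × P) 𝓘(ℝ, C3) G (w₀, 0)
  have hsplit : D (w, p) = D (w, 0) + D (0, p) := by
    rw [← map_add]; simp
  have h1 : D (w, 0) = baseDeriv ι (ψ w₀) (paramDeriv ψ w₀ w) := by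
    have hin : MDifferentiableAt 𝓘(ℝ, W) 𝓘(ℝ, W × P) (fun w : W => ((w, 0) : W × P)) w₀ :=
      (ContinuousLinearMap.inl ℝ W P).differentiableAt.mdifferentiableAt
    have ha := mfderiv_comp w₀ (f := fun w : W => ((w, 0) : W × P)) hGd hin
    have hc : (G ∘ fun w : W => ((w, 0) : W × P)) = ι ∘ ψ := by
      funext w
      simp only [G, Function.comp, map_zero, cotangentLift_zero]
      exact hΦ.zero_section _
    have hbb := mfderiv_comp w₀ (hι.smooth.contMDiffAt.mdifferentiableAt (by simp))
      (hψ.mdifferentiableAt (by simp))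
    have hd : (mfderiv 𝓘(ℝ, W) 𝓘(ℝ, C3) (G ∘ fun w : W => ((w, 0) : W × P)) w₀ : W →L[ℝ] C3)
        = mfderiv 𝓘(ℝ, W) 𝓘(ℝ, C3) (ι ∘ ψ) w₀ := by rw [hc]
    rw [mfderiv_eq_fderiv] at ha
    have hfd : fderiv ℝ (fun w : W => ((w, 0) : W × P)) w₀ = ContinuousLinearMap.inl ℝ W P :=
      (ContinuousLinearMap.inl ℝ W P).fderiv
    rw [hfd] at ha
    exact congrArg (fun L : W →L[ℝ] C3 => L w) (ha.symm.trans (hd.trans hbb))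
  have h2 : D (0, p) = fibreDeriv Φ (ψ w₀) ((T p).comp (paramDeriv ψ w₀).inverse) := by
    have hin : MDifferentiableAt 𝓘(ℝ, P) 𝓘(ℝ, W × P) (fun p : P => ((w₀, p) : W × P)) 0 :=
      ((differentiableAt_const w₀).prodMk differentiableAt_id).mdifferentiableAt
    have ha := mfderiv_comp (0 : P) (f := fun p : P => ((w₀, p) : W × P)) hGd hin
    rw [mfderiv_eq_fderiv] at ha
    have hfd : fderiv ℝ (fun p : P => ((w₀, p) : W × P)) 0 = ContinuousLinearMap.inr ℝ W P := by
      have := ((hasFDerivAt_const w₀ (0 : P)).prodMk (hasFDerivAt_id (𝕜 := ℝ) (0 : P))).fderiv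
      refine this.trans ?_
      ext <;> simp
    rw [hfd] at ha
    let S : P →L[ℝ] (R3 →L[ℝ] ℝ) :=
      ((ContinuousLinearMap.compL ℝ R3 W ℝ).flip (paramDeriv ψ w₀).inverse).comp T
    have hS : MDifferentiableAt 𝓘(ℝ, P) 𝓘(ℝ, R3 →L[ℝ] ℝ) S 0 :=
      S.differentiableAt.mdifferentiableAt
    have hfib : MDifferentiableAt 𝓘(ℝ, R3 →L[ℝ] ℝ) 𝓘(ℝ, C3)
        (fun p : R3 →L[ℝ] ℝ => Φ (⟨ψ w₀, p⟩ : Cotangent Z)) (S 0) := by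
      rw [map_zero]
      have hc : (fun p : R3 →L[ℝ] ℝ => Φ (⟨ψ w₀, p⟩ : Cotangent Z))
          = fun p : R3 →L[ℝ] ℝ => Φ (cotangentLift ψ w₀ (p.comp (paramDeriv ψ w₀))) := by
        funext p
        have he : (p.comp (paramDeriv ψ w₀)).comp (paramDeriv ψ w₀).inverse = p := by
          ext1 v
          have h0 := hb.self_of_nhds
          have h3 : (paramDeriv ψ w₀).inverse = ((paramEquiv h0).symm : R3 →L[ℝ] W) :=
            (congrArg ContinuousLinearMap.inverse (paramEquiv_coe h0)).symm.trans
              (ContinuousLinearMap.inverse_equiv _)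
          rw [h3]
          exact congrArg p ((paramEquiv h0).apply_symm_apply v)
        exact congrArg (fun p' : R3 →L[ℝ] ℝ => Φ (⟨ψ w₀, p'⟩ : Cotangent Z)) he.symm
      rw [hc]
      refine (contMDiffAt_lift hΦ (a := fun _ => w₀)
        (η := fun p : R3 →L[ℝ] ℝ => p.comp (paramDeriv ψ w₀)) hψ hb contDiffAt_const
        (contDiffAt_id.clm_comp contDiffAt_const) ?_).mdifferentiableAt (by simp)
      simpa [cotangentLift_zero] using hz
    have hbb := mfderiv_comp (0 : P) hfib hS
    have hc : (G ∘ fun p : P => ((w₀, p) : W × P))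
      = (fun p : R3 →L[ℝ] ℝ => Φ (⟨ψ w₀, p⟩ : Cotangent Z)) ∘ S := rfl
    have hd : (mfderiv 𝓘(ℝ, P) 𝓘(ℝ, C3) (G ∘ fun p : P => ((w₀, p) : W × P)) 0 : P →L[ℝ] C3)
        = mfderiv 𝓘(ℝ, P) 𝓘(ℝ, C3) ((fun p : R3 →L[ℝ] ℝ => Φ (⟨ψ w₀, p⟩ : Cotangent Z)) ∘ S) 0 := by
      rw [hc]
    rw [mfderiv_eq_fderiv (f := S), S.fderiv, map_zero] at hbb
    exact congrArg (fun L : P →L[ℝ] C3 => L p) (ha.symm.trans (hd.trans hbb))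
  exact hsplit.trans (by rw [h1, h2])

omit [IsManifold (𝓡 3) ∞ Z] in
theorem inverse_paramDeriv {ψ : W → Z} {w : W}
    (hb : Function.Bijective (mfderiv 𝓘(ℝ, W) (𝓡 3) ψ w)) :
    (paramDeriv ψ w).inverse = ((paramEquiv hb).symm : R3 →L[ℝ] W) :=
  (congrArg ContinuousLinearMap.inverse (paramEquiv_coe hb)).symm.trans
    (ContinuousLinearMap.inverse_equiv _)

omit [IsManifold (𝓡 3) ∞ Z] in
theorem inverse_paramDeriv_apply {ψ : W → Z} {w : W}
    (hb : Function.Bijective (mfderiv 𝓘(ℝ, W) (𝓡 3) ψ w)) (v : W) :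
    (paramDeriv ψ w).inverse (paramDeriv ψ w v) = v := by
  rw [inverse_paramDeriv hb]
  exact (paramEquiv hb).symm_apply_apply v

omit [IsManifold (𝓡 3) ∞ Z] in
theorem paramDeriv_inverse_apply {ψ : W → Z} {w : W}
    (hb : Function.Bijective (mfderiv 𝓘(ℝ, W) (𝓡 3) ψ w)) (v : R3) :
    paramDeriv ψ w ((paramDeriv ψ w).inverse v) = v := by
  rw [inverse_paramDeriv hb]
  exact (paramEquiv hb).apply_symm_apply v

/-- The symplectic pairing of horizontal and vertical vectors along the zero section. -/
theorem kahler_base_fibre (hι : IsSpecialLagrangian cy ι)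
    (hΦ : IsLagrangianNeighbourhood cy ι U Φ) (z : Z) (x : R3) (η : R3 →L[ℝ] ℝ) :
    cy.kahler (ι z) ![baseDeriv ι z x, fibreDeriv Φ z η] = η x := by
  let φ := chartAt R3 z
  have hmem : φ ∈ IsManifold.maximalAtlas (𝓡 3) ∞ Z := IsManifold.chart_mem_maximalAtlas z
  have hz : z ∈ φ.source := mem_chart_source R3 z
  have hφs : ContMDiffAt (𝓡 3) 𝓘(ℝ, R3) ∞ φ z := contMDiffAt_of_mem_maximalAtlas hmem hz
  have hu : φ z ∈ φ.target := φ.map_source hz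
  have hsymm : ∀ u ∈ φ.target, ContMDiffAt 𝓘(ℝ, R3) (𝓡 3) ∞ φ.symm u := fun u hu =>
    (contMDiffOn_symm_of_mem_maximalAtlas hmem).contMDiffAt (φ.open_target.mem_nhds hu)
  have hfwd : ∀ u ∈ φ.target, ContMDiffAt (𝓡 3) 𝓘(ℝ, R3) ∞ φ (φ.symm u) := fun u hu =>
    contMDiffAt_of_mem_maximalAtlas hmem (φ.map_target hu)
  let Dφ : R3 → R3 →L[ℝ] R3 := fun u => mfderiv (𝓡 3) 𝓘(ℝ, R3) φ (φ.symm u)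
  have hleft : ∀ u ∈ φ.target, (Dφ u).comp (paramDeriv φ.symm u) = ContinuousLinearMap.id ℝ R3 := by
    intro u hu
    have h2 := mfderiv_comp u ((hfwd u hu).mdifferentiableAt (by simp))
      ((hsymm u hu).mdifferentiableAt (by simp))
    have h3 : mfderiv 𝓘(ℝ, R3) 𝓘(ℝ, R3) (φ ∘ φ.symm) u = ContinuousLinearMap.id ℝ R3 := by
      have : (φ ∘ φ.symm) =ᶠ[𝓝 u] id := by
        filter_upwards [φ.open_target.mem_nhds hu] with w hw using φ.right_inv hw
      rw [this.mfderiv_eq, mfderiv_id]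
      rfl
    exact h2.symm.trans h3
  have hbij : ∀ u ∈ φ.target, Function.Bijective (mfderiv 𝓘(ℝ, R3) (𝓡 3) φ.symm u) := by
    intro u hu
    have hinj : Function.Injective (paramDeriv φ.symm u) := by
      intro v w hvw
      have h1 := congrArg (fun L : R3 →L[ℝ] R3 => L v) (hleft u hu)
      have h2 := congrArg (fun L : R3 →L[ℝ] R3 => L w) (hleft u hu)
      exact h1.symm.trans ((congrArg (Dφ u) hvw).trans h2)
    exact ⟨hinj, (LinearMap.injective_iff_surjective (f := (paramDeriv φ.symm u : R3 →ₗ[ℝ] R3))).1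
      hinj⟩
  -- The derivative of `φ` is the inverse of that of `φ.symm`, so canonical coordinates are the lift
  -- of the parametrization `φ.symm`.
  have hcc : ∀ q : R3 × (R3 →L[ℝ] ℝ), q.1 ∈ φ.target →
      canonicalCoord φ q = cotangentLift φ.symm q.1 q.2 := by
    intro q hq
    have h1 : Dφ q.1 = (paramDeriv φ.symm q.1).inverse := by
      ext1 v
      have hv := paramDeriv_inverse_apply (hbij q.1 hq) v
      conv_lhs => rw [← hv]
      exact congrArg (fun L : R3 →L[ℝ] R3 => L ((paramDeriv φ.symm q.1).inverse v)) (hleft q.1 hq)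
    exact congrArg (fun L : R3 →L[ℝ] R3 => (⟨φ.symm q.1, q.2.comp L⟩ : Cotangent Z)) h1
  have hb : ∀ᶠ w in 𝓝 (φ z), Function.Bijective (mfderiv 𝓘(ℝ, R3) (𝓡 3) φ.symm w) := by
    filter_upwards [φ.open_target.mem_nhds hu] with w hw using hbij w hw
  have hev : (fun q' => Φ (canonicalCoord φ q')) =ᶠ[𝓝 (φ z, (0 : R3 →L[ℝ] ℝ))]
      fun q' => Φ (cotangentLift φ.symm q'.1 q'.2) := by
    have : ∀ᶠ q' : R3 × (R3 →L[ℝ] ℝ) in 𝓝 (φ z, (0 : R3 →L[ℝ] ℝ)), q'.1 ∈ φ.target :=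
      continuousAt_fst.eventually (φ.open_target.mem_nhds hu)
    filter_upwards [this] with q' hq'
    rw [hcc q' hq']
  have hd : ∀ (v : R3) (p : R3 →L[ℝ] ℝ), (mfderiv 𝓘(ℝ, R3 × (R3 →L[ℝ] ℝ)) 𝓘(ℝ, C3)
      (fun q' => Φ (canonicalCoord φ q')) (φ z, 0) (v, p) : C3)
      = baseDeriv ι (φ.symm (φ z)) (paramDeriv φ.symm (φ z) v)
        + fibreDeriv Φ (φ.symm (φ z)) (p.comp (paramDeriv φ.symm (φ z)).inverse) := by
    intro v p
    have h1 := mfderiv_lift_zero hι hΦ (hsymm _ hu) hb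
      (ContinuousLinearMap.id ℝ (R3 →L[ℝ] ℝ)) v p
    refine Eq.trans ?_ h1
    have h2 : (mfderiv 𝓘(ℝ, R3 × (R3 →L[ℝ] ℝ)) 𝓘(ℝ, C3)
        (fun q' => Φ (canonicalCoord φ q')) (φ z, 0) : R3 × (R3 →L[ℝ] ℝ) →L[ℝ] C3)
        = mfderiv 𝓘(ℝ, R3 × (R3 →L[ℝ] ℝ)) 𝓘(ℝ, C3)
          (fun q' => Φ (cotangentLift φ.symm q'.1 q'.2)) (φ z, 0) := hev.mfderiv_eq
    exact congrArg (fun L : R3 × (R3 →L[ℝ] ℝ) →L[ℝ] C3 => L (v, p)) h2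
  have hzz : φ.symm (φ z) = z := φ.left_inv hz
  rw [hzz] at hd
  have hcz : canonicalCoord φ (φ z, 0) = ⟨z, 0⟩ := by
    rw [hcc _ hu, cotangentLift_zero]
    exact congrArg (fun z' : Z => (⟨z', 0⟩ : Cotangent Z)) hzz
  -- For a purely horizontal and a purely vertical vector the canonical form reduces to the
  -- evaluation `η x`.
  have hS := hΦ.symplectic φ hmem (φ z, 0) hu (by rw [hcz]; exact hΦ.zero_mem z)
    ((paramDeriv φ.symm (φ z)).inverse x, 0) (0, η.comp (paramDeriv φ.symm (φ z)))
  have e1 := hd ((paramDeriv φ.symm (φ z)).inverse x) 0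
  have e2 := hd 0 (η.comp (paramDeriv φ.symm (φ z)))
  rw [paramDeriv_inverse_apply (hbij _ hu), ContinuousLinearMap.zero_comp, map_zero, add_zero] at e1
  have e3 : (η.comp (paramDeriv φ.symm (φ z))).comp (paramDeriv φ.symm (φ z)).inverse = η := by
    ext1 v
    exact congrArg η (paramDeriv_inverse_apply (hbij _ hu) v)
  rw [e3, map_zero, map_zero, zero_add] at e2
  have hp : Φ (canonicalCoord φ (φ z, 0)) = ι z := by rw [hcz, hΦ.zero_section]
  have key : ∀ y : Y, y = ι z → ∀ a b : C3, a = baseDeriv ι z x → b = fibreDeriv Φ z η →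
      cy.kahler y ![a, b] = cy.kahler (ι z) ![baseDeriv ι z x, fibreDeriv Φ z η] := by
    rintro y rfl a b rfl rfl; rfl
  refine (key _ hp _ _ e1 e2).symm.trans (hS.trans ?_)
  simp only [_root_.zero_apply, sub_zero]
  exact congrArg η (paramDeriv_inverse_apply (hbij _ hu) x)

/-- The vertical derivative is `J` of the metric dual. -/
theorem exists_fibreDeriv_eq (hι : IsSpecialLagrangian cy ι)
    (hΦ : IsLagrangianNeighbourhood cy ι U Φ) (z : Z) (η : R3 →L[ℝ] ℝ) :
    ∃ w : R3, fibreDeriv Φ z η = Complex.I • baseDeriv ι z w ∧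
      ∀ x : R3, cy.g.inner (ι z) (baseDeriv ι z x) (baseDeriv ι z w) = η x := by
  obtain ⟨w, hw⟩ := hΦ.fibre z η
  have hw' : fibreDeriv Φ z η = Complex.I • baseDeriv ι z w := hw
  refine ⟨w, hw', fun x => ?_⟩
  have h1 := kahler_base_fibre hι hΦ z x η
  rw [hw'] at h1
  rw [← h1]
  -- `ω(x, J w) = g(J x, J w) = g(x, w)`; the left side is already known to be `η x`.
  have h2 := cy.kahler_eq (ι z) (baseDeriv ι z x) (J (ι z) (baseDeriv ι z w))
  exact (h2.trans (cy.g_J (ι z) (baseDeriv ι z x) (baseDeriv ι z w))).symm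

end LagrangianNeighbourhood


/-! ### The map `Φ` in the coordinates of a tube. -/

section TubeMap

variable {Y : Type*} [TopologicalSpace Y] [ChartedSpace C3 Y] [IsManifold 𝓘(ℂ, C3) ω Y]
  {Z : Type*} [TopologicalSpace Z] [ChartedSpace R3 Z] [IsManifold (𝓡 3) ∞ Z]
  {cy : CalabiYau Y} {ι : Z → Y} {U : Set (Cotangent Z)} {Φ : Cotangent Z → Y}
  {ψ : ℂ × ℝ → Z} {ρ l : ℝ}

/-- The covector `Re p du₁ + Im p du₂`. -/
def pairing : ℂ →L[ℝ] (ℂ × ℝ →L[ℝ] ℝ) :=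
  Complex.reCLM.smulRight (Complex.reCLM.comp (ContinuousLinearMap.fst ℝ ℂ ℝ)) +
    Complex.imCLM.smulRight (Complex.imCLM.comp (ContinuousLinearMap.fst ℝ ℂ ℝ))

theorem pairing_apply (p : ℂ) (w : ℂ × ℝ) : pairing p w = p.re * w.1.re + p.im * w.1.im := by
  simp [pairing]

/-- The map `Φ` in the coordinates of a tube, restricted to the covectors which vanish
along the circles. -/
def tubeMap (Φ : Cotangent Z → Y) (ψ : ℂ × ℝ → Z) (q : (ℂ × ℝ) × ℂ) : Y :=
  Φ (cotangentLift ψ q.1 (pairing q.2))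

/-- The derivative of `tubeMap`. -/
def tubeDeriv (Φ : Cotangent Z → Y) (ψ : ℂ × ℝ → Z) (q : (ℂ × ℝ) × ℂ) : (ℂ × ℝ) × ℂ →L[ℝ] C3 :=
  mfderiv 𝓘(ℝ, (ℂ × ℝ) × ℂ) 𝓘(ℝ, C3) (tubeMap Φ ψ) q

theorem tubeMap_zero (hΦ : IsLagrangianNeighbourhood cy ι U Φ) (w : ℂ × ℝ) :
    tubeMap Φ ψ (w, 0) = ι (ψ w) := by
  refine Eq.trans ?_ (hΦ.zero_section (ψ w))
  simp only [tubeMap, map_zero, cotangentLift_zero]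

theorem isOpen_cyl : IsOpen (cyl ρ) := isOpen_lt (by fun_prop) continuous_const

theorem IsTube.contMDiffAt {M : Type*} [TopologicalSpace M] [ChartedSpace R3 M] {ψ : ℂ × ℝ → M}
    (h : IsTube ρ l ψ) {w : ℂ × ℝ} (hw : w ∈ cyl ρ) :
    ContMDiffAt 𝓘(ℝ, ℂ × ℝ) (𝓡 3) ∞ ψ w := h.smooth.contMDiffAt (isOpen_cyl.mem_nhds hw)

theorem IsTube.eventually_bijective {M : Type*} [TopologicalSpace M] [ChartedSpace R3 M]
    {ψ : ℂ × ℝ → M} (h : IsTube ρ l ψ) {w : ℂ × ℝ} (hw : w ∈ cyl ρ) :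
    ∀ᶠ w in 𝓝 w, Function.Bijective (mfderiv 𝓘(ℝ, ℂ × ℝ) (𝓡 3) ψ w) := by
  filter_upwards [isOpen_cyl.mem_nhds hw] with w hw using h.bijective w hw

theorem contMDiffAt_tubeMap (hΦ : IsLagrangianNeighbourhood cy ι U Φ) (hψ : IsTube ρ l ψ)
    {q : (ℂ × ℝ) × ℂ} (hq : q.1 ∈ cyl ρ) (hU : cotangentLift ψ q.1 (pairing q.2) ∈ U) :
    ContMDiffAt 𝓘(ℝ, (ℂ × ℝ) × ℂ) 𝓘(ℝ, C3) ∞ (tubeMap Φ ψ) q :=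
  contMDiffAt_lift hΦ (a := fun q : (ℂ × ℝ) × ℂ => q.1) (η := fun q => pairing q.2)
    (hψ.contMDiffAt hq) (hψ.eventually_bijective hq) contDiffAt_fst
    (pairing.contDiff.contDiffAt.comp _ contDiffAt_snd) hU

theorem eventually_lift_mem (hΦ : IsLagrangianNeighbourhood cy ι U Φ) (hψ : IsTube ρ l ψ)
    {q : (ℂ × ℝ) × ℂ} (hq : q.1 ∈ cyl ρ) (hU : cotangentLift ψ q.1 (pairing q.2) ∈ U) :
    ∀ᶠ q in 𝓝 q, q.1 ∈ cyl ρ ∧ cotangentLift ψ q.1 (pairing q.2) ∈ U := by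
  have h1 : ContMDiffAt 𝓘(ℝ, (ℂ × ℝ) × ℂ) ((𝓡 3).prod 𝓘(ℝ, R3 →L[ℝ] ℝ)) ∞
      (fun q : (ℂ × ℝ) × ℂ => cotangentLift ψ q.1 (pairing q.2)) q :=
    contMDiffAt_cotangentLift (a := fun q : (ℂ × ℝ) × ℂ => q.1) (η := fun q => pairing q.2)
      (hψ.contMDiffAt hq) (hψ.eventually_bijective hq) contDiffAt_fst
      (pairing.contDiff.contDiffAt.comp _ contDiffAt_snd)
  exact (continuousAt_fst.eventually (isOpen_cyl.mem_nhds hq)).and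
    (h1.continuousAt.eventually (hΦ.isOpen.mem_nhds hU))

theorem lift_zero_mem (hΦ : IsLagrangianNeighbourhood cy ι U Φ) (w : ℂ × ℝ) :
    cotangentLift ψ w (pairing 0) ∈ U := by
  rw [map_zero, cotangentLift_zero]; exact hΦ.zero_mem _

/-- The derivative of `tubeMap` along the zero section in horizontal directions. -/
theorem tubeDeriv_horizontal (hι : IsSpecialLagrangian cy ι)
    (hΦ : IsLagrangianNeighbourhood cy ι U Φ) (hψ : IsTube ρ l ψ) {w₀ : ℂ × ℝ} (hw : w₀ ∈ cyl ρ)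
    (w : ℂ × ℝ) :
    tubeDeriv Φ ψ (w₀, 0) (w, 0) = baseDeriv ι (ψ w₀) (paramDeriv ψ w₀ w) := by
  refine (mfderiv_lift_zero hι hΦ (hψ.contMDiffAt hw) (hψ.eventually_bijective hw)
    pairing w 0).trans ?_
  rw [map_zero, ContinuousLinearMap.zero_comp, map_zero, add_zero]

/-- The derivative of `tubeMap` along the core circle, where the coordinates are orthonormal. -/
theorem tubeDeriv_core (hι : IsSpecialLagrangian cy ι)
    (hΦ : IsLagrangianNeighbourhood cy ι U Φ) (hψ : IsTube ρ l ψ) {w₀ : ℂ × ℝ} (hw : w₀ ∈ cyl ρ)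
    (hon : ∀ v w : ℂ × ℝ, cy.g.inner (ι (ψ w₀)) (baseDeriv ι (ψ w₀) (paramDeriv ψ w₀ v))
      (baseDeriv ι (ψ w₀) (paramDeriv ψ w₀ w)) = v.1.re * w.1.re + v.1.im * w.1.im + v.2 * w.2)
    (w : ℂ × ℝ) (p : ℂ) :
    tubeDeriv Φ ψ (w₀, 0) (w, p) = baseDeriv ι (ψ w₀) (paramDeriv ψ w₀ w)
      + Complex.I • baseDeriv ι (ψ w₀) (paramDeriv ψ w₀ (p, 0)) := by
  refine (mfderiv_lift_zero hι hΦ (hψ.contMDiffAt hw) (hψ.eventually_bijective hw)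
    pairing w p).trans ?_
  obtain ⟨x, hx, hx'⟩ := exists_fibreDeriv_eq hι hΦ (ψ w₀)
    ((pairing p).comp (paramDeriv ψ w₀).inverse)
  obtain ⟨v, rfl⟩ := (hψ.bijective w₀ hw).2 x
  -- The coordinates are orthonormal on the core, so the metric dual of `Re p du₁ + Im p du₂` is the
  -- vector `(p, 0)`; testing on `1`, `i` and the circle direction determines `v`.
  have hv : v = (p, 0) := by
    have h : ∀ u : ℂ × ℝ, u.1.re * v.1.re + u.1.im * v.1.im + u.2 * v.2
        = p.re * u.1.re + p.im * u.1.im := by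
      intro u
      refine (hon u v).symm.trans ((hx' (paramDeriv ψ w₀ u)).trans ?_)
      rw [ContinuousLinearMap.comp_apply, inverse_paramDeriv_apply (hψ.bijective w₀ hw),
        pairing_apply]
    have h1 := h (1, 0)
    have h2 := h (Complex.I, 0)
    have h3 := h (0, 1)
    simp at h1 h2 h3
    exact Prod.ext (Complex.ext h1 h2) h3
  subst hv
  rw [hx]
  rfl

/-- The metric along the core circle is Euclidean. -/
theorem metric_core (hι : IsSpecialLagrangian cy ι)
    (hΦ : IsLagrangianNeighbourhood cy ι U Φ) (hψ : IsTube ρ l ψ) {w₀ : ℂ × ℝ} (hw : w₀ ∈ cyl ρ)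
    (hon : ∀ v w : ℂ × ℝ, cy.g.inner (ι (ψ w₀)) (baseDeriv ι (ψ w₀) (paramDeriv ψ w₀ v))
      (baseDeriv ι (ψ w₀) (paramDeriv ψ w₀ w)) = v.1.re * w.1.re + v.1.im * w.1.im + v.2 * w.2)
    (v : (ℂ × ℝ) × ℂ) :
    cy.g.inner (tubeMap Φ ψ (w₀, 0)) (tubeDeriv Φ ψ (w₀, 0) v) (tubeDeriv Φ ψ (w₀, 0) v)
      = Complex.normSq v.1.1 + v.1.2 ^ 2 + Complex.normSq v.2 := by
  obtain ⟨w, p⟩ := v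
  have hd := tubeDeriv_core hι hΦ hψ hw hon w p
  have hz : tubeMap Φ ψ (w₀, 0) = ι (ψ w₀) := tubeMap_zero hΦ w₀
  let a : C3 := baseDeriv ι (ψ w₀) (paramDeriv ψ w₀ w)
  let b : C3 := baseDeriv ι (ψ w₀) (paramDeriv ψ w₀ (p, 0))
  let γ : C3 →L[ℝ] C3 →L[ℝ] ℝ := cy.g.inner (ι (ψ w₀))
  let Jb : C3 := J (ι (ψ w₀)) b
  have key : ∀ y : Y, y = ι (ψ w₀) → ∀ c : C3, c = a + Jb →
      cy.g.inner y c c = γ (a + Jb) (a + Jb) := by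
    rintro y rfl c rfl; rfl
  refine (key _ hz _ hd).trans ?_
  -- The horizontal and vertical parts are orthogonal because `g(J b, a) = ω(b, a)` vanishes on a
  -- Lagrangian.
  have h1 : γ Jb a = 0 := by
    have e1 := cy.kahler_eq (ι (ψ w₀)) b a
    have e2 := hι.lagrangian (ψ w₀) (paramDeriv ψ w₀ (p, 0)) (paramDeriv ψ w₀ w)
    exact e1.symm.trans e2
  have h2 : γ a Jb = 0 := (cy.g.symm (ι (ψ w₀)) a Jb).trans h1
  have h3 : γ Jb Jb = γ b b := cy.g_J (ι (ψ w₀)) b b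
  have h4 : γ a a = _ := hon w w
  have h5 : γ b b = _ := hon (p, 0) (p, 0)
  have h6 : γ (a + Jb) (a + Jb) = γ a a + γ b b := by
    simp only [map_add, add_apply, h1, h2, h3]; ring
  refine h6.trans ?_
  rw [h4, h5]
  simp [Complex.normSq_apply]; ring

end TubeMap


/-! ### Angles of frames that contain the circle direction, and where they vanish. -/

section PlaneAngle

variable {Y : Type*} [TopologicalSpace Y] [ChartedSpace C3 Y] [IsManifold 𝓘(ℂ, C3) ω Y]
  {Z : Type*} [TopologicalSpace Z] [ChartedSpace R3 Z] [IsManifold (𝓡 3) ∞ Z]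
  {cy : CalabiYau Y} {ι : Z → Y} {U : Set (Cotangent Z)} {Φ : Cotangent Z → Y}
  {ψ : ℂ × ℝ → Z} {ρ l : ℝ}

/-- A vector orthogonal to the direction of the circle. -/
def planeVec : ℂ × ℂ →L[ℝ] (ℂ × ℝ) × ℂ :=
  ((ContinuousLinearMap.inl ℝ ℂ ℝ).comp (ContinuousLinearMap.fst ℝ ℂ ℂ)).prod
    (ContinuousLinearMap.snd ℝ ℂ ℂ)

theorem planeVec_apply (x : ℂ × ℂ) : planeVec x = ((x.1, 0), x.2) := rfl

/-- The frame consisting of two vectors orthogonal to the direction of the circle, and this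
direction. -/
def planeFrame (w : (ℂ × ℂ) × (ℂ × ℂ)) : Fin 3 → (ℂ × ℝ) × ℂ :=
  ![planeVec w.1, planeVec w.2, ((0, 1), 0)]

/-- The standard frame of `ℂ × ℝ`. -/
def tubeFrame : Fin 3 → ℂ × ℝ := ![(1, 0), (Complex.I, 0), (0, 1)]

theorem linearIndependent_tubeFrame : LinearIndependent ℝ tubeFrame := by
  rw [Fintype.linearIndependent_iff]
  intro c hc
  simp [Fin.sum_univ_three, tubeFrame, Prod.ext_iff, Complex.ext_iff] at hc
  intro i
  fin_cases i
  · exact hc.1.1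
  · exact hc.1.2
  · exact hc.2

theorem linearIndependent_planeFrame {w : (ℂ × ℂ) × (ℂ × ℂ)}
    (hw : ∀ a b : ℝ, a • w.1 + b • w.2 = 0 → a = 0 ∧ b = 0) :
    LinearIndependent ℝ (planeFrame w) := by
  rw [Fintype.linearIndependent_iff]
  intro c hc
  simp only [Fin.sum_univ_three, planeFrame, Matrix.cons_val_zero, Matrix.cons_val_one,
    Matrix.cons_val, planeVec_apply, Prod.ext_iff, Prod.fst_add, Prod.snd_add, Prod.smul_fst,
    Prod.smul_snd, smul_zero, add_zero, zero_add, Prod.fst_zero, Prod.snd_zero, smul_eq_mul,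
    mul_one, mul_zero] at hc
  obtain ⟨⟨h1, h3⟩, h2⟩ := hc
  have := hw (c 0) (c 1) (Prod.ext (by simpa using h1) (by simpa using h2))
  intro i
  fin_cases i
  · exact this.1
  · exact this.2
  · exact h3

theorem angle_eq_zero {y : Y} {v : Fin 3 → TangentSpace 𝓘(ℝ, C3) y}
    (h : (cy.OmegaR y v).im = 0) : angle cy y v = 0 := by
  rw [angle_eq, h, zero_div]

variable (cy Φ ψ) in
/-- The angle of the image of a frame under the derivative of `tubeMap`. -/
def planeAngle (x : ((ℂ × ℝ) × ℂ) × ((ℂ × ℂ) × (ℂ × ℂ))) : ℝ :=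
  angle cy (tubeMap Φ ψ x.1) (fun i => tubeDeriv Φ ψ x.1 (planeFrame x.2 i))

-- With the circle direction kept fixed, only the oriented real plane in `ℂ × ℂ` matters. This
-- permits rescaling, orthonormalizing and changing coordinates in the frame.
omit [IsManifold (𝓡 3) ∞ Z] in
theorem planeAngle_change (q : (ℂ × ℝ) × ℂ) (w : (ℂ × ℂ) × (ℂ × ℂ)) (a b c d : ℝ)
    (h : 0 < a * d - b * c) :
    planeAngle cy Φ ψ (q, (a • w.1 + b • w.2, c • w.1 + d • w.2)) = planeAngle cy Φ ψ (q, w) := by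
  have h1 := angle_frame_change cy (tubeMap Φ ψ q) (fun i => tubeDeriv Φ ψ q (planeFrame w i))
    !![a, b, 0; c, d, 0; 0, 0, 1]
  have hd : (!![a, b, 0; c, d, 0; 0, 0, 1] : Matrix (Fin 3) (Fin 3) ℝ).det = a * d - b * c := by
    simp [Matrix.det_fin_three]
  rw [hd, abs_of_pos h, div_self h.ne', one_mul] at h1
  refine Eq.trans ?_ h1
  refine congrArg (angle cy (tubeMap Φ ψ q)) (funext fun i => ?_)
  let D : (ℂ × ℝ) × ℂ →L[ℝ] C3 := tubeDeriv Φ ψ q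
  have : D (planeFrame (a • w.1 + b • w.2, c • w.1 + d • w.2) i)
      = ∑ k, (!![a, b, 0; c, d, 0; 0, 0, 1] : Matrix (Fin 3) (Fin 3) ℝ) i k •
        D (planeFrame w k) := by
    simp only [← map_smul, ← map_sum]
    congr 1
    fin_cases i <;> simp [Fin.sum_univ_three, planeFrame]
  exact this

theorem contDiffAt_planeAngle (hΦ : IsLagrangianNeighbourhood cy ι U Φ) (hψ : IsTube ρ l ψ)
    {q : (ℂ × ℝ) × ℂ} (hq : q.1 ∈ cyl ρ) (hU : cotangentLift ψ q.1 (pairing q.2) ∈ U)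
    (hinj : Function.Injective (tubeDeriv Φ ψ q)) {w : (ℂ × ℂ) × (ℂ × ℂ)}
    (hw : ∀ a b : ℝ, a • w.1 + b • w.2 = 0 → a = 0 ∧ b = 0) :
    ContDiffAt ℝ ∞ (planeAngle cy Φ ψ) (q, w) := by
  refine contDiffAt_angle cy (G := tubeMap Φ ψ)
    (a := fun x : ((ℂ × ℝ) × ℂ) × ((ℂ × ℂ) × (ℂ × ℂ)) => x.1)
    (v := fun i x => planeFrame x.2 i) (contMDiffAt_tubeMap hΦ hψ hq hU) contDiffAt_fst ?_ ?_
  · intro i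
    fin_cases i
    · exact (planeVec.contDiff.comp (contDiff_fst.comp contDiff_snd)).contDiffAt
    · exact (planeVec.contDiff.comp (contDiff_snd.comp contDiff_snd)).contDiffAt
    · exact contDiffAt_const
  · refine gram_det_pos cy _ _ ?_
    exact (linearIndependent_planeFrame hw).map' (tubeDeriv Φ ψ q : (ℂ × ℝ) × ℂ →ₗ[ℝ] C3)
      (LinearMap.ker_eq_bot.2 hinj)

/-- These frames are tangent to `Z`, where `Im Ω` vanishes. -/
theorem planeAngle_horizontal (hι : IsSpecialLagrangian cy ι)
    (hΦ : IsLagrangianNeighbourhood cy ι U Φ) (hψ : IsTube ρ l ψ) {w₀ : ℂ × ℝ} (hw : w₀ ∈ cyl ρ)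
    (x y : ℂ) : planeAngle cy Φ ψ ((w₀, 0), ((x, 0), (y, 0))) = 0 := by
  let v : Fin 3 → ℂ × ℝ := ![(x, 0), (y, 0), (0, 1)]
  have hz : tubeMap Φ ψ (w₀, 0) = ι (ψ w₀) := tubeMap_zero hΦ w₀
  have hv : ∀ i, tubeDeriv Φ ψ (w₀, 0) (planeFrame ((x, 0), (y, 0)) i)
      = baseDeriv ι (ψ w₀) (paramDeriv ψ w₀ (v i)) := by
    intro i
    rw [← tubeDeriv_horizontal hι hΦ hψ hw]
    congr 1
    fin_cases i <;> rfl
  have key : ∀ y' : Y, y' = ι (ψ w₀) → ∀ c : Fin 3 → C3,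
      c = (fun i => baseDeriv ι (ψ w₀) (paramDeriv ψ w₀ (v i))) → (cy.OmegaR y' c).im = 0 := by
    rintro y' rfl c rfl
    exact hι.special (ψ w₀) (fun i => paramDeriv ψ w₀ (v i))
  have := key _ hz _ (funext hv)
  exact angle_eq_zero this

/-- On the core the differential is `(w, p) ↦ w + i p`, so the frame is a complex matrix `M` applied
to a basis `e` of the tangent space of `Z`. The plane is a complex line for `(u, p) ↦ (iu, -ip)`,
which makes `det M = |ζ|² + |τ|²` real, and `Ω(e)` is real because `Z` is special Lagrangian. -/
theorem planeAngle_core (hι : IsSpecialLagrangian cy ι)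
    (hΦ : IsLagrangianNeighbourhood cy ι U Φ) (hψ : IsTube ρ l ψ) {w₀ : ℂ × ℝ} (hw : w₀ ∈ cyl ρ)
    (hon : ∀ v w : ℂ × ℝ, cy.g.inner (ι (ψ w₀)) (baseDeriv ι (ψ w₀) (paramDeriv ψ w₀ v))
      (baseDeriv ι (ψ w₀) (paramDeriv ψ w₀ w)) = v.1.re * w.1.re + v.1.im * w.1.im + v.2 * w.2)
    (ζ τ : ℂ) :
    planeAngle cy Φ ψ ((w₀, 0), ((ζ, τ), (Complex.I * ζ, -(Complex.I * τ)))) = 0 := by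
  let L : ℂ × ℝ →L[ℝ] C3 := (baseDeriv ι (ψ w₀)).comp (paramDeriv ψ w₀)
  let e : Fin 3 → C3 := fun i => L (tubeFrame i)
  let M : Matrix (Fin 3) (Fin 3) ℂ := !![ζ.re + Complex.I * τ.re, ζ.im + Complex.I * τ.im, 0;
    -ζ.im + Complex.I * τ.im, ζ.re - Complex.I * τ.re, 0; 0, 0, 1]
  have hz : tubeMap Φ ψ (w₀, 0) = ι (ψ w₀) := tubeMap_zero hΦ w₀
  have hL : ∀ x : ℂ, L (x, 0) = (x.re : ℂ) • e 0 + (x.im : ℂ) • e 1 := by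
    intro x
    have : ((x, 0) : ℂ × ℝ) = x.re • tubeFrame 0 + x.im • tubeFrame 1 := by
      apply Prod.ext
      · simp [tubeFrame]
      · simp [tubeFrame]
    rw [this, map_add, map_smul, map_smul]
    rfl
  have hv : ∀ i, tubeDeriv Φ ψ (w₀, 0)
      (planeFrame ((ζ, τ), (Complex.I * ζ, -(Complex.I * τ))) i) = ∑ k, M i k • e k := by
    intro i
    fin_cases i
    · refine (tubeDeriv_core hι hΦ hψ hw hon (ζ, 0) τ).trans ?_
      change L (ζ, 0) + Complex.I • L (τ, 0) = _
      rw [hL, hL, Fin.sum_univ_three]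
      simp [M]
      module
    · refine (tubeDeriv_core hι hΦ hψ hw hon (Complex.I * ζ, 0) (-(Complex.I * τ))).trans ?_
      change L (Complex.I * ζ, 0) + Complex.I • L (-(Complex.I * τ), 0) = _
      rw [hL, hL, Fin.sum_univ_three]
      simp [M]
      module
    · refine (tubeDeriv_core hι hΦ hψ hw hon (0, 1) 0).trans ?_
      change L (0, 1) + Complex.I • L (0, 0) = _
      rw [Fin.sum_univ_three]
      have : L ((0, 0) : ℂ × ℝ) = 0 := map_zero L
      rw [this]
      simp [M, e, tubeFrame]
  have hO : (cy.OmegaR (ι (ψ w₀)) e).im = 0 := hι.special (ψ w₀) fun i => paramDeriv ψ w₀ (tubeFrame i)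
  have hdet : M.det = ((Complex.normSq ζ + Complex.normSq τ : ℝ) : ℂ) := by
    simp only [Matrix.det_fin_three, M, Complex.normSq_apply]
    apply Complex.ext
    · simp; ring
    · simp; ring
  have key : ∀ y' : Y, y' = ι (ψ w₀) → ∀ c : Fin 3 → C3, c = (fun i => ∑ k, M i k • e k) →
      (cy.OmegaR y' c).im = 0 := by
    rintro y' rfl c rfl
    have h1 := alternating_frame_change (R := ℂ) (E := C3)
      (cy.Omega (ι (ψ w₀))).toAlternatingMap e M
    have h2 : cy.OmegaR (ι (ψ w₀)) (fun i => ∑ k, M i k • e k)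
        = M.det * cy.OmegaR (ι (ψ w₀)) e := h1
    rw [hdet] at h2
    refine (congrArg Complex.im h2).trans ?_
    rw [Complex.im_ofReal_mul, hO, mul_zero]
  have := key _ hz _ (funext hv)
  exact angle_eq_zero this

/-- The angle of a graph over the tube. -/
theorem frameAngle_comp_tubeMap (hΦ : IsLagrangianNeighbourhood cy ι U Φ) (hψ : IsTube ρ l ψ)
    {F : ℂ × ℝ → (ℂ × ℝ) × ℂ} {w₀ : ℂ × ℝ} (hF : DifferentiableAt ℝ F w₀)
    (hq : (F w₀).1 ∈ cyl ρ) (hU : cotangentLift ψ (F w₀).1 (pairing (F w₀).2) ∈ U)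
    {x y : ℂ × ℂ} (h₁ : fderiv ℝ F w₀ (1, 0) = planeVec x)
    (h₂ : fderiv ℝ F w₀ (Complex.I, 0) = planeVec y)
    (h₃ : fderiv ℝ F w₀ (0, 1) = ((0, 1), 0)) :
    frameAngle cy (fun w => tubeMap Φ ψ (F w)) tubeFrame w₀ = planeAngle cy Φ ψ (F w₀, (x, y)) := by
  refine congrArg (angle cy (tubeMap Φ ψ (F w₀))) (funext fun i => ?_)
  have h1 := mfderiv_comp w₀ ((contMDiffAt_tubeMap hΦ hψ hq hU).mdifferentiableAt (by simp))
    hF.mdifferentiableAt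
  rw [mfderiv_eq_fderiv] at h1
  refine (congrArg (fun A : ℂ × ℝ →L[ℝ] C3 => A (tubeFrame i)) h1).trans ?_
  have h2 : fderiv ℝ F w₀ (tubeFrame i) = planeFrame (x, y) i := by
    fin_cases i
    · exact h₁
    · exact h₂
    · exact h₃
  exact congrArg (tubeDeriv Φ ψ (F w₀)) h2

end PlaneAngle


/-! ### A compact neighbourhood of the core with uniform metric bounds. -/

section Box

variable {Y : Type*} [TopologicalSpace Y] [ChartedSpace C3 Y] [IsManifold 𝓘(ℂ, C3) ω Y]
  {Z : Type*} [TopologicalSpace Z] [ChartedSpace R3 Z] [IsManifold (𝓡 3) ∞ Z]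
  {cy : CalabiYau Y} {ι : Z → Y} {U : Set (Cotangent Z)} {Φ : Cotangent Z → Y}
  {ψ : ℂ × ℝ → Z} {ρ l : ℝ}

/-- A neighbourhood of the zero section over the core circle. -/
def box (l r : ℝ) : Set ((ℂ × ℝ) × ℂ) :=
  (Metric.closedBall 0 r ×ˢ Icc 0 l) ×ˢ Metric.closedBall 0 r

theorem isCompact_box (l r : ℝ) : IsCompact (box l r) :=
  ((isCompact_closedBall _ _).prod isCompact_Icc).prod (isCompact_closedBall _ _)

theorem mem_box {l r : ℝ} {q : (ℂ × ℝ) × ℂ} :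
    q ∈ box l r ↔ ‖q.1.1‖ ≤ r ∧ q.1.2 ∈ Icc 0 l ∧ ‖q.2‖ ≤ r := by
  simp only [box, mem_prod, mem_closedBall_zero_iff, and_assoc]

variable (cy Φ ψ) in
/-- The pull-back metric of `tubeMap`. -/
def tubeMetric (x : ((ℂ × ℝ) × ℂ) × ((ℂ × ℝ) × ℂ)) : ℝ :=
  cy.g.inner (tubeMap Φ ψ x.1) (tubeDeriv Φ ψ x.1 x.2) (tubeDeriv Φ ψ x.1 x.2)

theorem contDiffAt_tubeMetric (hΦ : IsLagrangianNeighbourhood cy ι U Φ) (hψ : IsTube ρ l ψ)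
    {q : (ℂ × ℝ) × ℂ} (hq : q.1 ∈ cyl ρ) (hU : cotangentLift ψ q.1 (pairing q.2) ∈ U)
    (v : (ℂ × ℝ) × ℂ) : ContDiffAt ℝ ∞ (tubeMetric cy Φ ψ) (q, v) :=
  contDiffAt_metric cy (G := tubeMap Φ ψ) (a := fun x : ((ℂ × ℝ) × ℂ) × ((ℂ × ℝ) × ℂ) => x.1)
    (v := fun x => x.2) (w := fun x => x.2) (contMDiffAt_tubeMap hΦ hψ hq hU) contDiffAt_fst
    contDiffAt_snd contDiffAt_snd

omit [IsManifold (𝓡 3) ∞ Z] in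
theorem tubeMetric_smul (q v : (ℂ × ℝ) × ℂ) (c : ℝ) :
    tubeMetric cy Φ ψ (q, c • v) = c ^ 2 * tubeMetric cy Φ ψ (q, v) := by
  let γ : C3 →L[ℝ] C3 →L[ℝ] ℝ := cy.g.inner (tubeMap Φ ψ q)
  change γ (tubeDeriv Φ ψ q (c • v)) (tubeDeriv Φ ψ q (c • v))
    = c ^ 2 * γ (tubeDeriv Φ ψ q v) (tubeDeriv Φ ψ q v)
  rw [map_smul, map_smul, map_smul, _root_.smul_apply]
  simp only [smul_eq_mul]; ring

/-- Near the zero section over the core circle, `tubeMap` is a smooth immersion, whose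
metric is uniformly equivalent to the Euclidean one. -/
theorem exists_box (hι : IsSpecialLagrangian cy ι)
    (hΦ : IsLagrangianNeighbourhood cy ι U Φ) (hψ : IsTube ρ l ψ)
    (hon : ∀ (s : ℝ) (v w : ℂ × ℝ), cy.g.inner (ι (ψ (0, s)))
      (baseDeriv ι (ψ (0, s)) (paramDeriv ψ (0, s) v))
      (baseDeriv ι (ψ (0, s)) (paramDeriv ψ (0, s) w))
        = v.1.re * w.1.re + v.1.im * w.1.im + v.2 * w.2) :
    ∃ r₀, 0 < r₀ ∧ r₀ ≤ 1 ∧ ∃ c, 0 < c ∧ ∀ q ∈ box l r₀, q.1 ∈ cyl ρ ∧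
      cotangentLift ψ q.1 (pairing q.2) ∈ U ∧ Function.Injective (tubeDeriv Φ ψ q) ∧
      ∀ v, c * ‖v‖ ≤ Real.sqrt (tubeMetric cy Φ ψ (q, v)) := by
  let S : Set ((ℂ × ℝ) × ℂ) := Metric.sphere 0 1
  let core : Set ((ℂ × ℝ) × ℂ) := (fun s : ℝ => (((0, s), 0) : (ℂ × ℝ) × ℂ)) '' Icc 0 l
  let A : Set (((ℂ × ℝ) × ℂ) × ((ℂ × ℝ) × ℂ)) := {x | (x.1.1 ∈ cyl ρ ∧
    cotangentLift ψ x.1.1 (pairing x.1.2) ∈ U) ∧ 0 < tubeMetric cy Φ ψ x}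
  have hS : IsCompact S := isCompact_sphere _ _
  have hcore : IsCompact core := isCompact_Icc.image (by fun_prop)
  have hcyl : ∀ s : ℝ, ((0, s) : ℂ × ℝ) ∈ cyl ρ := fun s => by simpa [cyl] using hψ.radius_pos
  have hA : core ×ˢ S ⊆ interior A := by
    rintro ⟨_, v⟩ ⟨⟨s, -, rfl⟩, hv⟩
    rw [mem_interior_iff_mem_nhds]
    have h1 := contDiffAt_tubeMetric hΦ hψ (q := ((0, s), 0)) (hcyl s) (lift_zero_mem hΦ _) v
    have hpos : 0 < tubeMetric cy Φ ψ (((0, s), 0), v) := by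
      have h2 := metric_core hι hΦ hψ (hcyl s) (hon s) v
      have hv0 : v ≠ 0 := by
        rintro rfl
        simp [S] at hv
      have h3 : 0 < Complex.normSq v.1.1 + v.1.2 ^ 2 + Complex.normSq v.2 := by
        by_contra hcon
        have a1 := Complex.normSq_nonneg v.1.1
        have a2 := Complex.normSq_nonneg v.2
        have a3 := sq_nonneg v.1.2
        apply hv0
        refine Prod.ext (Prod.ext ?_ ?_) ?_
        · exact Complex.normSq_eq_zero.1 (by linarith)
        · exact pow_eq_zero_iff (two_ne_zero) |>.1 (by linarith)
        · exact Complex.normSq_eq_zero.1 (by linarith)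
      exact h3.trans_eq h2.symm
    have h4 := eventually_lift_mem hΦ hψ (q := ((0, s), 0)) (hcyl s) (lift_zero_mem hΦ _)
    exact (continuousAt_fst.eventually h4).and (h1.continuousAt.eventually (lt_mem_nhds hpos))
  -- On the core the pull-back metric is Euclidean, hence positive on unit vectors; compactness of
  -- the core and of the sphere extends this to a neighbourhood of uniform size.
  obtain ⟨u, w, hu, -, hcu, hSw, huw⟩ := generalized_tube_lemma hcore hS isOpen_interior hA
  obtain ⟨r₁, hr₁, hr₁u⟩ := hcore.exists_cthickening_subset_open hu hcu
  -- The cap by `1` ensures `|u| ≤ 1` and `|p| ≤ 1` in the box, which the later estimates use to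
  -- absorb higher order terms.
  have hr : 0 < min r₁ 1 := lt_min hr₁ one_pos
  have hbox : box l (min r₁ 1) ⊆ u := by
    intro q hq
    rw [mem_box] at hq
    refine hr₁u (Metric.mem_cthickening_of_dist_le q ((0, q.1.2), 0) _ _ ⟨_, hq.2.1, rfl⟩ ?_)
    simp only [Prod.dist_eq, dist_zero_right, dist_self]
    refine max_le (max_le (hq.1.trans (min_le_left _ _)) hr₁.le) (hq.2.2.trans (min_le_left _ _))
  have hin : ∀ q ∈ box l (min r₁ 1), ∀ v ∈ S, (q, v) ∈ A := fun q hq v hv =>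
    interior_subset (huw ⟨hbox hq, hSw hv⟩)
  have hcont : ContinuousOn (tubeMetric cy Φ ψ) (box l (min r₁ 1) ×ˢ S) := by
    rintro ⟨q, v⟩ ⟨hq, hv⟩
    have h := hin q hq v hv
    exact (contDiffAt_tubeMetric hΦ hψ h.1.1 h.1.2 v).continuousAt.continuousWithinAt
  have hS1 : (((1, 0), 0) : (ℂ × ℝ) × ℂ) ∈ S := by simp [S]
  have hne : (box l (min r₁ 1) ×ˢ S).Nonempty :=
    ⟨(((0, 0), 0), ((1, 0), 0)), by
      rw [mem_box]; simp [hr.le, hψ.length_pos.le], hS1⟩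
  -- The minimum over unit vectors gives the lower bound for all vectors, since the metric is
  -- homogeneous of degree two.
  obtain ⟨x₀, hx₀, hmin⟩ := ((isCompact_box _ _).prod hS).exists_isMinOn hne hcont
  have hx₀' : 0 < tubeMetric cy Φ ψ x₀ := (hin x₀.1 hx₀.1 x₀.2 hx₀.2).2
  have hbound : ∀ q ∈ box l (min r₁ 1), ∀ v,
      tubeMetric cy Φ ψ x₀ * ‖v‖ ^ 2 ≤ tubeMetric cy Φ ψ (q, v) := by
    intro q hq v
    by_cases hv : v = 0
    · subst hv
      have := tubeMetric_smul (cy := cy) (Φ := Φ) (ψ := ψ) q 0 0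
      rw [smul_zero] at this
      rw [this]; simp
    · have hv' : 0 < ‖v‖ := norm_pos_iff.2 hv
      have h1 : tubeMetric cy Φ ψ x₀ ≤ tubeMetric cy Φ ψ (q, ‖v‖⁻¹ • v) := by
        refine isMinOn_iff.1 hmin _ ⟨hq, ?_⟩
        simp [S, norm_smul, hv'.ne']
      rw [tubeMetric_smul] at h1
      calc _ ≤ ‖v‖⁻¹ ^ 2 * tubeMetric cy Φ ψ (q, v) * ‖v‖ ^ 2 := by gcongr
        _ = _ := by field_simp
  refine ⟨min r₁ 1, hr, min_le_right _ _, Real.sqrt (tubeMetric cy Φ ψ x₀),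
    Real.sqrt_pos.2 hx₀', fun q hq => ?_⟩
  refine ⟨(hin q hq _ hS1).1.1, (hin q hq _ hS1).1.2, ?_, fun v => ?_⟩
  · refine (injective_iff_map_eq_zero _).2 fun v hv => ?_
    have h1 := hbound q hq v
    have h2 : tubeMetric cy Φ ψ (q, v) = 0 := by
      let γ : C3 →L[ℝ] C3 →L[ℝ] ℝ := cy.g.inner (tubeMap Φ ψ q)
      change γ (tubeDeriv Φ ψ q v) (tubeDeriv Φ ψ q v) = 0
      rw [hv, map_zero]
    rw [h2] at h1
    have h3 : ‖v‖ ^ 2 ≤ 0 := by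
      by_contra h
      have := mul_pos hx₀' (not_le.1 h)
      linarith
    exact norm_eq_zero.1 (pow_eq_zero_iff two_ne_zero |>.1 (le_antisymm h3 (sq_nonneg _)))
  · refine Real.le_sqrt_of_sq_le ?_
    rw [mul_pow, Real.sq_sqrt hx₀'.le]
    exact hbound q hq v

end Box


/-! ### Mean value estimates for functions vanishing on a linear subspace. -/

section Vanishing

variable {E : Type*} [NormedAddCommGroup E] [NormedSpace ℝ E]

/-- Uniform bounds for a smooth function on a compact set. -/
theorem exists_bound_deriv {N : E → ℝ} {κ : Set E} (hκ : IsCompact κ)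
    (hN : ∀ x ∈ κ, ContDiffAt ℝ ∞ N x) :
    ∃ C, 0 < C ∧ ∀ x ∈ κ, |N x| ≤ C ∧ ‖fderiv ℝ N x‖ ≤ C ∧ ‖fderiv ℝ (fderiv ℝ N) x‖ ≤ C := by
  have hD : ∀ x ∈ κ, ContDiffAt ℝ ∞ (fderiv ℝ N) x := fun x hx =>
    (hN x hx).fderiv_right (by simp)
  have hDD : ∀ x ∈ κ, ContDiffAt ℝ ∞ (fderiv ℝ (fderiv ℝ N)) x := fun x hx =>
    (hD x hx).fderiv_right (by simp)
  obtain ⟨C₀, h₀⟩ := hκ.exists_bound_of_continuousOn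
    fun x hx => (hN x hx).continuousAt.continuousWithinAt
  obtain ⟨C₁, h₁⟩ := hκ.exists_bound_of_continuousOn
    fun x hx => (hD x hx).continuousAt.continuousWithinAt
  obtain ⟨C₂, h₂⟩ := hκ.exists_bound_of_continuousOn (f := fderiv ℝ (fderiv ℝ N))
    fun x hx => (hDD x hx).continuousAt.continuousWithinAt
  refine ⟨max 1 (max C₀ (max C₁ C₂)), by positivity, fun x hx => ⟨?_, ?_, ?_⟩⟩
  · exact (h₀ x hx).trans (by simp)
  · exact (h₁ x hx).trans (by simp)
  · exact (h₂ x hx).trans (by simp)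

/-- A smooth function which vanishes on the image of a linear projection is estimated by the
distance to this image. -/
theorem exists_bound_of_vanishing {N : E → ℝ} {κ : Set E} (hκ : IsCompact κ) (pr : E →L[ℝ] E)
    (hN : ∀ x ∈ κ, ContDiffAt ℝ ∞ N x) (hseg : ∀ x ∈ κ, segment ℝ (pr x) x ⊆ κ)
    (h0 : ∀ x ∈ κ, ∀ᶠ y in 𝓝 x, N (pr y) = 0) :
    ∃ C, 0 < C ∧ ∀ x ∈ κ, |N x| ≤ C * ‖x - pr x‖ ∧
      ∀ v, |fderiv ℝ N x v| ≤ C * (‖x - pr x‖ * ‖pr v‖ + ‖v - pr v‖) := by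
  obtain ⟨C, hC, hb⟩ := exists_bound_deriv hκ hN
  refine ⟨C, hC, fun x hx => ⟨?_, fun v => ?_⟩⟩
  · have h1 := (convex_segment (pr x) x).norm_image_sub_le_of_norm_fderiv_le (𝕜 := ℝ) (f := N)
      (fun y hy => (hN y (hseg x hx hy)).differentiableAt (by simp))
      (fun y hy => (hb y (hseg x hx hy)).2.1) (left_mem_segment ℝ _ _) (right_mem_segment ℝ _ _)
    rwa [(h0 x hx).self_of_nhds, sub_zero] at h1
  · have hp : pr x ∈ κ := hseg x hx (left_mem_segment ℝ _ _)
    have h1 := (convex_segment (pr x) x).norm_image_sub_le_of_norm_fderiv_le (𝕜 := ℝ)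
      (f := fderiv ℝ N)
      (fun y hy => ((hN y (hseg x hx hy)).fderiv_right (m := ∞) (by simp)).differentiableAt
        (by simp))
      (fun y hy => (hb y (hseg x hx hy)).2.2) (left_mem_segment ℝ _ _) (right_mem_segment ℝ _ _)
    -- At the projected point the differential vanishes along the subspace. Hence on `pr v` only the
    -- difference of the differentials at `x` and `pr x` contributes, controlled by the second
    -- derivative; the rest `v - pr v` needs only a bound on the first.
    have h2 : fderiv ℝ N (pr x) (pr v) = 0 := by
      have h3 : HasFDerivAt (fun y => N (pr y)) ((fderiv ℝ N (pr x)).comp pr) x :=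
        (((hN _ hp).differentiableAt (by simp)).hasFDerivAt).comp x pr.hasFDerivAt
      have h4 : HasFDerivAt (fun y => N (pr y)) (0 : E →L[ℝ] ℝ) x :=
        (hasFDerivAt_const (0 : ℝ) x).congr_of_eventuallyEq (h0 x hx)
      exact congrArg (fun L : E →L[ℝ] ℝ => L v) (h3.unique h4)
    have h5 : fderiv ℝ N x v = fderiv ℝ N x (v - pr v)
        + (fderiv ℝ N x - fderiv ℝ N (pr x)) (pr v) := by
      rw [map_sub, _root_.sub_apply, h2]; ring
    rw [h5]
    have h6 := (fderiv ℝ N x).le_of_opNorm_le (hb x hx).2.1 (v - pr v)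
    have h7 := (fderiv ℝ N x - fderiv ℝ N (pr x)).le_of_opNorm_le h1 (pr v)
    rw [Real.norm_eq_abs] at h6 h7
    calc _ ≤ |fderiv ℝ N x (v - pr v)| + |(fderiv ℝ N x - fderiv ℝ N (pr x)) (pr v)| :=
          abs_add_le _ _
      _ ≤ C * ‖v - pr v‖ + C * ‖x - pr x‖ * ‖pr v‖ := add_le_add h6 h7
      _ = _ := by ring

end Vanishing


/-! ### Uniform bounds for the angles of antiholomorphic graphs and of general graphs. -/

section AngleEstimates

variable {Y : Type*} [TopologicalSpace Y] [ChartedSpace C3 Y] [IsManifold 𝓘(ℂ, C3) ω Y]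
  {Z : Type*} [TopologicalSpace Z] [ChartedSpace R3 Z] [IsManifold (𝓡 3) ∞ Z]
  {cy : CalabiYau Y} {ι : Z → Y} {U : Set (Cotangent Z)} {Φ : Cotangent Z → Y}
  {ψ : ℂ × ℝ → Z} {ρ l r₀ : ℝ}

variable (cy Φ ψ) in
/-- The angle of the frames which belong to graphs of antiholomorphic functions over
branched coverings. -/
def coreAngle (x : ((ℂ × ℝ) × ℂ) × (ℂ × ℂ)) : ℝ :=
  planeAngle cy Φ ψ (x.1, (x.2, (Complex.I * x.2.1, -(Complex.I * x.2.2))))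

variable (cy Φ ψ) in
/-- The angle of the frames of tangent spaces of graphs. -/
def graphAngle (x : ((ℂ × ℝ) × ℂ) × (ℂ × ℂ)) : ℝ :=
  planeAngle cy Φ ψ (x.1, ((1, x.2.1), (Complex.I, x.2.2)))

/-- `(u, p) ↦ (iu, -ip)` is a complex structure on `ℂ²`, and a nonzero vector is independent over
`ℝ` of its image. -/
theorem core_independent {ζ τ : ℂ} (h : ζ ≠ 0 ∨ τ ≠ 0) (a b : ℝ)
    (hab : a • (ζ, τ) + b • (Complex.I * ζ, -(Complex.I * τ)) = 0) : a = 0 ∧ b = 0 := by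
  obtain ⟨h1, h2⟩ := Prod.ext_iff.1 hab
  simp only [Prod.fst_add, Prod.smul_fst, Prod.snd_add, Prod.smul_snd, Prod.fst_zero,
    Prod.snd_zero, Complex.real_smul] at h1 h2
  rcases h with h | h
  · have : ((a : ℂ) + b * Complex.I) * ζ = 0 := by linear_combination h1
    have := (mul_eq_zero.1 this).resolve_right h
    simpa [Complex.ext_iff] using this
  · have : ((a : ℂ) - b * Complex.I) * τ = 0 := by linear_combination h2
    have := (mul_eq_zero.1 this).resolve_right h
    simpa [Complex.ext_iff] using this

theorem graph_independent (β : ℂ × ℂ) (a b : ℝ)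
    (hab : a • ((1, β.1) : ℂ × ℂ) + b • (Complex.I, β.2) = 0) : a = 0 ∧ b = 0 := by
  obtain ⟨h1, -⟩ := Prod.ext_iff.1 hab
  simpa [Complex.ext_iff] using h1

theorem contDiffAt_coreAngle (hΦ : IsLagrangianNeighbourhood cy ι U Φ) (hψ : IsTube ρ l ψ)
    {q : (ℂ × ℝ) × ℂ} (hq : q.1 ∈ cyl ρ) (hU : cotangentLift ψ q.1 (pairing q.2) ∈ U)
    (hinj : Function.Injective (tubeDeriv Φ ψ q)) {w : ℂ × ℂ} (hw : w.1 ≠ 0 ∨ w.2 ≠ 0) :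
    ContDiffAt ℝ ∞ (coreAngle cy Φ ψ) (q, w) := by
  have h := contDiffAt_planeAngle (cy := cy) hΦ hψ hq hU hinj
    (w := (w, (Complex.I * w.1, -(Complex.I * w.2)))) (core_independent hw)
  exact ContDiffAt.comp (g := planeAngle cy Φ ψ) (f := fun x : ((ℂ × ℝ) × ℂ) × (ℂ × ℂ) =>
    (x.1, (x.2, (Complex.I * x.2.1, -(Complex.I * x.2.2))))) (q, w) h (by fun_prop)

theorem contDiffAt_graphAngle (hΦ : IsLagrangianNeighbourhood cy ι U Φ) (hψ : IsTube ρ l ψ)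
    {q : (ℂ × ℝ) × ℂ} (hq : q.1 ∈ cyl ρ) (hU : cotangentLift ψ q.1 (pairing q.2) ∈ U)
    (hinj : Function.Injective (tubeDeriv Φ ψ q)) (β : ℂ × ℂ) :
    ContDiffAt ℝ ∞ (graphAngle cy Φ ψ) (q, β) := by
  have h := contDiffAt_planeAngle (cy := cy) hΦ hψ hq hU hinj
    (w := ((1, β.1), (Complex.I, β.2))) (graph_independent β)
  exact ContDiffAt.comp (g := planeAngle cy Φ ψ) (f := fun x : ((ℂ × ℝ) × ℂ) × (ℂ × ℂ) =>
    (x.1, ((1, x.2.1), (Complex.I, x.2.2)))) (q, β) h (by fun_prop)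

/-- The projection to the zero section over the core circle. -/
def coreProj : ((ℂ × ℝ) × ℂ) × (ℂ × ℂ) →L[ℝ] ((ℂ × ℝ) × ℂ) × (ℂ × ℂ) :=
  ((((0 : _ →L[ℝ] ℂ).prod ((ContinuousLinearMap.snd ℝ ℂ ℝ).comp
    ((ContinuousLinearMap.fst ℝ (ℂ × ℝ) ℂ).comp (ContinuousLinearMap.fst ℝ _ (ℂ × ℂ))))).prod 0)).prod
    (ContinuousLinearMap.snd ℝ ((ℂ × ℝ) × ℂ) (ℂ × ℂ))

theorem coreProj_apply (x : ((ℂ × ℝ) × ℂ) × (ℂ × ℂ)) : coreProj x = (((0, x.1.1.2), 0), x.2) := rfl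

/-- The projection to the tangent spaces of the zero section. -/
def graphProj : ((ℂ × ℝ) × ℂ) × (ℂ × ℂ) →L[ℝ] ((ℂ × ℝ) × ℂ) × (ℂ × ℂ) :=
  (((ContinuousLinearMap.fst ℝ (ℂ × ℝ) ℂ).comp (ContinuousLinearMap.fst ℝ _ (ℂ × ℂ))).prod 0).prod 0

theorem graphProj_apply (x : ((ℂ × ℝ) × ℂ) × (ℂ × ℂ)) : graphProj x = ((x.1.1, 0), 0) := rfl

theorem convex_box (l r : ℝ) : Convex ℝ (box l r) :=
  ((convex_closedBall _ _).prod (convex_Icc _ _)).prod (convex_closedBall _ _)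

/-- `planeAngle_core` gives vanishing over the core for every direction `w`. Restricting to unit `w`
makes the domain compact; it is not convex, but the segment from `coreProj x` to `x` does not move
`w`. Only the components `v.1.1.2` and `v.2` survive the projection, so these alone get the small
factor. -/
theorem exists_bound_coreAngle (hι : IsSpecialLagrangian cy ι)
    (hΦ : IsLagrangianNeighbourhood cy ι U Φ) (hψ : IsTube ρ l ψ)
    (hon : ∀ (s : ℝ) (v w : ℂ × ℝ), cy.g.inner (ι (ψ (0, s)))
      (baseDeriv ι (ψ (0, s)) (paramDeriv ψ (0, s) v))
      (baseDeriv ι (ψ (0, s)) (paramDeriv ψ (0, s) w))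
        = v.1.re * w.1.re + v.1.im * w.1.im + v.2 * w.2) (hr₀ : 0 < r₀)
    (hbox : ∀ q ∈ box l r₀, q.1 ∈ cyl ρ ∧ cotangentLift ψ q.1 (pairing q.2) ∈ U ∧
      Function.Injective (tubeDeriv Φ ψ q)) :
    ∃ C, 0 < C ∧ ∀ q ∈ box l r₀, ∀ w : ℂ × ℂ, ‖w‖ = 1 →
      |coreAngle cy Φ ψ (q, w)| ≤ C * max ‖q.1.1‖ ‖q.2‖ ∧
      ∀ v : ((ℂ × ℝ) × ℂ) × (ℂ × ℂ), |fderiv ℝ (coreAngle cy Φ ψ) (q, w) v| ≤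
        C * (max ‖q.1.1‖ ‖q.2‖ * max ‖v.1.1.2‖ ‖v.2‖ + ‖v.1‖) := by
  have hN : ∀ x ∈ box l r₀ ×ˢ Metric.sphere (0 : ℂ × ℂ) 1, ContDiffAt ℝ ∞ (coreAngle cy Φ ψ) x := by
    rintro ⟨q, w⟩ ⟨hq, hw⟩
    obtain ⟨h1, h2, h3⟩ := hbox q hq
    refine contDiffAt_coreAngle hΦ hψ h1 h2 h3 ?_
    by_contra hcon
    push Not at hcon
    have : w = 0 := Prod.ext hcon.1 hcon.2
    simp [this] at hw
  have hseg : ∀ x ∈ box l r₀ ×ˢ Metric.sphere (0 : ℂ × ℂ) 1,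
      segment ℝ (coreProj x) x ⊆ box l r₀ ×ˢ Metric.sphere (0 : ℂ × ℂ) 1 := by
    rintro ⟨q, w⟩ ⟨hq, hw⟩
    have h1 : ((0, q.1.2), (0 : ℂ)) ∈ box l r₀ := by
      rw [mem_box] at hq ⊢
      simpa [hr₀.le] using hq.2.1
    rw [coreProj_apply]
    rintro y ⟨a, b, ha, hb, hab, rfl⟩
    refine ⟨convex_box l r₀ h1 hq ha hb hab, ?_⟩
    have : (a • (((0, q.1.2), (0 : ℂ)), w) + b • (q, w) : ((ℂ × ℝ) × ℂ) × (ℂ × ℂ)).2 = w := by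
      simp only [Prod.snd_add, Prod.smul_snd, ← add_smul, hab, one_smul]
    rw [this]; exact hw
  have h0 : ∀ x ∈ box l r₀ ×ˢ Metric.sphere (0 : ℂ × ℂ) 1, ∀ᶠ y in 𝓝 x,
      coreAngle cy Φ ψ (coreProj y) = 0 := by
    rintro x -
    refine Eventually.of_forall fun y => ?_
    rw [coreProj_apply]
    exact planeAngle_core hι hΦ hψ (by simpa [cyl] using hψ.radius_pos) (hon _) _ _
  obtain ⟨C, hC, h⟩ := exists_bound_of_vanishing (N := coreAngle cy Φ ψ)
    ((isCompact_box l r₀).prod (isCompact_sphere (0 : ℂ × ℂ) 1)) coreProj hN hseg h0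
  refine ⟨C, hC, fun q hq w hw => ?_⟩
  have h1 := h (q, w) ⟨hq, by simpa using hw⟩
  have e : ∀ v : ((ℂ × ℝ) × ℂ) × (ℂ × ℂ), ‖v - coreProj v‖ = max ‖v.1.1.1‖ ‖v.1.2‖ := by
    intro v; simp [coreProj_apply, Prod.norm_def]
  rw [e] at h1
  refine ⟨h1.1, fun v => (h1.2 v).trans ?_⟩
  rw [e]
  have e2 : ‖coreProj v‖ = max ‖v.1.1.2‖ ‖v.2‖ := by
    simp [coreProj_apply, Prod.norm_def]
  rw [e2]
  have e3 : max ‖v.1.1.1‖ ‖v.1.2‖ ≤ ‖v.1‖ :=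
    max_le ((norm_fst_le v.1.1).trans (norm_fst_le v.1)) (norm_snd_le v.1)
  gcongr

/-- The real inner product of `ℂ²`. -/
def planeInner (x y : ℂ × ℂ) : ℝ := x.1.re * y.1.re + x.1.im * y.1.im + x.2.re * y.2.re + x.2.im * y.2.im

/-- The orthonormal pairs of vectors of `ℂ²`. -/
def planeStiefel : Set ((ℂ × ℂ) × (ℂ × ℂ)) :=
  {w | planeInner w.1 w.1 = 1 ∧ planeInner w.2 w.2 = 1 ∧ planeInner w.1 w.2 = 0}

theorem planeInner_self (x : ℂ × ℂ) : planeInner x x = ‖x.1‖ ^ 2 + ‖x.2‖ ^ 2 := by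
  rw [Complex.sq_norm, Complex.sq_norm, Complex.normSq_apply, Complex.normSq_apply, planeInner]
  ring

theorem norm_le_of_planeInner {x : ℂ × ℂ} (h : planeInner x x = 1) : ‖x‖ ≤ 1 := by
  rw [planeInner_self] at h
  refine max_le ?_ ?_
  · nlinarith [sq_nonneg ‖x.2‖, norm_nonneg x.1]
  · nlinarith [sq_nonneg ‖x.1‖, norm_nonneg x.2]

theorem isCompact_planeStiefel : IsCompact planeStiefel := by
  refine Metric.isCompact_of_isClosed_isBounded ?_ ?_
  · refine (isClosed_eq ?_ continuous_const).inter
      ((isClosed_eq ?_ continuous_const).inter (isClosed_eq ?_ continuous_const)) <;>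
    · unfold planeInner
      fun_prop
  · refine (Metric.isBounded_closedBall (x := 0) (r := 1)).subset fun w hw => ?_
    rw [mem_closedBall_zero_iff]
    exact max_le (norm_le_of_planeInner hw.1) (norm_le_of_planeInner hw.2.1)

theorem planeStiefel_independent {w : (ℂ × ℂ) × (ℂ × ℂ)} (hw : w ∈ planeStiefel) (a b : ℝ)
    (hab : a • w.1 + b • w.2 = 0) : a = 0 ∧ b = 0 := by
  obtain ⟨h1, h2, h3⟩ := hw
  have e1 : planeInner (a • w.1 + b • w.2) w.1 = 0 := by rw [hab]; simp [planeInner]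
  have e2 : planeInner (a • w.1 + b • w.2) w.2 = 0 := by rw [hab]; simp [planeInner]
  unfold planeInner at *
  simp at e1 e2
  constructor
  · linear_combination e1 - a * h1 - b * h3
  · linear_combination e2 - a * h3 - b * h2

/-- Orthonormalization of the frame of a graph with uniformly bounded coefficients. -/
theorem exists_orthonormal (β : ℂ × ℂ) : ∃ a b d : ℝ, 0 < a ∧ 0 < d ∧ a ≤ 1 ∧ |b| ≤ 1 ∧ d ≤ 1 ∧
    (a • ((1, β.1) : ℂ × ℂ) + (0 : ℝ) • ((Complex.I, β.2) : ℂ × ℂ),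
      b • ((1, β.1) : ℂ × ℂ) + d • ((Complex.I, β.2) : ℂ × ℂ)) ∈ planeStiefel := by
  set v₁ : ℂ × ℂ := (1, β.1)
  set v₂ : ℂ × ℂ := (Complex.I, β.2)
  set n := planeInner v₁ v₁ with hn
  set k := planeInner v₁ v₂ / n with hk
  have hn1 : 1 ≤ n := by
    rw [hn, planeInner_self]; simp [v₁]
  have hkn : planeInner v₁ v₂ = k * n := by rw [hk]; field_simp
  set w := v₂ - k • v₁
  set N := planeInner w w with hN
  -- Gram-Schmidt has bounded coefficients here because the first components are `1` and `i - k`: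
  -- they force `n ≥ 1` and `N ≥ 1 + k²`, however large `β` is.
  have hN1 : 1 + k ^ 2 ≤ N := by
    have : N = 1 + k ^ 2 + ‖w.2‖ ^ 2 := by
      rw [hN, planeInner_self, Complex.sq_norm, Complex.normSq_apply]
      simp [w, v₁, v₂]; ring
    rw [this]; nlinarith [sq_nonneg ‖w.2‖]
  have hn0 : 0 < Real.sqrt n := Real.sqrt_pos.2 (by linarith)
  have hN0 : 0 < Real.sqrt N := Real.sqrt_pos.2 (by nlinarith [sq_nonneg k])
  have hn2 : Real.sqrt n ^ 2 = n := Real.sq_sqrt (by linarith)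
  have hN2 : Real.sqrt N ^ 2 = N := Real.sq_sqrt (by nlinarith [sq_nonneg k])
  have hNk : |k| ≤ Real.sqrt N := Real.abs_le_sqrt (by linarith)
  have hNone : 1 ≤ Real.sqrt N := Real.one_le_sqrt.2 (by nlinarith [sq_nonneg k])
  have hv12 : planeInner v₁ w = 0 := by
    have : planeInner v₁ w = planeInner v₁ v₂ - k * n := by
      rw [hn]; simp only [planeInner, w, Prod.fst_sub, Prod.snd_sub, Prod.smul_fst, Prod.smul_snd,
        Complex.sub_re, Complex.sub_im, Complex.real_smul, Complex.re_ofReal_mul, Complex.im_ofReal_mul]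
      ring
    rw [this, hkn, sub_self]
  have hsm : ∀ (a b : ℝ) (x y : ℂ × ℂ), planeInner (a • x) (b • y) = a * b * planeInner x y := by
    intro a b x y; simp [planeInner]; ring
  refine ⟨(Real.sqrt n)⁻¹, -(k * (Real.sqrt N)⁻¹), (Real.sqrt N)⁻¹, by positivity, by positivity,
    inv_le_one_of_one_le₀ (Real.one_le_sqrt.2 hn1), ?_, inv_le_one_of_one_le₀ hNone, ?_⟩
  · rw [abs_neg, abs_mul, abs_of_pos (inv_pos.2 hN0), ← div_eq_mul_inv]
    exact (div_le_one hN0).2 hNk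
  · have e : -(k * (Real.sqrt N)⁻¹) • v₁ + (Real.sqrt N)⁻¹ • v₂ = (Real.sqrt N)⁻¹ • w := by
      simp only [w]; module
    rw [e, zero_smul, add_zero]
    refine ⟨?_, ?_, ?_⟩
    · rw [hsm, ← hn]; field_simp; rw [hn2]
    · rw [hsm, ← hN]; field_simp; rw [hN2]
    · rw [hsm, hv12, mul_zero]

/-- For `‖β‖ ≤ 1` this is the mean value estimate at the horizontal plane. For `‖β‖ ≥ 1` the right
side is bounded below, so no smallness is needed: boundedness on the compact set of orthonormal
frames suffices, and it is uniform in the slope. -/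
theorem exists_bound_graphAngle (hι : IsSpecialLagrangian cy ι)
    (hΦ : IsLagrangianNeighbourhood cy ι U Φ) (hψ : IsTube ρ l ψ) (hr₀ : 0 < r₀)
    (hbox : ∀ q ∈ box l r₀, q.1 ∈ cyl ρ ∧ cotangentLift ψ q.1 (pairing q.2) ∈ U ∧
      Function.Injective (tubeDeriv Φ ψ q)) :
    ∃ C, 0 < C ∧ ∀ q ∈ box l r₀, ∀ β : ℂ × ℂ,
      |graphAngle cy Φ ψ (q, β)| ≤ C * (‖q.2‖ + ‖β‖) ∧
      ∀ v : ((ℂ × ℝ) × ℂ) × (ℂ × ℂ), |fderiv ℝ (graphAngle cy Φ ψ) (q, β) v| ≤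
        C * ((‖q.2‖ + ‖β‖) * ‖v.1.1‖ + (‖v.1.2‖ + ‖v.2‖)) := by
  have hN : ∀ x ∈ box l r₀ ×ˢ Metric.closedBall (0 : ℂ × ℂ) 1, ContDiffAt ℝ ∞ (graphAngle cy Φ ψ) x := by
    rintro ⟨q, β⟩ ⟨hq, -⟩
    obtain ⟨h1, h2, h3⟩ := hbox q hq
    exact contDiffAt_graphAngle hΦ hψ h1 h2 h3 β
  have hseg : ∀ x ∈ box l r₀ ×ˢ Metric.closedBall (0 : ℂ × ℂ) 1,
      segment ℝ (graphProj x) x ⊆ box l r₀ ×ˢ Metric.closedBall (0 : ℂ × ℂ) 1 := by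
    rintro ⟨q, β⟩ ⟨hq, hβ⟩
    refine ((convex_box l r₀).prod (convex_closedBall 0 1)).segment_subset ⟨?_, ?_⟩ ⟨hq, hβ⟩
    · rw [graphProj_apply]
      rw [mem_box] at hq ⊢
      simpa [hr₀.le] using ⟨hq.1, hq.2.1⟩
    · simp [graphProj_apply]
  have h0 : ∀ x ∈ box l r₀ ×ˢ Metric.closedBall (0 : ℂ × ℂ) 1, ∀ᶠ y in 𝓝 x,
      graphAngle cy Φ ψ (graphProj y) = 0 := by
    rintro ⟨q, β⟩ ⟨hq, -⟩
    have h1 : ∀ᶠ y : ((ℂ × ℝ) × ℂ) × (ℂ × ℂ) in 𝓝 (q, β), y.1.1 ∈ cyl ρ :=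
      (continuous_fst.comp continuous_fst).continuousAt.eventually
        (isOpen_cyl.mem_nhds (hbox q hq).1)
    filter_upwards [h1] with y hy
    rw [graphProj_apply]
    exact planeAngle_horizontal hι hΦ hψ hy _ _
  obtain ⟨C₁, hC₁, h₁⟩ := exists_bound_of_vanishing (N := graphAngle cy Φ ψ)
    ((isCompact_box l r₀).prod (isCompact_closedBall (0 : ℂ × ℂ) 1)) graphProj hN hseg h0
  obtain ⟨C₂, hC₂, h₂⟩ := exists_bound_deriv (N := planeAngle cy Φ ψ)
    ((isCompact_box l r₀).prod isCompact_planeStiefel) (by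
      rintro ⟨q, w⟩ ⟨hq, hw⟩
      obtain ⟨h1, h2, h3⟩ := hbox q hq
      exact contDiffAt_planeAngle hΦ hψ h1 h2 h3 (planeStiefel_independent hw))
  refine ⟨max C₁ (2 * C₂), by positivity, fun q hq β => ?_⟩
  rcases le_total ‖β‖ 1 with hβ | hβ
  · have h := h₁ (q, β) ⟨hq, by simpa using hβ⟩
    have e : ∀ v : ((ℂ × ℝ) × ℂ) × (ℂ × ℂ), ‖v - graphProj v‖ ≤ ‖v.1.2‖ + ‖v.2‖ := by
      intro v
      rw [graphProj_apply]
      have : ‖v - ((v.1.1, 0), 0)‖ = max ‖v.1.2‖ ‖v.2‖ := by simp [Prod.norm_def]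
      rw [this]
      exact max_le (le_add_of_nonneg_right (norm_nonneg _)) (le_add_of_nonneg_left (norm_nonneg _))
    have e2 : ∀ v : ((ℂ × ℝ) × ℂ) × (ℂ × ℂ), ‖graphProj v‖ = ‖v.1.1‖ := by
      intro v
      rw [graphProj_apply]; simp [Prod.norm_def]
    refine ⟨h.1.trans ?_, fun v => (h.2 v).trans ?_⟩
    · exact mul_le_mul (le_max_left _ _) (e _) (norm_nonneg _) (by positivity)
    · rw [e2]
      exact mul_le_mul (le_max_left _ _) (add_le_add (mul_le_mul_of_nonneg_right (e (q, β))
        (norm_nonneg _)) (e v)) (by positivity) (by positivity)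
  · obtain ⟨a, b, d, ha, hd, ha1, hb1, hd1, hw⟩ := exists_orthonormal β
    -- The orthonormalizing coefficients are frozen at this `β`. Thus `Λ` is affine, its linear part
    -- has entries at most one, and invariance of the angle still identifies `graphAngle` with
    -- `planeAngle ∘ Λ` everywhere.
    let Λ : ((ℂ × ℝ) × ℂ) × (ℂ × ℂ) → ((ℂ × ℝ) × ℂ) × ((ℂ × ℂ) × (ℂ × ℂ)) := fun x =>
      (x.1, (a • ((1, x.2.1) : ℂ × ℂ) + (0 : ℝ) • ((Complex.I, x.2.2) : ℂ × ℂ),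
        b • ((1, x.2.1) : ℂ × ℂ) + d • ((Complex.I, x.2.2) : ℂ × ℂ)))
    have hΛ : graphAngle cy Φ ψ = fun x => planeAngle cy Φ ψ (Λ x) := by
      funext x
      exact (planeAngle_change x.1 ((1, x.2.1), (Complex.I, x.2.2)) a 0 b d
        (by simpa using mul_pos ha hd)).symm
    have h := h₂ (Λ (q, β)) ⟨hq, hw⟩
    obtain ⟨g1, g2, g3⟩ := hbox q hq
    have hN : DifferentiableAt ℝ (planeAngle cy Φ ψ) (Λ (q, β)) :=
      (contDiffAt_planeAngle hΦ hψ g1 g2 g3 (planeStiefel_independent hw)).differentiableAt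
        (by simp)
    let Λ' : ((ℂ × ℝ) × ℂ) × (ℂ × ℂ) →L[ℝ] ((ℂ × ℝ) × ℂ) × ((ℂ × ℂ) × (ℂ × ℂ)) :=
      (ContinuousLinearMap.fst ℝ _ _).prod
        (((0 : _ →L[ℝ] ℂ).prod (a • ((ContinuousLinearMap.fst ℝ ℂ ℂ).comp
            (ContinuousLinearMap.snd ℝ _ _)))).prod
          ((0 : _ →L[ℝ] ℂ).prod (b • ((ContinuousLinearMap.fst ℝ ℂ ℂ).comp
            (ContinuousLinearMap.snd ℝ _ _)) + d • ((ContinuousLinearMap.snd ℝ ℂ ℂ).comp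
            (ContinuousLinearMap.snd ℝ _ _)))))
    have hΛ' : HasFDerivAt Λ Λ' (q, β) := by
      have : Λ = fun x => Λ' x + Λ 0 := by
        funext x
        simp [Λ, Λ']
      rw [this]
      exact Λ'.hasFDerivAt.add_const _
    have hbΛ : ∀ v, ‖Λ' v‖ ≤ ‖v.1‖ + 2 * ‖v.2‖ := by
      intro v
      have hv1 := norm_fst_le v.2
      have hv2 := norm_snd_le v.2
      have n0 := norm_nonneg v.1
      have n1 := norm_nonneg v.2
      have n2 := norm_nonneg v.2.1
      have n3 := norm_nonneg v.2.2
      have c1 : ‖a • v.2.1‖ ≤ ‖v.2‖ := by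
        rw [norm_smul, Real.norm_eq_abs, abs_of_pos ha]; nlinarith
      have c2 : ‖b • v.2.1 + d • v.2.2‖ ≤ 2 * ‖v.2‖ := by
        refine (norm_add_le _ _).trans ?_
        rw [norm_smul, norm_smul, Real.norm_eq_abs, Real.norm_eq_abs, abs_of_pos hd]
        nlinarith
      have : Λ' v = (v.1, ((0, a • v.2.1), (0, b • v.2.1 + d • v.2.2))) := rfl
      rw [this]
      refine max_le (by linarith) (max_le ?_ ?_)
      · exact max_le (by simp; positivity) (by dsimp only; linarith)
      · exact max_le (by simp; positivity) (by dsimp only; linarith)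
    constructor
    · rw [hΛ]
      refine h.1.trans ?_
      calc C₂ ≤ max C₁ (2 * C₂) := le_max_of_le_right (by linarith)
        _ ≤ _ := le_mul_of_one_le_right (by positivity) (by linarith [norm_nonneg q.2])
    · intro v
      have hc : fderiv ℝ (graphAngle cy Φ ψ) (q, β) v
          = fderiv ℝ (planeAngle cy Φ ψ) (Λ (q, β)) (Λ' v) := by
        rw [hΛ]
        exact congrArg (fun L : _ →L[ℝ] ℝ => L v) (hN.hasFDerivAt.comp (q, β) hΛ').fderiv
      rw [hc]
      refine ((fderiv ℝ (planeAngle cy Φ ψ) (Λ (q, β))).le_of_opNorm_le h.2.1 (Λ' v)).trans ?_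
      have n1 : ‖v.1‖ ≤ ‖v.1.1‖ + ‖v.1.2‖ :=
        max_le (le_add_of_nonneg_right (norm_nonneg _)) (le_add_of_nonneg_left (norm_nonneg _))
      have n2 := norm_nonneg v.1.1
      have n3 := norm_nonneg v.1.2
      have n4 := norm_nonneg v.2
      have n5 := norm_nonneg q.2
      calc C₂ * ‖Λ' v‖ ≤ C₂ * (2 * ((‖q.2‖ + ‖β‖) * ‖v.1.1‖ + (‖v.1.2‖ + ‖v.2‖))) := by
            refine mul_le_mul_of_nonneg_left ((hbΛ v).trans ?_) hC₂.le
            nlinarith [mul_nonneg n5 n2, mul_le_mul_of_nonneg_right hβ n2]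
        _ = 2 * C₂ * ((‖q.2‖ + ‖β‖) * ‖v.1.1‖ + (‖v.1.2‖ + ‖v.2‖)) := by ring
        _ ≤ _ := mul_le_mul_of_nonneg_right (le_max_right _ _) (by positivity)

end AngleEstimates


/-! ### The section `f_! dh` in parametrizations. -/

section PushGraph

variable {Z : Type*} [TopologicalSpace Z] [ChartedSpace R3 Z] [IsManifold (𝓡 3) ∞ Z]
  {X : Type*} [TopologicalSpace X] [ChartedSpace R3 X] [IsManifold (𝓡 3) ∞ X]
  {W : Type*} [NormedAddCommGroup W] [NormedSpace ℝ W] [FiniteDimensional ℝ W]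

omit [IsManifold (𝓡 3) ∞ Z] in
theorem cotangent_ext {z z' : Z} {η η' : R3 →L[ℝ] ℝ} (hz : z = z') (hη : η = η') :
    (⟨z, η⟩ : Cotangent Z) = ⟨z', η'⟩ := by
  subst hz hη; rfl

omit [IsManifold (𝓡 3) ∞ Z] in
/-- The graph of a differential in a parametrization. -/
theorem pushGraph_param {ψ : W → X} {φ : W → Z} {w₀ : W} {f : X → Z} {h : X → ℝ} {k : W → ℝ}
    (hψ : ContMDiffAt 𝓘(ℝ, W) (𝓡 3) ∞ ψ w₀)
    (hb : Function.Bijective (mfderiv 𝓘(ℝ, W) (𝓡 3) ψ w₀))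
    (hφ : ContMDiffAt 𝓘(ℝ, W) (𝓡 3) ∞ φ w₀)
    (hb' : Function.Bijective (mfderiv 𝓘(ℝ, W) (𝓡 3) φ w₀))
    (hf : ∀ᶠ w in 𝓝 w₀, f (ψ w) = φ w) (hk : ContDiffAt ℝ ∞ k w₀)
    (hh : ∀ᶠ w in 𝓝 w₀, h (ψ w) = k w) :
    pushGraph f h (ψ w₀) = cotangentLift φ w₀ (fderiv ℝ k w₀) := by
  let Df : R3 →L[ℝ] R3 := mfderiv (𝓡 3) (𝓡 3) f (ψ w₀)
  let Dh : R3 →L[ℝ] ℝ := mfderiv (𝓡 3) 𝓘(ℝ, ℝ) h (ψ w₀)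
  have h1 : ∀ v, Df (paramDeriv ψ w₀ v) = paramDeriv φ w₀ v := fun v => mfderiv_param hψ hb hφ hf v
  have h2 : ∀ v, Dh (paramDeriv ψ w₀ v) = fderiv ℝ k w₀ v := fun v => by
    refine (mfderiv_param hψ hb hk.contMDiffAt hh v).trans ?_
    rw [mfderiv_eq_fderiv]; rfl
  have hsurj : Function.Surjective Df := by
    intro y
    obtain ⟨v, rfl⟩ := hb'.2 y
    exact ⟨_, h1 v⟩
  have hinj : Function.Injective Df := LinearMap.injective_iff_surjective.2 hsurj
  let e : R3 ≃L[ℝ] R3 := ContinuousLinearEquiv.ofBijective Df (LinearMap.ker_eq_bot.2 hinj)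
    (LinearMap.range_eq_top.2 hsurj)
  have he : (e : R3 →L[ℝ] R3) = Df := rfl
  have hinv : Df.inverse = e.symm := by rw [← he, ContinuousLinearMap.inverse_equiv]
  refine cotangent_ext (η := Dh.comp Df.inverse)
    (η' := (fderiv ℝ k w₀).comp (paramDeriv φ w₀).inverse) hf.self_of_nhds ?_
  ext1 y
  obtain ⟨v, rfl⟩ := hb'.2 y
  have h3 : (paramDeriv φ w₀).inverse (paramDeriv φ w₀ v) = v := inverse_paramDeriv_apply hb' v
  have h4 : Df.inverse (paramDeriv φ w₀ v) = paramDeriv ψ w₀ v := by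
    rw [hinv, ← h1 v]
    exact e.symm_apply_apply _
  exact (congrArg Dh h4).trans ((h2 v).trans (congrArg (fderiv ℝ k w₀) h3).symm)

omit [IsManifold (𝓡 3) ∞ Z] in
/-- Reparametrization of the lift to the cotangent bundle. -/
theorem cotangentLift_comp {φ : W → Z} {e : W → W} {w₀ : W} {e' : W →L[ℝ] W}
    (hφ : ContMDiffAt 𝓘(ℝ, W) (𝓡 3) ∞ φ (e w₀))
    (hb : Function.Bijective (mfderiv 𝓘(ℝ, W) (𝓡 3) φ (e w₀)))
    (he : HasFDerivAt e e' w₀) (hb' : Function.Bijective e') (η : W →L[ℝ] ℝ) :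
    cotangentLift (fun w => φ (e w)) w₀ (η.comp e') = cotangentLift φ (e w₀) η := by
  have h1 := mfderiv_comp w₀ (hφ.mdifferentiableAt (by simp)) he.differentiableAt.mdifferentiableAt
  rw [mfderiv_eq_fderiv, he.fderiv] at h1
  have h2 : ∀ v, paramDeriv (fun w => φ (e w)) w₀ v = paramDeriv φ (e w₀) (e' v) := fun v =>
    congrArg (fun L : W →L[ℝ] R3 => L v) h1
  have hb2 : Function.Bijective (mfderiv 𝓘(ℝ, W) (𝓡 3) (fun w => φ (e w)) w₀) := by
    have : (mfderiv 𝓘(ℝ, W) (𝓡 3) (fun w => φ (e w)) w₀ : W → R3)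
      = (mfderiv 𝓘(ℝ, W) (𝓡 3) φ (e w₀) : W → R3) ∘ e' := funext h2
    have h3 := hb.comp hb'
    exact this ▸ h3
  refine cotangent_ext (η := (η.comp e').comp (paramDeriv (fun w => φ (e w)) w₀).inverse)
    (η' := η.comp (paramDeriv φ (e w₀)).inverse) rfl ?_
  ext1 y
  obtain ⟨v, rfl⟩ := hb2.2 y
  have h3 : (paramDeriv (fun w => φ (e w)) w₀).inverse (paramDeriv (fun w => φ (e w)) w₀ v) = v :=
    inverse_paramDeriv_apply hb2 v
  have h4 : (paramDeriv φ (e w₀)).inverse (paramDeriv (fun w => φ (e w)) w₀ v) = e' v := by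
    rw [h2 v]
    exact inverse_paramDeriv_apply hb _
  exact (congrArg (fun u => η (e' u)) h3).trans (congrArg η h4).symm

omit [IsManifold (𝓡 3) ∞ Z] [IsManifold (𝓡 3) ∞ X] in
/-- At the points where `f` is not a local diffeomorphism. -/
theorem pushGraph_of_not_bijective {f : X → Z} {h : X → ℝ} {x : X}
    (hx : ¬ Function.Injective (mfderiv (𝓡 3) (𝓡 3) f x)) :
    pushGraph f h x = ⟨f x, 0⟩ := by
  let Df : R3 →L[ℝ] R3 := mfderiv (𝓡 3) (𝓡 3) f x
  let Dh : R3 →L[ℝ] ℝ := mfderiv (𝓡 3) 𝓘(ℝ, ℝ) h x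
  have h1 : Df.inverse = 0 := by
    refine ContinuousLinearMap.inverse_of_not_isInvertible fun ⟨e, he⟩ => hx ?_
    have : Function.Injective Df := by
      rw [← he]; exact e.injective
    exact this
  refine cotangent_ext (η := Dh.comp Df.inverse) rfl ?_
  rw [h1, ContinuousLinearMap.comp_zero]; rfl

end PushGraph

/-! ### Logarithmic coordinates on the complement of the circle. -/

section ExpParam

/-- The parametrization of the complement of the axis by logarithmic coordinates. -/
def expParam (c : ℝ) (w : ℂ × ℝ) : ℂ × ℝ := (Complex.exp (c * w.1), w.2)

/-- The derivative of `expParam`. -/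
def expParamDeriv (c : ℝ) (w : ℂ × ℝ) : ℂ × ℝ →L[ℝ] ℂ × ℝ :=
  ((c * Complex.exp (c * w.1)) • ContinuousLinearMap.fst ℝ ℂ ℝ).prod (ContinuousLinearMap.snd ℝ ℂ ℝ)

theorem expParamDeriv_apply (c : ℝ) (w v : ℂ × ℝ) :
    expParamDeriv c w v = (c * Complex.exp (c * w.1) * v.1, v.2) := rfl

theorem hasFDerivAt_expParam (c : ℝ) (w : ℂ × ℝ) :
    HasFDerivAt (expParam c) (expParamDeriv c w) w := by
  have h1 : HasFDerivAt (fun w : ℂ × ℝ => (c : ℂ) * w.1)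
      ((c : ℂ) • ContinuousLinearMap.fst ℝ ℂ ℝ) w :=
    (ContinuousLinearMap.fst ℝ ℂ ℝ).hasFDerivAt.const_mul (c : ℂ)
  have h2 := h1.cexp
  have h3 := h2.prodMk (ContinuousLinearMap.snd ℝ ℂ ℝ).hasFDerivAt (x := w)
  refine h3.congr_fderiv ?_
  ext v <;> (simp [expParamDeriv]; try ring)

theorem contDiff_expParam (c : ℝ) : ContDiff ℝ ∞ (expParam c) := by
  unfold expParam
  have : ContDiff ℝ ∞ Complex.exp := Complex.contDiff_exp
  fun_prop

theorem bijective_expParamDeriv {c : ℝ} (hc : c ≠ 0) (w : ℂ × ℝ) :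
    Function.Bijective (expParamDeriv c w) := by
  have h : (c * Complex.exp (c * w.1) : ℂ) ≠ 0 :=
    mul_ne_zero (by exact_mod_cast hc) (Complex.exp_ne_zero _)
  constructor
  · intro v v' hv
    rw [expParamDeriv_apply, expParamDeriv_apply, Prod.mk.injEq] at hv
    exact Prod.ext (mul_left_cancel₀ h hv.1) hv.2
  · intro y
    exact ⟨((c * Complex.exp (c * w.1))⁻¹ * y.1, y.2), by
      rw [expParamDeriv_apply]; exact Prod.ext (mul_inv_cancel_left₀ h _) rfl⟩

end ExpParam


/-! ### Uniform bounds for the cutoff in the variable `log r`. -/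

section LogCutoff

/-- The cutoff function in logarithmic coordinates. -/
def logCutoff (χ : ℝ → ℝ → ℝ) (t ρ : ℝ) : ℝ := χ t (Real.exp ρ)

variable {δ R₀ : ℝ} {b₁ b₂ : ℝ → ℝ} {χ : ℝ → ℝ → ℝ}

theorem IsCutoffFamily.contDiffAt (h : IsCutoffFamily δ R₀ b₁ b₂ χ) {t : ℝ} (ht : t ∈ Ioo 0 δ)
    {r : ℝ} (hr : r ∈ Ioo 0 R₀) : ContDiffAt ℝ ∞ (χ t) r := by
  have h1 : ContDiffAt ℝ ∞ (fun p : ℝ × ℝ => χ p.1 p.2) (t, r) :=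
    h.smooth.contDiffAt ((isOpen_Ioo.prod isOpen_Ioo).mem_nhds ⟨ht, hr⟩)
  exact ContDiffAt.comp (g := fun p : ℝ × ℝ => χ p.1 p.2) (f := fun r => (t, r)) r h1 (by fun_prop)

theorem contDiffAt_deriv {g : ℝ → ℝ} {x : ℝ} (hg : ContDiffAt ℝ ∞ g x) :
    ContDiffAt ℝ ∞ (deriv g) x :=
  (hg.fderiv_right (m := ∞) (by simp)).clm_apply contDiffAt_const

theorem IsCutoffFamily.contDiffAt_logCutoff (h : IsCutoffFamily δ R₀ b₁ b₂ χ) {t : ℝ}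
    (ht : t ∈ Ioo 0 δ) {ρ : ℝ} (hρ : Real.exp ρ < R₀) : ContDiffAt ℝ ∞ (logCutoff χ t) ρ :=
  ContDiffAt.comp (g := χ t) (f := Real.exp) ρ (h.contDiffAt ht ⟨Real.exp_pos _, hρ⟩)
    Real.contDiff_exp.contDiffAt

theorem IsCutoffFamily.logCutoff_eq_one (h : IsCutoffFamily δ R₀ b₁ b₂ χ) {t : ℝ}
    (ht : t ∈ Ioo 0 δ) {ρ : ℝ} (hρ : Real.exp ρ ≤ b₁ t) : logCutoff χ t ρ = 1 :=
  h.eq_one t ht _ (Real.exp_pos _) hρ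

theorem IsCutoffFamily.exists_bound_logCutoff (h : IsCutoffFamily δ R₀ b₁ b₂ χ) :
    ∃ K, 1 ≤ K ∧ ∃ t₀, 0 < t₀ ∧ ∀ t ∈ Ioo 0 δ, t < t₀ → ∀ ρ, Real.exp ρ ≤ b₂ t →
      |logCutoff χ t ρ| ≤ K ∧ |deriv (logCutoff χ t) ρ| ≤ K ∧
      |deriv (deriv (logCutoff χ t)) ρ| ≤ K ∧
      |deriv (deriv (deriv (logCutoff χ t))) ρ| ≤ K := by
  obtain ⟨C₀, hC₀, t₀, ht₀, hb⟩ := h.deriv_le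
  -- In `log r` the derivatives are combinations of `r^k χ^{(k)}(r)`, each at most `C₀` because `r ≤
  -- b₂`. The third has coefficients `1, 3, 1`, whence `5 C₀`; the summand `1` covers `χ` itself.
  refine ⟨5 * C₀ + 1, by linarith, t₀, ht₀, fun t ht htt ρ hρ => ?_⟩
  obtain ⟨hb1, hb12, hb2⟩ := h.b_lt t ht
  have hb2pos : 0 < b₂ t := hb1.trans hb12
  have hder : ∀ k : ℕ, ∀ r ∈ Ioo 0 R₀,
      HasDerivAt (iteratedDeriv k (χ t)) (iteratedDeriv (k + 1) (χ t) r) r := by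
    intro k r hr
    rw [iteratedDeriv_succ]
    refine DifferentiableAt.hasDerivAt ?_
    have h2 : ContDiffAt ℝ ∞ (iteratedDeriv k (χ t)) r := by
      induction k with
      | zero => rw [iteratedDeriv_zero]; exact h.contDiffAt ht hr
      | succ k ih => rw [iteratedDeriv_succ]; exact contDiffAt_deriv ih
    exact h2.differentiableAt (by simp)
  let c : ℕ → ℝ → ℝ := fun k ρ => iteratedDeriv k (χ t) (Real.exp ρ)
  have hc : ∀ k ρ, Real.exp ρ < R₀ → HasDerivAt (c k) (c (k + 1) ρ * Real.exp ρ) ρ :=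
    fun k ρ hρ => (hder k _ ⟨Real.exp_pos _, hρ⟩).comp ρ (Real.hasDerivAt_exp ρ)
  have hev : ∀ ρ, Real.exp ρ < R₀ → ∀ᶠ ρ' in 𝓝 ρ, Real.exp ρ' < R₀ := fun ρ hρ =>
    Real.continuous_exp.continuousAt.eventually (gt_mem_nhds hρ)
  have d1 : ∀ ρ, Real.exp ρ < R₀ → deriv (logCutoff χ t) ρ = c 1 ρ * Real.exp ρ := by
    intro ρ hρ
    have : logCutoff χ t = c 0 := by
      funext ρ; simp [c, logCutoff, iteratedDeriv_zero]
    rw [this]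
    exact (hc 0 ρ hρ).deriv
  have d2 : ∀ ρ, Real.exp ρ < R₀ → deriv (deriv (logCutoff χ t)) ρ
      = c 2 ρ * Real.exp ρ ^ 2 + c 1 ρ * Real.exp ρ := by
    intro ρ hρ
    have : deriv (logCutoff χ t) =ᶠ[𝓝 ρ] fun ρ => c 1 ρ * Real.exp ρ := by
      filter_upwards [hev ρ hρ] with ρ' hρ' using d1 ρ' hρ'
    refine this.deriv_eq.trans (((hc 1 ρ hρ).mul (Real.hasDerivAt_exp ρ)).deriv.trans ?_)
    ring
  have d3 : ∀ ρ, Real.exp ρ < R₀ → deriv (deriv (deriv (logCutoff χ t))) ρ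
      = c 3 ρ * Real.exp ρ ^ 3 + 3 * (c 2 ρ * Real.exp ρ ^ 2) + c 1 ρ * Real.exp ρ := by
    intro ρ hρ
    have : deriv (deriv (logCutoff χ t))
        =ᶠ[𝓝 ρ] fun ρ => c 2 ρ * Real.exp ρ ^ 2 + c 1 ρ * Real.exp ρ := by
      filter_upwards [hev ρ hρ] with ρ' hρ' using d2 ρ' hρ'
    have h4 := ((hc 2 ρ hρ).mul ((Real.hasDerivAt_exp ρ).pow 2)).add
      ((hc 1 ρ hρ).mul (Real.hasDerivAt_exp ρ))
    rw [this.deriv_eq]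
    refine h4.deriv.trans ?_
    simp
    ring
  have hr : Real.exp ρ ∈ Ioo 0 R₀ := ⟨Real.exp_pos _, hρ.trans_lt hb2⟩
  have hx : ∀ k ∈ ({1, 2, 3} : Set ℕ), |c k ρ * Real.exp ρ ^ k| ≤ C₀ := by
    intro k hk
    rw [abs_mul, abs_of_pos (pow_pos hr.1 k)]
    calc |c k ρ| * Real.exp ρ ^ k ≤ C₀ * (b₂ t)⁻¹ ^ k * b₂ t ^ k := by
          gcongr
          exact hb t ht htt _ hr k hk
      _ = C₀ := by rw [mul_assoc, ← mul_pow, inv_mul_cancel₀ hb2pos.ne', one_pow, mul_one]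
  have x1 := hx 1 (by simp)
  have x2 := hx 2 (by simp)
  have x3 := hx 3 (by simp)
  rw [pow_one] at x1
  have x0 := h.mem_Icc t ht _ hr
  rw [d1 ρ hr.2, d2 ρ hr.2, d3 ρ hr.2]
  refine ⟨?_, by linarith, ?_, ?_⟩
  · change |χ t (Real.exp ρ)| ≤ _
    rw [abs_of_nonneg x0.1]; linarith [x0.2]
  · exact (abs_add_le _ _).trans (by linarith)
  · refine (abs_add_le _ _).trans ?_
    have := abs_add_le (c 3 ρ * Real.exp ρ ^ 3) (3 * (c 2 ρ * Real.exp ρ ^ 2))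
    rw [abs_mul 3, abs_of_pos (by norm_num : (0 : ℝ) < 3)] at this
    linarith

end LogCutoff

/-! ### The explicit covector of the potential. -/

section LogCovec

/-- The functions `X(Re ξ) e^{ℓ ξ}`. -/
def logExp (X : ℝ → ℝ) (ℓ : ℂ →L[ℝ] ℂ) (ξ : ℂ) : ℂ := X ξ.re * Complex.exp (ℓ ξ)

/-- The exponent `ξ̄ / m`. -/
def conjExponent (m : ℕ) : ℂ →L[ℝ] ℂ := (1 / (m : ℝ)) • (Complex.conjCLE : ℂ →L[ℝ] ℂ)

/-- The exponent `ξ / m + ξ - ξ̄`. -/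
def mixedExponent (m : ℕ) : ℂ →L[ℝ] ℂ :=
  (1 / (m : ℝ)) • ContinuousLinearMap.id ℝ ℂ + ContinuousLinearMap.id ℝ ℂ
    - (Complex.conjCLE : ℂ →L[ℝ] ℂ)

/-- The covector `f_! dh` in logarithmic coordinates. -/
def logCovec (m : ℕ) (A : ℝ) (X : ℝ → ℝ) (ξ : ℂ) : ℂ :=
  A * (logExp X (conjExponent m) ξ + ((m : ℝ) / (m + 1) / 2 : ℝ) *
    (logExp (deriv X) (mixedExponent m) ξ + logExp (deriv X) (conjExponent m) ξ))

/-- The amplitude `t^{(m-1)/m} a^{1/m}`. -/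
def amplitude (m : ℕ) (a t : ℝ) : ℝ := t ^ (((m : ℝ) - 1) / m) * a ^ (1 / (m : ℝ))

theorem localPotential_exp {m : ℕ} (hm : m ≠ 0) (a : ℝ) (χ : ℝ → ℝ → ℝ) (t : ℝ) (ξ : ℂ) :
    localPotential m a χ t (Complex.exp ((1 / m : ℝ) * ξ)) = amplitude m a t * ((m : ℝ) / (m + 1)) *
      (logCutoff χ t ξ.re * (Complex.exp ((1 + 1 / m : ℝ) * ξ)).re) := by
  have hm' : (m : ℝ) ≠ 0 := by exact_mod_cast hm
  have h1 : ‖Complex.exp ((1 / m : ℝ) * ξ)‖ ^ m = Real.exp ξ.re := by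
    rw [Complex.norm_exp, ← Real.exp_nat_mul, Complex.re_ofReal_mul]
    congr 1
    field_simp
  have h2 : Complex.exp ((1 / m : ℝ) * ξ) ^ (m + 1) = Complex.exp ((1 + 1 / m : ℝ) * ξ) := by
    rw [← Complex.exp_nat_mul]
    congr 1
    have : (m : ℂ) ≠ 0 := by exact_mod_cast hm
    push_cast
    field_simp
  rw [localPotential, h1, h2, amplitude, logCutoff]
  ring

/-- This is the origin of `logCovec`. As `du = e^ξ dξ` and `pairing p w = Re (p̄ w)`,
differentiation gives `p̄ e^ξ = A (X e^{(1+1/m)ξ} + m/(m+1) X' Re e^{(1+1/m)ξ})`. Writing the real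
part as half the sum with the conjugate produces the two exponents; the factor `m/(m+1)` cancels `1
+ 1/m` in the first term. -/
theorem hasFDerivAt_potential_log {m : ℕ} (hm : m ≠ 0) (A : ℝ) {X : ℝ → ℝ} {w : ℂ × ℝ}
    (hX : DifferentiableAt ℝ X w.1.re) :
    HasFDerivAt (fun w : ℂ × ℝ => A * ((m : ℝ) / (m + 1)) *
      (X w.1.re * (Complex.exp ((1 + 1 / m : ℝ) * w.1)).re))
      ((pairing (logCovec m A X w.1)).comp (expParamDeriv 1 w)) w := by
  have hm' : (m : ℝ) ≠ 0 := by exact_mod_cast hm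
  have hm1 : (m : ℝ) + 1 ≠ 0 := by positivity
  have h0 : HasFDerivAt (fun w : ℂ × ℝ => w.1.re)
      (Complex.reCLM.comp (ContinuousLinearMap.fst ℝ ℂ ℝ)) w :=
    (Complex.reCLM.comp (ContinuousLinearMap.fst ℝ ℂ ℝ)).hasFDerivAt
  have h1 : HasFDerivAt (fun w : ℂ × ℝ => X w.1.re)
      (deriv X w.1.re • (Complex.reCLM.comp (ContinuousLinearMap.fst ℝ ℂ ℝ))) w :=
    hX.hasDerivAt.comp_hasFDerivAt w h0
  have h2 : HasFDerivAt (fun w : ℂ × ℝ => ((1 + 1 / m : ℝ) : ℂ) * w.1)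
      (((1 + 1 / m : ℝ) : ℂ) • ContinuousLinearMap.fst ℝ ℂ ℝ) w :=
    (ContinuousLinearMap.fst ℝ ℂ ℝ).hasFDerivAt.const_mul _
  have h3 := Complex.reCLM.hasFDerivAt.comp w h2.cexp
  have h4 := (h1.mul h3).const_mul (A * ((m : ℝ) / (m + 1)))
  refine h4.congr_fderiv ?_
  refine ContinuousLinearMap.ext fun v => ?_
  obtain ⟨ξ, s⟩ := w
  obtain ⟨v, r⟩ := v
  have e1 : conjExponent m ξ = (starRingEnd ℂ) ((1 / m : ℝ) * ξ) := by
    simp [conjExponent]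
  have e2 : mixedExponent m ξ = (1 / m : ℝ) * ξ + ξ - (starRingEnd ℂ) ξ := by
    simp [mixedExponent]
  have key : (starRingEnd ℂ) (logCovec m A X ξ) * Complex.exp ξ
      = A * (X ξ.re * Complex.exp ((1 + 1 / m : ℝ) * ξ) + ((m : ℝ) / (m + 1) * deriv X ξ.re : ℝ) *
        (Complex.exp ((1 + 1 / m : ℝ) * ξ)).re) := by
    have e3 : ((Complex.exp ((1 + 1 / m : ℝ) * ξ)).re : ℂ)
        = (Complex.exp ((1 + 1 / m : ℝ) * ξ) +
          Complex.exp ((1 + 1 / m : ℝ) * (starRingEnd ℂ) ξ)) / 2 := by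
      rw [Complex.re_eq_add_conj, ← Complex.exp_conj, map_mul, Complex.conj_ofReal]
    have e4 : Complex.exp ((1 + 1 / m : ℝ) * ξ) = Complex.exp ((1 / m : ℝ) * ξ) * Complex.exp ξ := by
      rw [← Complex.exp_add]; congr 1; push_cast; ring
    have e5 : Complex.exp ((1 + 1 / m : ℝ) * (starRingEnd ℂ) ξ)
        = Complex.exp ((1 / m : ℝ) * (starRingEnd ℂ) ξ + (starRingEnd ℂ) ξ - ξ) * Complex.exp ξ := by
      rw [← Complex.exp_add]; congr 1; push_cast; ring
    rw [e3, e4, e5, logCovec, logExp, logExp, logExp, e1, e2]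
    simp only [map_mul, map_add, map_sub, ← Complex.exp_conj, Complex.conj_ofReal, Complex.conj_conj]
    push_cast
    ring
  have hp : ∀ p y : ℂ, p.re * y.re + p.im * y.im = ((starRingEnd ℂ) p * y).re := by
    intro p y; simp
  rw [ContinuousLinearMap.comp_apply, expParamDeriv_apply, pairing_apply, hp]
  simp only [Complex.ofReal_one, one_mul]
  rw [← mul_assoc, key]
  simp only [_root_.smul_apply, _root_.add_apply, ContinuousLinearMap.comp_apply,
    ContinuousLinearMap.coe_fst', Complex.reCLM_apply, smul_eq_mul, Function.comp]
  set E := Complex.exp ((1 + 1 / m : ℝ) * ξ)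
  have c1 : (m : ℝ) / (m + 1) * (1 + 1 / m) = 1 := by field_simp
  have f1 : (E * (((1 + 1 / m : ℝ) : ℂ) * v)).re = (1 + 1 / m : ℝ) * (E * v).re := by
    rw [mul_left_comm, Complex.re_ofReal_mul]
  have f2 : ((A : ℂ) * ((X ξ.re : ℂ) * E + ((m : ℝ) / (m + 1) * deriv X ξ.re : ℝ) * (E.re : ℂ)) * v).re
      = A * (X ξ.re * (E * v).re + (m : ℝ) / (m + 1) * deriv X ξ.re * E.re * v.re) := by
    rw [mul_assoc, Complex.re_ofReal_mul, add_mul, Complex.add_re, mul_assoc, Complex.re_ofReal_mul,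
      ← Complex.ofReal_mul, Complex.re_ofReal_mul]
  rw [f1, f2]
  linear_combination A * X ξ.re * (E * v).re * c1

end LogCovec


/-! ### The section `f_! dh^t` around a branch circle. -/

section TubeCoordinates

variable {Y : Type*} [TopologicalSpace Y] [ChartedSpace C3 Y] [IsManifold 𝓘(ℂ, C3) ω Y]
  {cy : CalabiYau Y}
  {Z : Type*} [TopologicalSpace Z] [ChartedSpace R3 Z] [IsManifold (𝓡 3) ∞ Z] {ι : Z → Y}
  {X : Type*} [TopologicalSpace X] [ChartedSpace R3 X] [IsManifold (𝓡 3) ∞ X]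
  {f : X → Z} {n : ℕ} {B : BranchData X Z n} {R₀ : ℝ} {a : Fin n → ℝ} {χ : ℝ → ℝ → ℝ}
  {δ t : ℝ} {b₁ b₂ : ℝ → ℝ} {j : Fin n}

theorem mem_cyl_rpow {R : ℝ} {m : ℕ} (hm : m ≠ 0) {p : ℂ × ℝ} (hp : ‖p.1‖ ^ m < R) :
    p ∈ cyl (R ^ (1 / (m : ℝ))) := by
  have h1 : ‖p.1‖ = (‖p.1‖ ^ m) ^ (1 / (m : ℝ)) := by
    rw [one_div, Real.pow_rpow_inv_natCast (norm_nonneg _) hm]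
  change ‖p.1‖ < _
  rw [h1]
  have : (m : ℝ) ≠ 0 := by exact_mod_cast hm
  exact Real.rpow_lt_rpow (by positivity) hp (by positivity)

theorem norm_exp_pow {m : ℕ} (hm : m ≠ 0) (ξ : ℂ) :
    ‖Complex.exp ((1 / m : ℝ) * ξ)‖ ^ m = Real.exp ξ.re := by
  have hm' : (m : ℝ) ≠ 0 := by exact_mod_cast hm
  rw [Complex.norm_exp, ← Real.exp_nat_mul, Complex.re_ofReal_mul]
  congr 1
  field_simp

theorem exp_pow_eq {m : ℕ} (hm : m ≠ 0) (ξ : ℂ) :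
    Complex.exp ((1 / m : ℝ) * ξ) ^ m = Complex.exp ((1 : ℝ) * ξ) := by
  have hm' : (m : ℂ) ≠ 0 := by exact_mod_cast hm
  rw [← Complex.exp_nat_mul]
  congr 1
  push_cast
  field_simp

namespace IsSimpleNormalizedBranchedCovering

omit [IsManifold (𝓡 3) ∞ Z] [IsManifold (𝓡 3) ∞ X] in
theorem m_ne_zero (hf : IsSimpleNormalizedBranchedCovering cy ι f B) (j : Fin n) : B.m j ≠ 0 := by
  have := hf.two_le j
  omega

-- The choice in `potential` is harmless: the tubes are disjoint, and two preimages in one tube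
-- share the first coordinate, the only one on which the local function depends.
omit [IsManifold (𝓡 3) ∞ Z] [IsManifold (𝓡 3) ∞ X] in
theorem potential_up (hf : IsSimpleNormalizedBranchedCovering cy ι f B) (hR : ∀ j, R₀ < B.R j)
    {p : ℂ × ℝ} (hp : ‖p.1‖ ^ B.m j < R₀) :
    potential B R₀ a χ t (B.up j p) = localPotential (B.m j) (a j) χ t p.1 := by
  have hx : ∃ q : Fin n × (ℂ × ℝ), ‖q.2.1‖ ^ B.m q.1 < R₀ ∧ B.up q.1 q.2 = B.up j p := ⟨(j, p), hp, rfl⟩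
  rw [potential, dif_pos hx]
  obtain ⟨h1, h2⟩ := hx.choose_spec
  generalize hx.choose = q at h1 h2
  obtain ⟨k, q⟩ := q
  dsimp only at h1 h2 ⊢
  have hq := mem_cyl_rpow (hf.m_ne_zero k) (h1.trans (hR k))
  have hp' := mem_cyl_rpow (hf.m_ne_zero j) (hp.trans (hR j))
  by_cases hk : k = j
  · subst hk
    rw [(((hf.tube_up k).eq_iff q hq p hp').1 h2).1]
  · exact absurd h2 ((hf.disjoint_up k j hk).ne_of_mem (mem_image_of_mem _ hq)
      (mem_image_of_mem _ hp'))

omit [IsManifold (𝓡 3) ∞ Z] [IsManifold (𝓡 3) ∞ X] in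
theorem bijective_mfderiv_reparam {φ : ℂ × ℝ → Z} {e : ℂ × ℝ → ℂ × ℝ} {w₀ : ℂ × ℝ}
    {e' : ℂ × ℝ →L[ℝ] ℂ × ℝ} (hφ : ContMDiffAt 𝓘(ℝ, ℂ × ℝ) (𝓡 3) ∞ φ (e w₀))
    (hb : Function.Bijective (mfderiv 𝓘(ℝ, ℂ × ℝ) (𝓡 3) φ (e w₀)))
    (he : HasFDerivAt e e' w₀) (hb' : Function.Bijective e') :
    Function.Bijective (mfderiv 𝓘(ℝ, ℂ × ℝ) (𝓡 3) (fun w => φ (e w)) w₀) := by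
  have h1 := mfderiv_comp w₀ (hφ.mdifferentiableAt (by simp)) he.differentiableAt.mdifferentiableAt
  rw [mfderiv_eq_fderiv, he.fderiv] at h1
  have : (mfderiv 𝓘(ℝ, ℂ × ℝ) (𝓡 3) (fun w => φ (e w)) w₀ : ℂ × ℝ → R3)
    = (mfderiv 𝓘(ℝ, ℂ × ℝ) (𝓡 3) φ (e w₀) : ℂ × ℝ → R3) ∘ e' :=
    funext fun v => congrArg (fun L : ℂ × ℝ →L[ℝ] R3 => L v) h1
  exact this ▸ hb.comp hb'

omit [IsManifold (𝓡 3) ∞ Z] [IsManifold (𝓡 3) ∞ X] in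
theorem expParam_mem_up (hf : IsSimpleNormalizedBranchedCovering cy ι f B) (hR : ∀ j, R₀ < B.R j)
    {w : ℂ × ℝ} (hw : Real.exp w.1.re < R₀) :
    expParam (1 / (B.m j : ℝ)) w ∈ cyl (B.R j ^ (1 / (B.m j : ℝ))) :=
  mem_cyl_rpow (hf.m_ne_zero j) (by
    rw [expParam, norm_exp_pow (hf.m_ne_zero j)]; exact hw.trans (hR j))

omit [IsManifold (𝓡 3) ∞ Z] [IsManifold (𝓡 3) ∞ X] in
theorem contMDiffAt_up_exp (hf : IsSimpleNormalizedBranchedCovering cy ι f B)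
    (hR : ∀ j, R₀ < B.R j) {w : ℂ × ℝ} (hw : Real.exp w.1.re < R₀) :
    ContMDiffAt 𝓘(ℝ, ℂ × ℝ) (𝓡 3) ∞ (fun w => B.up j (expParam (1 / (B.m j : ℝ)) w)) w :=
  ContMDiffAt.comp w ((hf.tube_up j).contMDiffAt (hf.expParam_mem_up hR hw))
    (contDiff_expParam _).contDiffAt.contMDiffAt

omit [IsManifold (𝓡 3) ∞ Z] [IsManifold (𝓡 3) ∞ X] in
theorem bijective_up_exp (hf : IsSimpleNormalizedBranchedCovering cy ι f B)
    (hR : ∀ j, R₀ < B.R j) {w : ℂ × ℝ} (hw : Real.exp w.1.re < R₀) :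
    Function.Bijective (mfderiv 𝓘(ℝ, ℂ × ℝ) (𝓡 3)
      (fun w => B.up j (expParam (1 / (B.m j : ℝ)) w)) w) := by
  have hm : (B.m j : ℝ) ≠ 0 := by exact_mod_cast hf.m_ne_zero j
  exact bijective_mfderiv_reparam ((hf.tube_up j).contMDiffAt (hf.expParam_mem_up hR hw))
    ((hf.tube_up j).bijective _ (hf.expParam_mem_up hR hw)) (hasFDerivAt_expParam _ w)
    (bijective_expParamDeriv (by positivity) w)

omit [IsManifold (𝓡 3) ∞ Z] in
/-- The section `f_! dh^t` in logarithmic coordinates. -/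
theorem pushGraph_log (hf : IsSimpleNormalizedBranchedCovering cy ι f B) (hR : ∀ j, R₀ < B.R j)
    (hχ : IsCutoffFamily δ R₀ b₁ b₂ χ) (ht : t ∈ Ioo 0 δ) {w : ℂ × ℝ}
    (hw : Real.exp w.1.re < R₀) :
    pushGraph f (potential B R₀ a χ t) (B.up j (expParam (1 / (B.m j : ℝ)) w))
      = cotangentLift (B.down j) (expParam 1 w)
        (pairing (logCovec (B.m j) (amplitude (B.m j) (a j) t) (logCutoff χ t) w.1)) := by
  have hm := hf.m_ne_zero j
  have hev : ∀ᶠ w' : ℂ × ℝ in 𝓝 w, Real.exp w'.1.re < R₀ := by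
    have : Continuous fun w' : ℂ × ℝ => Real.exp w'.1.re := by fun_prop
    exact this.continuousAt.eventually (gt_mem_nhds hw)
  have hX := hχ.contDiffAt_logCutoff ht hw
  have hdown : expParam 1 w ∈ cyl (B.R j) := by
    change ‖Complex.exp ((1 : ℝ) * w.1)‖ < _
    rw [Complex.norm_exp]
    simpa using hw.trans (hR j)
  have hD := hasFDerivAt_potential_log hm (amplitude (B.m j) (a j) t)
    (hX.differentiableAt (by simp))
  have hk : ContDiffAt ℝ ∞ (fun w : ℂ × ℝ => amplitude (B.m j) (a j) t *
      ((B.m j : ℝ) / (B.m j + 1)) * (logCutoff χ t w.1.re *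
        (Complex.exp ((1 + 1 / B.m j : ℝ) * w.1)).re)) w := by
    refine contDiffAt_const.mul (ContDiffAt.mul ?_ ?_)
    · exact ContDiffAt.comp (g := logCutoff χ t) (f := fun w : ℂ × ℝ => w.1.re) w hX
        (Complex.reCLM.contDiff.comp contDiff_fst).contDiffAt
    · exact (Complex.reCLM.contDiff.comp (Complex.contDiff_exp.comp
        (contDiff_const.mul contDiff_fst))).contDiffAt
  -- With `e^{ξ/m}` upstairs and `e^ξ` downstairs the map `f` becomes the identity of `(ξ, s)`;
  -- `cotangentLift_comp` then returns to the coordinates `u`.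
  have h1 := pushGraph_param (f := f) (h := potential B R₀ a χ t)
    (φ := fun w => B.down j (expParam 1 w))
    (hf.contMDiffAt_up_exp hR hw) (hf.bijective_up_exp (j := j) hR hw)
    (ContMDiffAt.comp w ((hf.tube_down j).contMDiffAt hdown)
      (contDiff_expParam 1).contDiffAt.contMDiffAt)
    (bijective_mfderiv_reparam ((hf.tube_down j).contMDiffAt hdown)
      ((hf.tube_down j).bijective _ hdown) (hasFDerivAt_expParam 1 w)
      (bijective_expParamDeriv one_ne_zero w)) ?_ hk ?_
  · rw [h1, hD.fderiv]
    exact cotangentLift_comp ((hf.tube_down j).contMDiffAt hdown)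
      ((hf.tube_down j).bijective _ hdown) (hasFDerivAt_expParam 1 w)
      (bijective_expParamDeriv one_ne_zero w) _
  · filter_upwards [hev] with w' hw'
    rw [hf.normal_form j _ (hf.expParam_mem_up hR hw'), expParam, expParam, exp_pow_eq hm]
  · filter_upwards [hev] with w' hw'
    rw [hf.potential_up hR (by rw [expParam, norm_exp_pow hm]; exact hw')]
    exact localPotential_exp hm _ _ _ _

omit [IsManifold (𝓡 3) ∞ Z] in
/-- At the branch points `f` is not a local diffeomorphism. -/
theorem not_injective_core (hf : IsSimpleNormalizedBranchedCovering cy ι f B) (j : Fin n) (s : ℝ) :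
    ¬ Function.Injective (mfderiv (𝓡 3) (𝓡 3) f (B.up j (0, s))) := by
  intro hinj
  have h0 : ((0, s) : ℂ × ℝ) ∈ cyl (B.R j ^ (1 / (B.m j : ℝ))) := by
    simpa [cyl] using (hf.tube_up j).radius_pos
  have h0' : ((0, s) : ℂ × ℝ) ∈ cyl (B.R j) := by
    simpa [cyl] using (hf.tube_down j).radius_pos
  have hm := hf.two_le j
  let e : ℂ × ℝ → ℂ × ℝ := fun w => (w.1 ^ B.m j, w.2)
  have hez : e (0, s) = (0, s) := by
    simp [e, hf.m_ne_zero j]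
  have he : HasFDerivAt e ((((B.m j : ℂ) * (0 : ℂ) ^ (B.m j - 1)) •
      ContinuousLinearMap.fst ℝ ℂ ℝ).prod (ContinuousLinearMap.snd ℝ ℂ ℝ)) (0, s) := by
    have h1 : HasFDerivAt (fun w : ℂ × ℝ => w.1 ^ B.m j)
        (((B.m j : ℂ) * (0 : ℂ) ^ (B.m j - 1)) • ContinuousLinearMap.fst ℝ ℂ ℝ) (0, s) := by
      have := (hasDerivAt_pow (B.m j) (0 : ℂ)).comp_hasFDerivAt_of_eq ((0, s) : ℂ × ℝ)
        ((ContinuousLinearMap.fst ℝ ℂ ℝ).hasFDerivAt) rfl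
      exact this
    exact h1.prodMk (ContinuousLinearMap.snd ℝ ℂ ℝ).hasFDerivAt
  have hd := (hf.tube_down j).contMDiffAt h0'
  have h1 := mfderiv_comp (0, s) (g := B.down j) (f := e)
    (by rw [hez]; exact hd.mdifferentiableAt (by simp)) he.differentiableAt.mdifferentiableAt
  rw [mfderiv_eq_fderiv, he.fderiv] at h1
  have hsm : ContMDiffAt 𝓘(ℝ, ℂ × ℝ) (𝓡 3) ∞ (B.down j ∘ e) (0, s) := by
    refine ContMDiffAt.comp _ (by rw [hez]; exact hd) ?_
    exact ContDiffAt.contMDiffAt (by fun_prop)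
  have h2 := mfderiv_param ((hf.tube_up j).contMDiffAt h0) ((hf.tube_up j).bijective _ h0)
    (F := f) (H := B.down j ∘ e) hsm (by
      filter_upwards [isOpen_cyl.mem_nhds h0] with w hw using hf.normal_form j w hw) (1, 0)
  have h3 : (mfderiv 𝓘(ℝ, ℂ × ℝ) (𝓡 3) (B.down j ∘ e) (0, s) ((1, 0) : ℂ × ℝ) : R3) = 0 := by
    refine (congrArg (fun L : ℂ × ℝ →L[ℝ] R3 => L (1, 0)) h1).trans ?_
    have : B.m j - 1 ≠ 0 := by omega
    let L : ℂ × ℝ →L[ℝ] R3 := mfderiv 𝓘(ℝ, ℂ × ℝ) (𝓡 3) (B.down j) (e (0, s))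
    change L (((((B.m j : ℂ) * (0 : ℂ) ^ (B.m j - 1)) •
      ContinuousLinearMap.fst ℝ ℂ ℝ).prod (ContinuousLinearMap.snd ℝ ℂ ℝ)) (1, 0)) = 0
    have h4 : ((((B.m j : ℂ) * (0 : ℂ) ^ (B.m j - 1)) •
      ContinuousLinearMap.fst ℝ ℂ ℝ).prod (ContinuousLinearMap.snd ℝ ℂ ℝ)) (1, 0) = 0 := by
      simp [this]
    rw [h4, map_zero]
  let L : R3 →L[ℝ] R3 := mfderiv (𝓡 3) (𝓡 3) f (B.up j (0, s))
  have hL : Function.Injective L := hinj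
  have h5 := hL ((h2.trans h3).trans (map_zero L).symm)
  have h6 := ((hf.tube_up j).bijective _ h0).1
    (h5.trans (map_zero (paramDeriv (B.up j) (0, s))).symm)
  simpa using congrArg Prod.fst h6

/-- The terms with derivatives of the cutoff drop out, leaving `A z̄` for `z = e^{ξ/m}`. -/
theorem logCovec_of_eq_one {m : ℕ} {A : ℝ} {F : ℝ → ℝ} {ξ : ℂ} (h : F =ᶠ[𝓝 ξ.re] fun _ => 1) :
    logCovec m A F ξ = A * (starRingEnd ℂ) (Complex.exp ((1 / m : ℝ) * ξ)) := by
  rw [logCovec, logExp, logExp, logExp, h.deriv_eq, h.self_of_nhds]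
  simp [conjExponent, ← Complex.exp_conj]

omit [IsManifold (𝓡 3) ∞ Z] in
/-- The section `f_! dh^t` near the branch locus. -/
theorem pushGraph_core (hf : IsSimpleNormalizedBranchedCovering cy ι f B) (hR : ∀ j, R₀ < B.R j)
    (hχ : IsCutoffFamily δ R₀ b₁ b₂ χ) (ht : t ∈ Ioo 0 δ) {w : ℂ × ℝ}
    (hw : ‖w.1‖ ^ B.m j < b₁ t) :
    pushGraph f (potential B R₀ a χ t) (B.up j w)
      = cotangentLift (B.down j) (w.1 ^ B.m j, w.2)
        (pairing (amplitude (B.m j) (a j) t * (starRingEnd ℂ) w.1)) := by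
  have hm := hf.m_ne_zero j
  have hm' : (B.m j : ℝ) ≠ 0 := by exact_mod_cast hm
  obtain ⟨hb1, hb12, hb2⟩ := hχ.b_lt t ht
  obtain ⟨z, s⟩ := w
  -- At the branch point the inverse of the singular `df` takes its default value `0`, which agrees
  -- with `A z̄` at `z = 0`. Elsewhere any logarithm of `z` leads back to the logarithmic formula.
  by_cases hz : z = 0
  · subst hz
    rw [pushGraph_of_not_bijective (hf.not_injective_core j s)]
    simp only [map_zero, mul_zero]
    rw [cotangentLift_zero, hf.normal_form j]
    simpa [cyl] using (hf.tube_up j).radius_pos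
  · let ξ : ℂ := (B.m j : ℝ) * Complex.log z
    have h1 : Complex.exp ((1 / B.m j : ℝ) * ξ) = z := by
      have : (1 / B.m j : ℝ) * ξ = Complex.log z := by
        simp only [ξ]
        rw [← mul_assoc, ← Complex.ofReal_mul, one_div, inv_mul_cancel₀ hm', Complex.ofReal_one,
          one_mul]
      rw [this, Complex.exp_log hz]
    have h2 : Real.exp ξ.re < b₁ t := by
      rw [← norm_exp_pow hm, h1]; exact hw
    have h3 := hf.pushGraph_log (a := a) (j := j) hR hχ ht (w := (ξ, s))
      (h2.trans (hb12.trans hb2))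
    have h4 : expParam (1 / (B.m j : ℝ)) (ξ, s) = (z, s) := by rw [expParam, h1]
    have h5 : expParam 1 (ξ, s) = (z ^ B.m j, s) := by
      rw [expParam, ← exp_pow_eq hm, h1]
    have h6 : logCutoff χ t =ᶠ[𝓝 ξ.re] fun _ => 1 := by
      filter_upwards [Real.continuous_exp.continuousAt.eventually (gt_mem_nhds h2)] with ρ hρ
      exact hχ.logCutoff_eq_one ht hρ.le
    rw [h4, h5, logCovec_of_eq_one h6, h1] at h3
    exact h3

end IsSimpleNormalizedBranchedCovering

end TubeCoordinates


/-! ### Comparison of the phase with the angle of a graph in a tube. -/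

section PhaseTube

variable {Y : Type*} [TopologicalSpace Y] [ChartedSpace C3 Y] [IsManifold 𝓘(ℂ, C3) ω Y]
  {Z : Type*} [TopologicalSpace Z] [ChartedSpace R3 Z] [IsManifold (𝓡 3) ∞ Z]
  {cy : CalabiYau Y} {ι : Z → Y} {U : Set (Cotangent Z)} {Φ : Cotangent Z → Y}
  {ψ : ℂ × ℝ → Z} {ρ l : ℝ}
  {X : Type*} [TopologicalSpace X] [ChartedSpace R3 X] [IsManifold (𝓡 3) ∞ X] [OrientedAtlas X]

/-- The phase of a map which is a graph in a tube. -/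
theorem phase_tube (hΦ : IsLagrangianNeighbourhood cy ι U Φ) (hψ : IsTube ρ l ψ)
    {x : ℂ × ℝ → X} {w₀ : ℂ × ℝ} (hx : ContMDiffAt 𝓘(ℝ, ℂ × ℝ) (𝓡 3) ∞ x w₀)
    (hb : Function.Bijective (mfderiv 𝓘(ℝ, ℂ × ℝ) (𝓡 3) x w₀)) {F : ℂ × ℝ → (ℂ × ℝ) × ℂ}
    (hF : ContDiffAt ℝ ∞ F w₀) (hinjF : Function.Injective (fderiv ℝ F w₀))
    (hq : (F w₀).1 ∈ cyl ρ) (hU : cotangentLift ψ (F w₀).1 (pairing (F w₀).2) ∈ U)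
    (hinj : Function.Injective (tubeDeriv Φ ψ (F w₀))) {c : ℝ} (hc : 0 < c)
    (hcm : ∀ v, c * ‖v‖ ≤ Real.sqrt (tubeMetric cy Φ ψ (F w₀, v))) {D : X → Y}
    (hD : ∀ᶠ w in 𝓝 w₀, D (x w) = tubeMap Φ ψ (F w)) {ang : ℂ × ℝ → ℝ}
    (hang : ∀ᶠ w in 𝓝 w₀, frameAngle cy (fun w => tubeMap Φ ψ (F w)) tubeFrame w = ang w) :
    ContMDiffAt (𝓡 3) 𝓘(ℝ, C3) ∞ D (x w₀) ∧
    Function.Injective (mfderiv (𝓡 3) 𝓘(ℝ, C3) D (x w₀)) ∧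
    ContMDiffAt (𝓡 3) 𝓘(ℝ, ℝ) ∞ (phase cy D) (x w₀) ∧
    |phase cy D (x w₀)| = |ang w₀| ∧
    ∀ c', 0 ≤ c' → (∀ v, |fderiv ℝ ang w₀ v| ≤ c' * ‖fderiv ℝ F w₀ v‖) →
      DiffNormLE cy D (phase cy D) (x w₀) (c' / c) := by
  have hG := contMDiffAt_tubeMap hΦ hψ hq hU
  have hH : ContMDiffAt 𝓘(ℝ, ℂ × ℝ) 𝓘(ℝ, C3) ∞ (fun w => tubeMap Φ ψ (F w)) w₀ :=
    ContMDiffAt.comp (g := tubeMap Φ ψ) (f := F) w₀ hG hF.contMDiffAt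
  have h1 := mfderiv_comp w₀ (hG.mdifferentiableAt (by simp))
    (hF.differentiableAt (by simp)).mdifferentiableAt
  rw [mfderiv_eq_fderiv] at h1
  have hd : ∀ v, (mfderiv 𝓘(ℝ, ℂ × ℝ) 𝓘(ℝ, C3) (fun w => tubeMap Φ ψ (F w)) w₀ v : C3)
      = tubeDeriv Φ ψ (F w₀) (fderiv ℝ F w₀ v) := fun v =>
    congrArg (fun L : ℂ × ℝ →L[ℝ] C3 => L v) h1
  have hHinj : Function.Injective
      (mfderiv 𝓘(ℝ, ℂ × ℝ) 𝓘(ℝ, C3) (fun w => tubeMap Φ ψ (F w)) w₀) := by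
    intro v v' hv
    exact hinjF (hinj ((hd v).symm.trans (hv.trans (hd v'))))
  obtain ⟨r1, r2, r3, r4, r5⟩ := phase_param cy hx hb linearIndependent_tubeFrame hH hHinj hD
  have hangd : fderiv ℝ (frameAngle cy (fun w => tubeMap Φ ψ (F w)) tubeFrame) w₀
      = fderiv ℝ ang w₀ := EventuallyEq.fderiv_eq hang
  refine ⟨r1, r2, r3, by rw [r4, hang.self_of_nhds], fun c' hc' h => r5 _ fun v => ?_⟩
  rw [hangd]
  refine (h v).trans ?_
  have h2 : Real.sqrt (tubeMetric cy Φ ψ (F w₀, fderiv ℝ F w₀ v))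
      = Real.sqrt (cy.g.inner (tubeMap Φ ψ (F w₀))
        (mfderiv 𝓘(ℝ, ℂ × ℝ) 𝓘(ℝ, C3) (fun w => tubeMap Φ ψ (F w)) w₀ v)
        (mfderiv 𝓘(ℝ, ℂ × ℝ) 𝓘(ℝ, C3) (fun w => tubeMap Φ ψ (F w)) w₀ v)) := by
    have : ∀ a : C3, a = tubeDeriv Φ ψ (F w₀) (fderiv ℝ F w₀ v) →
        tubeMetric cy Φ ψ (F w₀, fderiv ℝ F w₀ v) = cy.g.inner (tubeMap Φ ψ (F w₀)) a a := by
      rintro a rfl; rfl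
    rw [this _ (hd v)]
  have h3 := hcm (fderiv ℝ F w₀ v)
  refine le_trans ?_ (mul_le_mul_of_nonneg_left h2.le (by positivity))
  calc c' * ‖fderiv ℝ F w₀ v‖ = c' / c * (c * ‖fderiv ℝ F w₀ v‖) := by field_simp
    _ ≤ _ := mul_le_mul_of_nonneg_left h3 (by positivity)

end PhaseTube

/-! ### Estimates where the cutoff is one. -/

section CoreEstimate

variable {Y : Type*} [TopologicalSpace Y] [ChartedSpace C3 Y] [IsManifold 𝓘(ℂ, C3) ω Y]
  {Z : Type*} [TopologicalSpace Z] [ChartedSpace R3 Z] [IsManifold (𝓡 3) ∞ Z]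
  {cy : CalabiYau Y} {ι : Z → Y} {U : Set (Cotangent Z)} {Φ : Cotangent Z → Y}
  {ψ : ℂ × ℝ → Z} {ρ l : ℝ}
  {X : Type*} [TopologicalSpace X] [ChartedSpace R3 X] [IsManifold (𝓡 3) ∞ X] [OrientedAtlas X]

/-- The graph of `u ↦ A (u^{1/m})‾` over the branched covering `z ↦ z^m`. -/
def coreGraph (m : ℕ) (A : ℝ) (w : ℂ × ℝ) : (ℂ × ℝ) × ℂ :=
  ((w.1 ^ m, w.2), A * (starRingEnd ℂ) w.1)

/-- The derivative of `coreGraph`. -/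
def coreGraphDeriv (m : ℕ) (A : ℝ) (w : ℂ × ℝ) : ℂ × ℝ →L[ℝ] (ℂ × ℝ) × ℂ :=
  (((m * w.1 ^ (m - 1)) • ContinuousLinearMap.fst ℝ ℂ ℝ).prod (ContinuousLinearMap.snd ℝ ℂ ℝ)).prod
    ((A : ℂ) • ((Complex.conjCLE : ℂ →L[ℝ] ℂ).comp (ContinuousLinearMap.fst ℝ ℂ ℝ)))

theorem coreGraphDeriv_apply (m : ℕ) (A : ℝ) (w v : ℂ × ℝ) :
    coreGraphDeriv m A w v = ((m * w.1 ^ (m - 1) * v.1, v.2), A * (starRingEnd ℂ) v.1) := rfl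

theorem hasFDerivAt_pow_fst (m : ℕ) (w : ℂ × ℝ) : HasFDerivAt (fun w : ℂ × ℝ => w.1 ^ m)
    ((m * w.1 ^ (m - 1)) • ContinuousLinearMap.fst ℝ ℂ ℝ) w :=
  (hasDerivAt_pow m w.1).comp_hasFDerivAt_of_eq w (ContinuousLinearMap.fst ℝ ℂ ℝ).hasFDerivAt rfl

theorem hasFDerivAt_coreGraph (m : ℕ) (A : ℝ) (w : ℂ × ℝ) :
    HasFDerivAt (coreGraph m A) (coreGraphDeriv m A w) w := by
  refine ((hasFDerivAt_pow_fst m w).prodMk (ContinuousLinearMap.snd ℝ ℂ ℝ).hasFDerivAt).prodMk ?_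
  exact (((Complex.conjCLE : ℂ →L[ℝ] ℂ).comp (ContinuousLinearMap.fst ℝ ℂ ℝ)).hasFDerivAt
    (x := w)).const_mul (A : ℂ)

theorem contDiff_coreGraph (m : ℕ) (A : ℝ) : ContDiff ℝ ∞ (coreGraph m A) := by
  have h : ContDiff ℝ ∞ fun w : ℂ × ℝ => (starRingEnd ℂ) w.1 :=
    ((Complex.conjCLE : ℂ →L[ℝ] ℂ).comp (ContinuousLinearMap.fst ℝ ℂ ℝ)).contDiff
  unfold coreGraph
  fun_prop

theorem injective_coreGraphDeriv (m : ℕ) {A : ℝ} (hA : A ≠ 0) (w : ℂ × ℝ) :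
    Function.Injective (coreGraphDeriv m A w) := by
  intro v v' hv
  rw [coreGraphDeriv_apply, coreGraphDeriv_apply, Prod.mk.injEq, Prod.mk.injEq] at hv
  refine Prod.ext ?_ hv.1.2
  have hA' : (A : ℂ) ≠ 0 := by exact_mod_cast hA
  exact (starRingEnd ℂ).injective (mul_left_cancel₀ hA' hv.2)

-- Allows the tangent direction to be scaled to the unit sphere, where the angle is uniformly
-- controlled.
omit [IsManifold (𝓡 3) ∞ Z] in
theorem coreAngle_smul (q : (ℂ × ℝ) × ℂ) (w : ℂ × ℂ) {r : ℝ} (hr : 0 < r) :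
    coreAngle cy Φ ψ (q, r • w) = coreAngle cy Φ ψ (q, w) := by
  have h := planeAngle_change (cy := cy) (Φ := Φ) (ψ := ψ) q
    (w, (Complex.I * w.1, -(Complex.I * w.2))) r 0 0 r (by nlinarith [mul_pos hr hr])
  refine Eq.trans ?_ h
  simp only [coreAngle, zero_smul, add_zero, zero_add, Prod.smul_mk, Prod.smul_fst, Prod.smul_snd,
    mul_smul_comm, smul_neg]

/-- The estimates of the phase in the region where the cutoff function is one. -/
theorem exists_core_estimate (hι : IsSpecialLagrangian cy ι)
    (hΦ : IsLagrangianNeighbourhood cy ι U Φ) (hψ : IsTube ρ l ψ)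
    (hon : ∀ (s : ℝ) (v w : ℂ × ℝ), cy.g.inner (ι (ψ (0, s)))
      (baseDeriv ι (ψ (0, s)) (paramDeriv ψ (0, s) v))
      (baseDeriv ι (ψ (0, s)) (paramDeriv ψ (0, s) w))
        = v.1.re * w.1.re + v.1.im * w.1.im + v.2 * w.2) {r₀ : ℝ} (hr₀ : 0 < r₀) (hr₁ : r₀ ≤ 1)
    {c : ℝ} (hc : 0 < c)
    (hbox : ∀ q ∈ box l r₀, q.1 ∈ cyl ρ ∧ cotangentLift ψ q.1 (pairing q.2) ∈ U ∧
      Function.Injective (tubeDeriv Φ ψ q) ∧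
      ∀ v, c * ‖v‖ ≤ Real.sqrt (tubeMetric cy Φ ψ (q, v))) {m : ℕ} (hm : 2 ≤ m) :
    ∃ C, 0 < C ∧ ∀ (A : ℝ) (x : ℂ × ℝ → X) (w₀ : ℂ × ℝ) (D : X → Y), 0 < A →
      ContMDiffAt 𝓘(ℝ, ℂ × ℝ) (𝓡 3) ∞ x w₀ →
      Function.Bijective (mfderiv 𝓘(ℝ, ℂ × ℝ) (𝓡 3) x w₀) →
      (∀ᶠ w in 𝓝 w₀, D (x w) = tubeMap Φ ψ (coreGraph m A w)) → coreGraph m A w₀ ∈ box l r₀ →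
      ContMDiffAt (𝓡 3) 𝓘(ℝ, C3) ∞ D (x w₀) ∧
      Function.Injective (mfderiv (𝓡 3) 𝓘(ℝ, C3) D (x w₀)) ∧
      ContMDiffAt (𝓡 3) 𝓘(ℝ, ℝ) ∞ (phase cy D) (x w₀) ∧
      |phase cy D (x w₀)| ≤ C * (‖w₀.1‖ ^ m + A * ‖w₀.1‖) ∧
      DiffNormLE cy D (phase cy D) (x w₀) C := by
  obtain ⟨C, hC, hb⟩ := exists_bound_coreAngle hι hΦ hψ hon hr₀
    fun q hq => ⟨(hbox q hq).1, (hbox q hq).2.1, (hbox q hq).2.2.1⟩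
  refine ⟨max C (C * (m + 1) / c), by positivity, fun A x w₀ D hA hx hxb hD hq => ?_⟩
  obtain ⟨g1, g2, g3, g4⟩ := hbox _ hq
  -- The derivative of `z ↦ (z^m, A z̄)` in the direction `1`; in the direction `i` it is `(iζ,
  -- -iτ)` of the same vector. The normalizing factor below is frozen at `w₀`, so it need not be
  -- differentiated.
  let y : ℂ × ℝ → ℂ × ℂ := fun w => (m * w.1 ^ (m - 1), A)
  have hA' : (A : ℂ) ≠ 0 := by exact_mod_cast hA.ne'
  have hy0 : 0 < ‖y w₀‖ := norm_pos_iff.2 fun h => hA' (congrArg Prod.snd h)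
  have hy1 : ‖‖y w₀‖⁻¹ • y w₀‖ = 1 := by
    rw [norm_smul, norm_inv, norm_norm, inv_mul_cancel₀ hy0.ne']
  let ang : ℂ × ℝ → ℝ := fun w => coreAngle cy Φ ψ (coreGraph m A w, ‖y w₀‖⁻¹ • y w)
  have hFd : ∀ w, fderiv ℝ (coreGraph m A) w = coreGraphDeriv m A w := fun w =>
    (hasFDerivAt_coreGraph m A w).fderiv
  have hang : ∀ᶠ w in 𝓝 w₀,
      frameAngle cy (fun w => tubeMap Φ ψ (coreGraph m A w)) tubeFrame w = ang w := by
    filter_upwards [(contDiff_coreGraph m A).continuous.continuousAt.eventually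
      (eventually_lift_mem hΦ hψ g1 g2)] with w hw
    refine Eq.trans ?_ (coreAngle_smul _ _ (inv_pos.2 hy0)).symm
    refine frameAngle_comp_tubeMap hΦ hψ (hasFDerivAt_coreGraph m A w).differentiableAt hw.1 hw.2
      (x := y w) (y := (Complex.I * (y w).1, -(Complex.I * (y w).2))) ?_ ?_ ?_
    · rw [hFd, coreGraphDeriv_apply, planeVec_apply]; simp [y]
    · rw [hFd, coreGraphDeriv_apply, planeVec_apply]
      simp [y, mul_comm]
    · rw [hFd, coreGraphDeriv_apply]; simp
  -- The graph is immersed even at `z = 0`, because `A ≠ 0`.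
  obtain ⟨r1, r2, r3, r4, r5⟩ := phase_tube hΦ hψ hx hxb (contDiff_coreGraph m A).contDiffAt
    (by rw [hFd]; exact injective_coreGraphDeriv m hA.ne' w₀) g1 g2 g3 hc g4 hD hang
  have hbw := hb _ hq (‖y w₀‖⁻¹ • y w₀) hy1
  have hnp : ‖(coreGraph m A w₀).2‖ = A * ‖w₀.1‖ := by
    simp [coreGraph, abs_of_pos hA]
  have hnu : ‖(coreGraph m A w₀).1.1‖ = ‖w₀.1‖ ^ m := by simp [coreGraph]
  have hm1 : (1 : ℝ) ≤ m := by exact_mod_cast (by omega : 1 ≤ m)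
  refine ⟨r1, r2, r3, ?_, ?_⟩
  · rw [r4]
    refine hbw.1.trans ?_
    rw [hnp, hnu]
    refine mul_le_mul (le_max_left _ _) (max_le ?_ ?_) (by positivity) (by positivity)
    · exact le_add_of_nonneg_right (by positivity)
    · exact le_add_of_nonneg_left (by positivity)
  · have hmain : DiffNormLE cy D (phase cy D) (x w₀) (C * (m + 1) / c) := by
      refine r5 _ (by positivity) fun v => ?_
      rw [hFd]
      set F' := coreGraphDeriv m A w₀ v with hF'
      let y' : ℂ × ℝ →L[ℝ] ℂ × ℂ :=
        ((m : ℂ) • ((((m - 1 : ℕ) : ℂ) * w₀.1 ^ (m - 1 - 1)) • ContinuousLinearMap.fst ℝ ℂ ℝ)).prod 0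
      have hy' : HasFDerivAt y y' w₀ :=
        ((hasFDerivAt_pow_fst (m - 1) w₀).const_mul (m : ℂ)).prodMk (hasFDerivAt_const _ _)
      have hin : HasFDerivAt (fun w => (coreGraph m A w, ‖y w₀‖⁻¹ • y w))
          ((coreGraphDeriv m A w₀).prod (‖y w₀‖⁻¹ • y')) w₀ :=
        (hasFDerivAt_coreGraph m A w₀).prodMk (show HasFDerivAt (fun w => ‖y w₀‖⁻¹ • y w) (‖y w₀‖⁻¹ • y') w₀ from
            hy'.const_smul ‖y w₀‖⁻¹)
      have hN : DifferentiableAt ℝ (coreAngle cy Φ ψ) (coreGraph m A w₀, ‖y w₀‖⁻¹ • y w₀) :=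
        (contDiffAt_coreAngle hΦ hψ g1 g2 g3 (Or.inr
          (smul_ne_zero (inv_ne_zero hy0.ne') hA'))).differentiableAt (by simp)
      have hfd : fderiv ℝ ang w₀ v = fderiv ℝ (coreAngle cy Φ ψ)
          (coreGraph m A w₀, ‖y w₀‖⁻¹ • y w₀) (F', ‖y w₀‖⁻¹ • y' v) :=
        congrArg (fun L : ℂ × ℝ →L[ℝ] ℝ => L v) (HasFDerivAt.comp (g := coreAngle cy Φ ψ) w₀
          hN.hasFDerivAt hin).fderiv
      rw [hfd]
      refine (hbw.2 _).trans ?_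
      rw [hnp, hnu]
      have hs : ‖F'.1.2‖ ≤ ‖F'‖ := (norm_snd_le F'.1).trans (norm_fst_le F')
      have hu : ‖F'.1.1‖ ≤ ‖F'‖ := (norm_fst_le F'.1).trans (norm_fst_le F')
      have hu' : ‖F'.1.1‖ = m * ‖w₀.1‖ ^ (m - 1) * ‖v.1‖ := by
        rw [hF', coreGraphDeriv_apply]; simp
      rw [mem_box] at hq
      rw [hnu, hnp] at hq
      have hx1 : max (‖w₀.1‖ ^ m) (A * ‖w₀.1‖) ≤ 1 := max_le (hq.1.trans hr₁) (hq.2.2.trans hr₁)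
      -- The distance from the core is at most `|z| ‖y‖`. In `hprod` this cancels the factor `‖y‖⁻¹`
      -- in the derivative of the scaled direction and leaves a multiple of `|z|^{m-1} |v|`, which
      -- is part of the derivative of the graph. Hence the bound for `dε` depends on neither `A` nor
      -- `z`.
      have hx2 : max (‖w₀.1‖ ^ m) (A * ‖w₀.1‖) ≤ ‖w₀.1‖ * ‖y w₀‖ := by
        refine max_le ?_ ?_
        · have e1 : ‖w₀.1‖ ^ m = ‖w₀.1‖ * ‖w₀.1‖ ^ (m - 1) := by
            rw [← pow_succ']; congr 1; omega
          rw [e1]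
          gcongr
          calc ‖w₀.1‖ ^ (m - 1) ≤ m * ‖w₀.1‖ ^ (m - 1) :=
                le_mul_of_one_le_left (by positivity) hm1
            _ = ‖(y w₀).1‖ := by simp [y]
            _ ≤ _ := norm_fst_le _
        · rw [mul_comm]
          gcongr
          calc A = ‖(y w₀).2‖ := by simp [y, abs_of_pos hA]
            _ ≤ _ := norm_snd_le _
      have hyv : ‖‖y w₀‖⁻¹ • y' v‖ = ‖y w₀‖⁻¹ * (m * ((m - 1) * ‖w₀.1‖ ^ (m - 2)) * ‖v.1‖) := by
        have e1 : y' v = (m * ((((m - 1 : ℕ) : ℂ) * w₀.1 ^ (m - 1 - 1)) * v.1), 0) := rfl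
        rw [e1, norm_smul, norm_inv, norm_norm]
        congr 1
        simp only [Prod.norm_def, norm_zero, norm_mul, norm_pow, Complex.norm_natCast]
        rw [max_eq_left (by positivity), Nat.cast_sub (by omega : 1 ≤ m), Nat.cast_one,
          (by omega : m - 1 - 1 = m - 2)]
        ring
      have hprod : max (‖w₀.1‖ ^ m) (A * ‖w₀.1‖) * max ‖F'.1.2‖ ‖‖y w₀‖⁻¹ • y' v‖
          ≤ m * ‖F'‖ := by
        rcases le_total ‖F'.1.2‖ ‖‖y w₀‖⁻¹ • y' v‖ with h | h
        · rw [max_eq_right h, hyv]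
          calc _ ≤ ‖w₀.1‖ * ‖y w₀‖ * (‖y w₀‖⁻¹ * (m * ((m - 1) * ‖w₀.1‖ ^ (m - 2)) * ‖v.1‖)) := by
                refine mul_le_mul_of_nonneg_right hx2 ?_
                have : (0 : ℝ) ≤ m - 1 := by linarith
                positivity
            _ = (m - 1) * (m * (‖w₀.1‖ * ‖w₀.1‖ ^ (m - 2)) * ‖v.1‖) := by
                field_simp
            _ = (m - 1) * ‖F'.1.1‖ := by
                rw [hu', ← pow_succ', (by omega : m - 2 + 1 = m - 1)]
            _ ≤ (m - 1) * ‖F'‖ := mul_le_mul_of_nonneg_left hu (by linarith)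
            _ ≤ _ := mul_le_mul_of_nonneg_right (by linarith) (norm_nonneg _)
        · rw [max_eq_left h]
          calc _ ≤ 1 * ‖F'‖ := mul_le_mul hx1 hs (norm_nonneg _) zero_le_one
            _ ≤ _ := mul_le_mul_of_nonneg_right hm1 (norm_nonneg _)
      calc _ ≤ C * (m * ‖F'‖ + ‖F'‖) := by gcongr
        _ = _ := by ring
    intro v
    exact (hmain v).trans (mul_le_mul_of_nonneg_right (le_max_right _ _) (Real.sqrt_nonneg _))

end CoreEstimate


/-! ### Bounds for the covector and its derivatives in logarithmic coordinates. -/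

section LogDerivatives

/-- The real part as a complex valued linear map. -/
def reMap : ℂ →L[ℝ] ℂ := Complex.ofRealCLM.comp Complex.reCLM

theorem norm_reMap_le : ‖reMap‖ ≤ 1 :=
  ContinuousLinearMap.opNorm_le_bound _ zero_le_one fun v => by
    simpa [reMap] using Complex.abs_re_le_norm v

/-- The derivative of `logExp`. -/
def logExpDeriv (X : ℝ → ℝ) (ℓ : ℂ →L[ℝ] ℂ) (ξ : ℂ) : ℂ →L[ℝ] ℂ :=
  logExp (deriv X) ℓ ξ • reMap + logExp X ℓ ξ • ℓ

/-- The second derivative of `logExp`. -/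
def logExpDeriv2 (X : ℝ → ℝ) (ℓ : ℂ →L[ℝ] ℂ) (ξ : ℂ) : ℂ →L[ℝ] ℂ →L[ℝ] ℂ :=
  (logExpDeriv (deriv X) ℓ ξ).smulRight reMap + (logExpDeriv X ℓ ξ).smulRight ℓ

theorem hasFDerivAt_logExp {X : ℝ → ℝ} (ℓ : ℂ →L[ℝ] ℂ) {ξ : ℂ}
    (hX : DifferentiableAt ℝ X ξ.re) : HasFDerivAt (logExp X ℓ) (logExpDeriv X ℓ ξ) ξ := by
  have h1 : HasFDerivAt (fun ξ : ℂ => X ξ.re) (deriv X ξ.re • Complex.reCLM) ξ :=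
    hX.hasDerivAt.comp_hasFDerivAt ξ Complex.reCLM.hasFDerivAt
  have h2 := Complex.ofRealCLM.hasFDerivAt.comp ξ h1
  have h3 := h2.mul (ℓ.hasFDerivAt (x := ξ)).cexp
  refine h3.congr_fderiv ?_
  refine ContinuousLinearMap.ext fun v => ?_
  simp [logExpDeriv, logExp, reMap]
  ring

theorem hasFDerivAt_logExpDeriv {X : ℝ → ℝ} (ℓ : ℂ →L[ℝ] ℂ) {ξ : ℂ}
    (hX : DifferentiableAt ℝ X ξ.re) (hX' : DifferentiableAt ℝ (deriv X) ξ.re) :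
    HasFDerivAt (logExpDeriv X ℓ) (logExpDeriv2 X ℓ ξ) ξ :=
  ((hasFDerivAt_logExp ℓ hX').smul_const reMap).add ((hasFDerivAt_logExp ℓ hX).smul_const ℓ)

theorem contDiffAt_logExp {X : ℝ → ℝ} (ℓ : ℂ →L[ℝ] ℂ) {ξ : ℂ} (hX : ContDiffAt ℝ ∞ X ξ.re) :
    ContDiffAt ℝ ∞ (logExp X ℓ) ξ := by
  have h1 : ContDiffAt ℝ ∞ (fun ξ : ℂ => X ξ.re) ξ :=
    ContDiffAt.comp (g := X) (f := Complex.re) ξ hX Complex.reCLM.contDiff.contDiffAt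
  exact (Complex.ofRealCLM.contDiff.contDiffAt.comp ξ h1).mul
    (Complex.contDiff_exp.comp ℓ.contDiff).contDiffAt

/-- The derivative of `logCovec`. -/
def logCovecDeriv (m : ℕ) (A : ℝ) (X : ℝ → ℝ) (ξ : ℂ) : ℂ →L[ℝ] ℂ :=
  (A : ℂ) • (logExpDeriv X (conjExponent m) ξ + (((m : ℝ) / (m + 1) / 2 : ℝ) : ℂ) •
    (logExpDeriv (deriv X) (mixedExponent m) ξ + logExpDeriv (deriv X) (conjExponent m) ξ))

/-- The second derivative of `logCovec`. -/
def logCovecDeriv2 (m : ℕ) (A : ℝ) (X : ℝ → ℝ) (ξ : ℂ) : ℂ →L[ℝ] ℂ →L[ℝ] ℂ :=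
  (A : ℂ) • (logExpDeriv2 X (conjExponent m) ξ + (((m : ℝ) / (m + 1) / 2 : ℝ) : ℂ) •
    (logExpDeriv2 (deriv X) (mixedExponent m) ξ + logExpDeriv2 (deriv X) (conjExponent m) ξ))

theorem hasFDerivAt_logCovec (m : ℕ) (A : ℝ) {X : ℝ → ℝ} {ξ : ℂ} (hX : ContDiffAt ℝ ∞ X ξ.re) :
    HasFDerivAt (logCovec m A X) (logCovecDeriv m A X ξ) ξ := by
  have h0 := hX.differentiableAt (by simp)
  have h1 := (contDiffAt_deriv hX).differentiableAt (by simp)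
  exact ((hasFDerivAt_logExp _ h0).add (((hasFDerivAt_logExp _ h1).add
    (hasFDerivAt_logExp _ h1)).const_mul _)).const_mul _

theorem hasFDerivAt_logCovecDeriv (m : ℕ) (A : ℝ) {X : ℝ → ℝ} {ξ : ℂ}
    (hX : ContDiffAt ℝ ∞ X ξ.re) :
    HasFDerivAt (logCovecDeriv m A X) (logCovecDeriv2 m A X ξ) ξ := by
  have h0 := hX.differentiableAt (by simp)
  have h1 := (contDiffAt_deriv hX).differentiableAt (by simp)
  have h2 := (contDiffAt_deriv (contDiffAt_deriv hX)).differentiableAt (by simp)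
  exact ((hasFDerivAt_logExpDeriv _ h0 h1).add (((hasFDerivAt_logExpDeriv _ h1 h2).add
    (hasFDerivAt_logExpDeriv _ h1 h2)).const_smul (((m : ℝ) / (m + 1) / 2 : ℝ) : ℂ))).const_smul
      (A : ℂ)

theorem contDiffAt_logCovec (m : ℕ) (A : ℝ) {X : ℝ → ℝ} {ξ : ℂ} (hX : ContDiffAt ℝ ∞ X ξ.re) :
    ContDiffAt ℝ ∞ (logCovec m A X) ξ := by
  have h1 := contDiffAt_deriv hX
  exact contDiffAt_const.mul ((contDiffAt_logExp _ hX).add (contDiffAt_const.mul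
    ((contDiffAt_logExp _ h1).add (contDiffAt_logExp _ h1))))

/-- Both exponents have real part `Re ξ / m` and norm at most `3`. All terms therefore have size
`e^{ρ/m}`, and differentiating in `ξ` costs only constants. -/
theorem norm_logExp_le {X : ℝ → ℝ} {ℓ : ℂ →L[ℝ] ℂ} {ξ : ℂ} {m : ℕ} {K : ℝ}
    (hℓ : (ℓ ξ).re = ξ.re / m) (hX : |X ξ.re| ≤ K) :
    ‖logExp X ℓ ξ‖ ≤ K * Real.exp (ξ.re / m) := by
  rw [logExp, norm_mul, Complex.norm_exp, hℓ, Complex.norm_real, Real.norm_eq_abs]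
  gcongr

theorem norm_logExpDeriv_le {X : ℝ → ℝ} {ℓ : ℂ →L[ℝ] ℂ} {ξ : ℂ} {m : ℕ} {K : ℝ}
    (hℓ : (ℓ ξ).re = ξ.re / m) (hℓ' : ‖ℓ‖ ≤ 3) (h0 : |X ξ.re| ≤ K) (h1 : |deriv X ξ.re| ≤ K) :
    ‖logExpDeriv X ℓ ξ‖ ≤ 4 * (K * Real.exp (ξ.re / m)) := by
  have e0 := norm_logExp_le hℓ h0
  have e1 := norm_logExp_le hℓ h1
  have hK : 0 ≤ K * Real.exp (ξ.re / m) := (norm_nonneg _).trans e0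
  refine (norm_add_le _ _).trans ?_
  rw [norm_smul, norm_smul]
  have f1 := mul_le_mul e1 norm_reMap_le (norm_nonneg _) hK
  have f2 := mul_le_mul e0 hℓ' (norm_nonneg _) hK
  linarith

theorem norm_logExpDeriv2_le {X : ℝ → ℝ} {ℓ : ℂ →L[ℝ] ℂ} {ξ : ℂ} {m : ℕ} {K : ℝ}
    (hℓ : (ℓ ξ).re = ξ.re / m) (hℓ' : ‖ℓ‖ ≤ 3) (h0 : |X ξ.re| ≤ K) (h1 : |deriv X ξ.re| ≤ K)
    (h2 : |deriv (deriv X) ξ.re| ≤ K) (v : ℂ) :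
    ‖logExpDeriv2 X ℓ ξ v‖ ≤ 16 * (K * Real.exp (ξ.re / m) * ‖v‖) := by
  have e0 := (logExpDeriv X ℓ ξ).le_of_opNorm_le (norm_logExpDeriv_le hℓ hℓ' h0 h1) v
  have e1 := (logExpDeriv (deriv X) ℓ ξ).le_of_opNorm_le (norm_logExpDeriv_le hℓ hℓ' h1 h2) v
  have hK := (norm_nonneg _).trans e0
  have e : logExpDeriv2 X ℓ ξ v = logExpDeriv (deriv X) ℓ ξ v • reMap + logExpDeriv X ℓ ξ v • ℓ := rfl
  rw [e]
  refine (norm_add_le _ _).trans ?_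
  rw [norm_smul, norm_smul]
  have f1 := mul_le_mul e1 norm_reMap_le (norm_nonneg _) hK
  have f2 := mul_le_mul e0 hℓ' (norm_nonneg _) hK
  linarith

theorem conjExponent_re (m : ℕ) (ξ : ℂ) : (conjExponent m ξ).re = ξ.re / m := by
  simp [conjExponent]; ring

theorem mixedExponent_re (m : ℕ) (ξ : ℂ) : (mixedExponent m ξ).re = ξ.re / m := by
  simp [mixedExponent]; ring

theorem norm_conjExponent_le {m : ℕ} (hm : m ≠ 0) : ‖conjExponent m‖ ≤ 3 := by
  have h1 : (1 : ℝ) ≤ m := by exact_mod_cast Nat.one_le_iff_ne_zero.2 hm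
  have h2 : 1 / (m : ℝ) ≤ 1 := (div_le_one (by linarith)).2 h1
  refine ContinuousLinearMap.opNorm_le_bound _ (by norm_num) fun v => ?_
  have : ‖conjExponent m v‖ = 1 / m * ‖v‖ := by
    simp [conjExponent]
  rw [this]
  exact mul_le_mul_of_nonneg_right (by linarith) (norm_nonneg _)

theorem norm_mixedExponent_le {m : ℕ} (hm : m ≠ 0) : ‖mixedExponent m‖ ≤ 3 := by
  have h1 : (1 : ℝ) ≤ m := by exact_mod_cast Nat.one_le_iff_ne_zero.2 hm
  have h2 : 1 / (m : ℝ) ≤ 1 := (div_le_one (by linarith)).2 h1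
  refine ContinuousLinearMap.opNorm_le_bound _ (by norm_num) fun v => ?_
  have : mixedExponent m v = (1 / m : ℝ) • v + v - (starRingEnd ℂ) v := by
    simp [mixedExponent]
  rw [this]
  refine (norm_sub_le _ _).trans ?_
  have h3 := norm_add_le ((1 / m : ℝ) • v) v
  have h4 : ‖(1 / m : ℝ) • v‖ ≤ ‖v‖ := by
    rw [norm_smul, Real.norm_eq_abs, abs_of_nonneg (by positivity)]
    exact mul_le_of_le_one_left (norm_nonneg _) h2
  rw [RCLike.norm_conj]
  linarith

/-- The covector and its first two derivatives all have this shape. -/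
theorem norm_combination_le {E : Type*} [NormedAddCommGroup E] [NormedSpace ℂ E] {A κ M : ℝ}
    (hA : 0 ≤ A) (hκ : 0 ≤ κ) (hκ' : κ ≤ 1) {a b c : E} (ha : ‖a‖ ≤ M) (hb : ‖b‖ ≤ M)
    (hc : ‖c‖ ≤ M) : ‖(A : ℂ) • (a + (κ : ℂ) • (b + c))‖ ≤ 3 * A * M := by
  have h1 : ‖(κ : ℂ) • (b + c)‖ ≤ ‖b + c‖ := by
    rw [norm_smul, Complex.norm_real, Real.norm_eq_abs, abs_of_nonneg hκ]
    exact mul_le_of_le_one_left (norm_nonneg _) hκ'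
  have h2 := norm_add_le a ((κ : ℂ) • (b + c))
  have h3 := norm_add_le b c
  rw [norm_smul, Complex.norm_real, Real.norm_eq_abs, abs_of_nonneg hA]
  calc _ ≤ A * (3 * M) := mul_le_mul_of_nonneg_left (by linarith) hA
    _ = _ := by ring

/-- Uniform bounds in logarithmic coordinates. -/
theorem norm_logCovec_le {m : ℕ} (hm : m ≠ 0) {A K : ℝ} (hA : 0 ≤ A) {X : ℝ → ℝ} {ξ : ℂ}
    (h0 : |X ξ.re| ≤ K) (h1 : |deriv X ξ.re| ≤ K) (h2 : |deriv (deriv X) ξ.re| ≤ K)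
    (h3 : |deriv (deriv (deriv X)) ξ.re| ≤ K) :
    ‖logCovec m A X ξ‖ ≤ 48 * K * (A * Real.exp (ξ.re / m)) ∧
    ‖logCovecDeriv m A X ξ‖ ≤ 48 * K * (A * Real.exp (ξ.re / m)) ∧
    ∀ v, ‖logCovecDeriv2 m A X ξ v‖ ≤ 48 * K * (A * Real.exp (ξ.re / m)) * ‖v‖ := by
  have hm1 : (0 : ℝ) < m + 1 := by positivity
  have k0 : (0 : ℝ) ≤ (m : ℝ) / (m + 1) / 2 := by positivity
  have k1 : (m : ℝ) / (m + 1) / 2 ≤ 1 := by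
    have : (m : ℝ) / (m + 1) ≤ 1 := (div_le_one hm1).2 (by linarith)
    linarith
  have hK : 0 ≤ K := (abs_nonneg _).trans h0
  have hE : 0 ≤ K * Real.exp (ξ.re / m) := by positivity
  have c1 := conjExponent_re m ξ
  have c2 := mixedExponent_re m ξ
  have n1 := norm_conjExponent_le hm
  have n2 := norm_mixedExponent_le hm
  -- The common constant is `48 = 3 · 16`, from the second derivative; the value and the first
  -- derivative need only `3` and `12`.
  refine ⟨?_, ?_, ?_⟩
  · have := norm_combination_le hA k0 k1 (norm_logExp_le c1 h0) (norm_logExp_le c2 h1)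
      (norm_logExp_le c1 h1)
    refine this.trans ?_
    nlinarith [mul_nonneg hA hE]
  · have := norm_combination_le hA k0 k1 (norm_logExpDeriv_le c1 n1 h0 h1)
      (norm_logExpDeriv_le c2 n2 h1 h2) (norm_logExpDeriv_le c1 n1 h1 h2)
    refine this.trans ?_
    nlinarith [mul_nonneg hA hE]
  · intro v
    have := norm_combination_le hA k0 k1 (norm_logExpDeriv2_le c1 n1 h0 h1 h2 v)
      (norm_logExpDeriv2_le c2 n2 h1 h2 h3 v) (norm_logExpDeriv2_le c1 n1 h1 h2 h3 v)
    refine this.trans (le_of_eq ?_)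
    ring

end LogDerivatives

/-! ### The graph in logarithmic coordinates and its slopes. -/

section LogGraph

/-- The graph in logarithmic coordinates. -/
def logGraph (m : ℕ) (A : ℝ) (X : ℝ → ℝ) (w : ℂ × ℝ) : (ℂ × ℝ) × ℂ :=
  (expParam 1 w, logCovec m A X w.1)

/-- The derivative of `logGraph`. -/
def logGraphDeriv (m : ℕ) (A : ℝ) (X : ℝ → ℝ) (w : ℂ × ℝ) : ℂ × ℝ →L[ℝ] (ℂ × ℝ) × ℂ :=
  (expParamDeriv 1 w).prod ((logCovecDeriv m A X w.1).comp (ContinuousLinearMap.fst ℝ ℂ ℝ))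

theorem logGraphDeriv_apply (m : ℕ) (A : ℝ) (X : ℝ → ℝ) (w v : ℂ × ℝ) :
    logGraphDeriv m A X w v = ((Complex.exp w.1 * v.1, v.2), logCovecDeriv m A X w.1 v.1) := by
  refine Prod.ext ?_ rfl
  change expParamDeriv 1 w v = _
  rw [expParamDeriv_apply]; simp

theorem hasFDerivAt_logGraph (m : ℕ) (A : ℝ) {X : ℝ → ℝ} {w : ℂ × ℝ}
    (hX : ContDiffAt ℝ ∞ X w.1.re) :
    HasFDerivAt (logGraph m A X) (logGraphDeriv m A X w) w :=
  (hasFDerivAt_expParam 1 w).prodMk (HasFDerivAt.comp (g := logCovec m A X) w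
    (hasFDerivAt_logCovec m A hX) (ContinuousLinearMap.fst ℝ ℂ ℝ).hasFDerivAt)

theorem contDiffAt_logGraph (m : ℕ) (A : ℝ) {X : ℝ → ℝ} {w : ℂ × ℝ}
    (hX : ContDiffAt ℝ ∞ X w.1.re) : ContDiffAt ℝ ∞ (logGraph m A X) w :=
  (contDiff_expParam 1).contDiffAt.prodMk (ContDiffAt.comp (g := logCovec m A X)
    (f := fun w : ℂ × ℝ => w.1) w (contDiffAt_logCovec m A hX) contDiffAt_fst)

theorem injective_logGraphDeriv (m : ℕ) (A : ℝ) (X : ℝ → ℝ) (w : ℂ × ℝ) :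
    Function.Injective (logGraphDeriv m A X w) := fun _ _ hv =>
  (bijective_expParamDeriv one_ne_zero w).1 (congrArg Prod.fst hv)

/-- The slope of the graph in the coordinates downstairs, in the direction `c`. -/
def logSlope (m : ℕ) (A : ℝ) (X : ℝ → ℝ) (c ξ : ℂ) : ℂ :=
  logCovecDeriv m A X ξ (c * Complex.exp (-ξ))

theorem hasFDerivAt_logSlope (m : ℕ) (A : ℝ) {X : ℝ → ℝ} (c : ℂ) {ξ : ℂ}
    (hX : ContDiffAt ℝ ∞ X ξ.re) :
    ∃ L : ℂ →L[ℝ] ℂ, HasFDerivAt (logSlope m A X c) L ξ ∧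
      ∀ v, L v = logCovecDeriv m A X ξ (-(c * Complex.exp (-ξ) * v))
        + logCovecDeriv2 m A X ξ v (c * Complex.exp (-ξ)) := by
  have h1 : HasFDerivAt (fun ξ : ℂ => c * Complex.exp (-ξ))
      (c • (Complex.exp (-ξ) • -(ContinuousLinearMap.id ℝ ℂ))) ξ :=
    (((ContinuousLinearMap.id ℝ ℂ).hasFDerivAt (x := ξ)).neg.cexp).const_mul c
  have h2 := (hasFDerivAt_logCovecDeriv m A hX).clm_apply h1
  refine ⟨_, h2, fun v => ?_⟩
  simp [mul_assoc]

/-- A unit step in `u` is a step of length `e^{-ρ}` in `ξ`, which gives the factor in the slope. The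
factor `e^{-ξ}` keeps its size under differentiation in `ξ`, so the two terms of the product rule
give `2M`. -/
theorem logSlope_bound {m : ℕ} {A M : ℝ} {X : ℝ → ℝ} {c ξ : ℂ} (hc : ‖c‖ = 1)
    (hX : ContDiffAt ℝ ∞ X ξ.re) (h1 : ‖logCovecDeriv m A X ξ‖ ≤ M)
    (h2 : ∀ v, ‖logCovecDeriv2 m A X ξ v‖ ≤ M * ‖v‖) :
    ‖logSlope m A X c ξ‖ ≤ M * Real.exp (-ξ.re) ∧
    ∃ L : ℂ →L[ℝ] ℂ, HasFDerivAt (logSlope m A X c) L ξ ∧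
      ∀ v, ‖L v‖ ≤ 2 * M * Real.exp (-ξ.re) * ‖v‖ := by
  have hM : 0 ≤ M := (norm_nonneg _).trans h1
  have e1 : ‖c * Complex.exp (-ξ)‖ = Real.exp (-ξ.re) := by
    rw [norm_mul, hc, one_mul, Complex.norm_exp, Complex.neg_re]
  refine ⟨?_, ?_⟩
  · have := (logCovecDeriv m A X ξ).le_of_opNorm_le h1 (c * Complex.exp (-ξ))
    rwa [e1] at this
  · obtain ⟨L, hL, hLv⟩ := hasFDerivAt_logSlope m A c hX
    refine ⟨L, hL, fun v => ?_⟩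
    rw [hLv]
    have f1 := (logCovecDeriv m A X ξ).le_of_opNorm_le h1 (-(c * Complex.exp (-ξ) * v))
    rw [norm_neg, norm_mul, e1] at f1
    have f2 := (logCovecDeriv2 m A X ξ v).le_of_opNorm_le (h2 v)
      (c * Complex.exp (-ξ))
    rw [e1] at f2
    refine (norm_add_le _ _).trans ?_
    linarith

end LogGraph

/-! ### Estimates in the transition region. -/

section LogEstimate

variable {Y : Type*} [TopologicalSpace Y] [ChartedSpace C3 Y] [IsManifold 𝓘(ℂ, C3) ω Y]
  {Z : Type*} [TopologicalSpace Z] [ChartedSpace R3 Z] [IsManifold (𝓡 3) ∞ Z]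
  {cy : CalabiYau Y} {ι : Z → Y} {U : Set (Cotangent Z)} {Φ : Cotangent Z → Y}
  {ψ : ℂ × ℝ → Z} {ρ l : ℝ}
  {X : Type*} [TopologicalSpace X] [ChartedSpace R3 X] [IsManifold (𝓡 3) ∞ X] [OrientedAtlas X]

/-- The estimates of the phase in logarithmic coordinates. -/
theorem exists_log_estimate (hι : IsSpecialLagrangian cy ι)
    (hΦ : IsLagrangianNeighbourhood cy ι U Φ) (hψ : IsTube ρ l ψ)
    {r₀ : ℝ} (hr₀ : 0 < r₀) (hr₁ : r₀ ≤ 1) {c : ℝ} (hc : 0 < c)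
    (hbox : ∀ q ∈ box l r₀, q.1 ∈ cyl ρ ∧ cotangentLift ψ q.1 (pairing q.2) ∈ U ∧
      Function.Injective (tubeDeriv Φ ψ q) ∧
      ∀ v, c * ‖v‖ ≤ Real.sqrt (tubeMetric cy Φ ψ (q, v))) {m : ℕ} (hm : m ≠ 0) {K : ℝ}
    (hK : 0 < K) :
    ∃ C, 0 < C ∧ ∀ (A : ℝ) (F : ℝ → ℝ) (x : ℂ × ℝ → X) (w₀ : ℂ × ℝ) (D : X → Y), 0 < A →
      (∀ᶠ r in 𝓝 w₀.1.re, ContDiffAt ℝ ∞ F r) →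
      |F w₀.1.re| ≤ K → |deriv F w₀.1.re| ≤ K → |deriv (deriv F) w₀.1.re| ≤ K →
      |deriv (deriv (deriv F)) w₀.1.re| ≤ K →
      ContMDiffAt 𝓘(ℝ, ℂ × ℝ) (𝓡 3) ∞ x w₀ →
      Function.Bijective (mfderiv 𝓘(ℝ, ℂ × ℝ) (𝓡 3) x w₀) →
      (∀ᶠ w in 𝓝 w₀, D (x w) = tubeMap Φ ψ (logGraph m A F w)) →
      logGraph m A F w₀ ∈ box l r₀ →
      ContMDiffAt (𝓡 3) 𝓘(ℝ, C3) ∞ D (x w₀) ∧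
      Function.Injective (mfderiv (𝓡 3) 𝓘(ℝ, C3) D (x w₀)) ∧
      ContMDiffAt (𝓡 3) 𝓘(ℝ, ℝ) ∞ (phase cy D) (x w₀) ∧
      |phase cy D (x w₀)| ≤ C * (A * Real.exp (w₀.1.re / m - w₀.1.re)) ∧
      DiffNormLE cy D (phase cy D) (x w₀) (C * (A * Real.exp (w₀.1.re / m - 2 * w₀.1.re))) := by
  obtain ⟨C, hC, hb⟩ := exists_bound_graphAngle hι hΦ hψ hr₀
    fun q hq => ⟨(hbox q hq).1, (hbox q hq).2.1, (hbox q hq).2.2.1⟩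
  -- `96 = 2 · 48` and `240 = 5 · 48`, where `48` is the constant of `norm_logCovec_le`.
  refine ⟨max (C * (96 * K)) (C * (240 * K) / c), by positivity,
    fun A F x w₀ D hA hF k0 k1 k2 k3 hx hxb hD hq => ?_⟩
  obtain ⟨g1, g2, g3, g4⟩ := hbox _ hq
  set r := w₀.1.re with hr
  have hF0 := hF.self_of_nhds
  obtain ⟨p0, p1, p2⟩ := norm_logCovec_le (m := m) hm hA.le k0 k1 k2 k3
  set M := 48 * K * (A * Real.exp (w₀.1.re / m)) with hM
  have hM0 : 0 < M := by positivity
  obtain ⟨s0, L, hL, s1⟩ := logSlope_bound (c := 1) (by simp) hF0 p1 p2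
  obtain ⟨s0', L', hL', s1'⟩ := logSlope_bound (c := Complex.I) (by simp) hF0 p1 p2
  let β : ℂ × ℝ → ℂ × ℂ := fun w => (logSlope m A F 1 w.1, logSlope m A F Complex.I w.1)
  let ang : ℂ × ℝ → ℝ := fun w => graphAngle cy Φ ψ (logGraph m A F w, β w)
  have hF' : ∀ᶠ w : ℂ × ℝ in 𝓝 w₀, ContDiffAt ℝ ∞ F w.1.re :=
    (Complex.continuous_re.comp continuous_fst).continuousAt.eventually hF
  have hang : ∀ᶠ w in 𝓝 w₀,
      frameAngle cy (fun w => tubeMap Φ ψ (logGraph m A F w)) tubeFrame w = ang w := by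
    filter_upwards [hF', (contDiffAt_logGraph m A hF0).continuousAt.eventually
      (eventually_lift_mem hΦ hψ g1 g2)] with w hw hw2
    -- Multiplying the directions `1` and `i` by `e^{-ξ}` turns the logarithmic frame into the frame
    -- of a graph over `u`. As a real change of frame this is a rotation with scaling, of
    -- determinant `|e|² > 0`, so the angle is unchanged.
    set e := Complex.exp (-w.1) with he
    have hee : Complex.exp w.1 * e = 1 := by rw [he, ← Complex.exp_add]; simp
    have hpos : 0 < e.re * e.re - e.im * -e.im := by
      have := Complex.normSq_pos.2 (Complex.exp_ne_zero (-w.1))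
      rw [Complex.normSq_apply] at this
      linarith
    set v₁ : ℂ × ℂ := (Complex.exp w.1, logCovecDeriv m A F w.1 1)
    set v₂ : ℂ × ℂ := (Complex.exp w.1 * Complex.I, logCovecDeriv m A F w.1 Complex.I)
    have h1 := frameAngle_comp_tubeMap (cy := cy) hΦ hψ (hasFDerivAt_logGraph m A hw).differentiableAt
      hw2.1 hw2.2 (x := v₁) (y := v₂) (by
        rw [(hasFDerivAt_logGraph m A hw).fderiv, logGraphDeriv_apply, planeVec_apply]; simp [v₁])
      (by rw [(hasFDerivAt_logGraph m A hw).fderiv, logGraphDeriv_apply, planeVec_apply])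
      (by rw [(hasFDerivAt_logGraph m A hw).fderiv, logGraphDeriv_apply]; simp)
    rw [h1, ← planeAngle_change _ _ e.re e.im (-e.im) e.re (by linarith)]
    have hlin : ∀ a b : ℝ, a • v₁ + b • v₂ = (Complex.exp w.1 * (a + b * Complex.I),
        logCovecDeriv m A F w.1 (a + b * Complex.I)) := by
      intro a b
      refine Prod.ext ?_ ?_
      · simp [v₁, v₂]; ring
      · have : (a + b * Complex.I : ℂ) = a • (1 : ℂ) + b • Complex.I := by simp
        rw [this, map_add, map_smul, map_smul]
        rfl
    have e1 : (e.re + e.im * Complex.I : ℂ) = e := Complex.re_add_im e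
    have e2 : ((-e.im : ℝ) + e.re * Complex.I : ℂ) = Complex.I * e := by
      conv_rhs => rw [← e1]
      push_cast
      linear_combination (-(e.im : ℂ)) * Complex.I_sq
    simp only [hlin]
    rw [e1, e2, mul_left_comm, hee]
    simp only [ang, graphAngle, β, logSlope, one_mul, mul_one]
    rfl
  obtain ⟨r1, r2, r3, r4, r5⟩ := phase_tube hΦ hψ hx hxb (contDiffAt_logGraph m A hF0)
    (by rw [(hasFDerivAt_logGraph m A hF0).fderiv]; exact injective_logGraphDeriv m A F w₀)
    g1 g2 g3 hc g4 hD hang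
  have hbw := hb _ hq (β w₀)
  have hexp : Real.exp r ≤ 1 := by
    have h1 := (mem_box.1 hq).1
    have h2 : ‖(logGraph m A F w₀).1.1‖ = Real.exp r := by
      change ‖Complex.exp ((1 : ℝ) * w₀.1)‖ = _
      rw [Complex.norm_exp]; simp [hr]
    rw [h2] at h1
    exact h1.trans hr₁
  have hE : 1 ≤ Real.exp (-r) := by
    rw [Real.exp_neg]
    exact (one_le_inv₀ (Real.exp_pos r)).2 hexp
  have hβ : ‖β w₀‖ ≤ M * Real.exp (-r) := max_le s0 s0'
  -- Since `e^ρ ≤ r₀ ≤ 1`, the height `M` of the graph is dominated by the slope bound `M e^{-ρ}`.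
  have hpβ : ‖(logGraph m A F w₀).2‖ + ‖β w₀‖ ≤ 2 * (M * Real.exp (-r)) := by
    have : ‖(logGraph m A F w₀).2‖ ≤ M := p0
    nlinarith
  have x1 : M * Real.exp (-r) = 48 * K * (A * Real.exp (r / m - r)) := by
    rw [hM, ← hr, sub_eq_add_neg, Real.exp_add]; ring
  have x2 : M * Real.exp (-r) * Real.exp (-r) = 48 * K * (A * Real.exp (r / m - 2 * r)) := by
    rw [x1, (by ring : r / m - 2 * r = r / m - r + -r), Real.exp_add]; ring
  refine ⟨r1, r2, r3, ?_, ?_⟩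
  · rw [r4]
    calc |ang w₀| ≤ C * (‖(logGraph m A F w₀).2‖ + ‖β w₀‖) := hbw.1
      _ ≤ C * (2 * (M * Real.exp (-r))) := mul_le_mul_of_nonneg_left hpβ hC.le
      _ = C * (96 * K) * (A * Real.exp (r / m - r)) := by rw [x1]; ring
      _ ≤ _ := mul_le_mul_of_nonneg_right (le_max_left _ _) (by positivity)
  -- The factor `5 = 2 + 1 + 2` adds the contributions of the horizontal motion, of `p` and of the
  -- slopes. Each is at most `M e^{-2ρ} ‖V‖`, since a vector in `ξ` is `e^{-ρ}` times its image in
  -- `u`.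
  · have hmain : DiffNormLE cy D (phase cy D) (x w₀)
        (C * (5 * (M * Real.exp (-r) * Real.exp (-r))) / c) := by
      refine r5 _ (by positivity) fun v => ?_
      rw [(hasFDerivAt_logGraph m A hF0).fderiv]
      set V := logGraphDeriv m A F w₀ v with hV
      have hN : DifferentiableAt ℝ (graphAngle cy Φ ψ) (logGraph m A F w₀, β w₀) :=
        (contDiffAt_graphAngle hΦ hψ g1 g2 g3 _).differentiableAt (by simp)
      have hβ' : HasFDerivAt β ((L.comp (ContinuousLinearMap.fst ℝ ℂ ℝ)).prod
          (L'.comp (ContinuousLinearMap.fst ℝ ℂ ℝ))) w₀ :=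
        (HasFDerivAt.comp (g := logSlope m A F 1) w₀ hL
          (ContinuousLinearMap.fst ℝ ℂ ℝ).hasFDerivAt).prodMk
        (HasFDerivAt.comp (g := logSlope m A F Complex.I) w₀ hL'
          (ContinuousLinearMap.fst ℝ ℂ ℝ).hasFDerivAt)
      have hfd : fderiv ℝ ang w₀ v = fderiv ℝ (graphAngle cy Φ ψ) (logGraph m A F w₀, β w₀)
          (V, (L v.1, L' v.1)) :=
        congrArg (fun L : ℂ × ℝ →L[ℝ] ℝ => L v) (HasFDerivAt.comp (g := graphAngle cy Φ ψ) w₀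
          hN.hasFDerivAt ((hasFDerivAt_logGraph m A hF0).prodMk hβ')).fderiv
      rw [hfd]
      refine (hbw.2 _).trans ?_
      have hVv : V = ((Complex.exp w₀.1 * v.1, v.2), logCovecDeriv m A F w₀.1 v.1) := by
        rw [hV, logGraphDeriv_apply]
      have hv1 : ‖v.1‖ ≤ Real.exp (-r) * ‖V‖ := by
        have h1 : ‖V.1.1‖ ≤ ‖V‖ := (norm_fst_le V.1).trans (norm_fst_le V)
        have h2 : ‖V.1.1‖ = Real.exp r * ‖v.1‖ := by
          rw [hVv]; simp [Complex.norm_exp, hr]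
        rw [h2] at h1
        calc ‖v.1‖ = Real.exp (-r) * (Real.exp r * ‖v.1‖) := by
              rw [← mul_assoc, ← Real.exp_add]; simp
          _ ≤ _ := by gcongr
      have hVp : ‖V.2‖ ≤ M * ‖v.1‖ := by
        rw [hVv]
        exact (logCovecDeriv m A F w₀.1).le_of_opNorm_le p1 v.1
      have hLL : ‖((L v.1, L' v.1) : ℂ × ℂ)‖ ≤ 2 * M * Real.exp (-r) * ‖v.1‖ :=
        max_le (s1 _) (s1' _)
      have hV1 : ‖V.1‖ ≤ ‖V‖ := norm_fst_le V
      have nV := norm_nonneg V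
      have nE := Real.exp_pos (-r)
      set E := Real.exp (-r)
      have f1 : (‖(logGraph m A F w₀).2‖ + ‖β w₀‖) * ‖V.1‖ ≤ 2 * (M * E * E) * ‖V‖ := by
        calc _ ≤ 2 * (M * E) * ‖V‖ := mul_le_mul hpβ hV1 (norm_nonneg _) (by positivity)
          _ ≤ _ := by
            refine mul_le_mul_of_nonneg_right ?_ nV
            nlinarith [mul_pos hM0 nE]
      have f2 : ‖V.2‖ ≤ (M * E * E) * ‖V‖ := by
        calc _ ≤ M * (E * ‖V‖) := hVp.trans (mul_le_mul_of_nonneg_left hv1 hM0.le)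
          _ ≤ M * (E * ‖V‖) * E := le_mul_of_one_le_right (by positivity) hE
          _ = _ := by ring
      have f3 : ‖((L v.1, L' v.1) : ℂ × ℂ)‖ ≤ 2 * (M * E * E) * ‖V‖ := by
        calc _ ≤ 2 * M * E * (E * ‖V‖) := hLL.trans (mul_le_mul_of_nonneg_left hv1 (by positivity))
          _ = _ := by ring
      calc _ ≤ C * (2 * (M * E * E) * ‖V‖ + ((M * E * E) * ‖V‖ + 2 * (M * E * E) * ‖V‖)) := by
            refine mul_le_mul_of_nonneg_left ?_ hC.le
            exact add_le_add f1 (add_le_add f2 f3)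
        _ = _ := by ring
    intro v
    refine (hmain v).trans (mul_le_mul_of_nonneg_right ?_ (Real.sqrt_nonneg _))
    calc C * (5 * (M * Real.exp (-r) * Real.exp (-r))) / c
        = C * (240 * K) / c * (A * Real.exp (r / m - 2 * r)) := by rw [x2]; ring
      _ ≤ _ := mul_le_mul_of_nonneg_right (le_max_right _ _) (by positivity)

end LogEstimate


/-! ### Passage to the limit in the differential inequality. -/

section Closure

variable {Y : Type*} [TopologicalSpace Y] [ChartedSpace C3 Y] [IsManifold 𝓘(ℂ, C3) ω Y]
  {cy : CalabiYau Y}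
  {X : Type*} [TopologicalSpace X] [ChartedSpace R3 X] [IsManifold (𝓡 3) ∞ X]

/-- The inverse of a chart is a parametrization. -/
theorem exists_chart_param (x : X) : ∃ (ψ : R3 → X) (u₀ : R3), ψ u₀ = x ∧
    (∀ᶠ u in 𝓝 u₀, ContMDiffAt 𝓘(ℝ, R3) (𝓡 3) ∞ ψ u ∧
      Function.Bijective (mfderiv 𝓘(ℝ, R3) (𝓡 3) ψ u)) ∧ Tendsto ψ (𝓝 u₀) (𝓝 x) ∧
      𝓝 x ≤ map ψ (𝓝 u₀) := by
  let φ := chartAt R3 x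
  have hmem : φ ∈ IsManifold.maximalAtlas (𝓡 3) ∞ X := IsManifold.chart_mem_maximalAtlas x
  have hx : x ∈ φ.source := mem_chart_source R3 x
  have hu : φ x ∈ φ.target := φ.map_source hx
  have hsymm : ∀ u ∈ φ.target, ContMDiffAt 𝓘(ℝ, R3) (𝓡 3) ∞ φ.symm u := fun u hu =>
    (contMDiffOn_symm_of_mem_maximalAtlas hmem).contMDiffAt (φ.open_target.mem_nhds hu)
  have hbij : ∀ u ∈ φ.target, Function.Bijective (mfderiv 𝓘(ℝ, R3) (𝓡 3) φ.symm u) := by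
    intro u hu
    have hfwd : ContMDiffAt (𝓡 3) 𝓘(ℝ, R3) ∞ φ (φ.symm u) :=
      contMDiffAt_of_mem_maximalAtlas hmem (φ.map_target hu)
    have h2 := mfderiv_comp u (hfwd.mdifferentiableAt (by simp))
      ((hsymm u hu).mdifferentiableAt (by simp))
    have h3 : mfderiv 𝓘(ℝ, R3) 𝓘(ℝ, R3) (φ ∘ φ.symm) u = ContinuousLinearMap.id ℝ R3 := by
      have : (φ ∘ φ.symm) =ᶠ[𝓝 u] id := by
        filter_upwards [φ.open_target.mem_nhds hu] with w hw using φ.right_inv hw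
      rw [this.mfderiv_eq, mfderiv_id]
      rfl
    let Dφ : R3 →L[ℝ] R3 := mfderiv (𝓡 3) 𝓘(ℝ, R3) φ (φ.symm u)
    have h4 : Dφ.comp (paramDeriv φ.symm u) = ContinuousLinearMap.id ℝ R3 := h2.symm.trans h3
    have hinj : Function.Injective (paramDeriv φ.symm u) := by
      intro v w hvw
      have h1 := congrArg (fun L : R3 →L[ℝ] R3 => L v) h4
      have h2 := congrArg (fun L : R3 →L[ℝ] R3 => L w) h4
      exact h1.symm.trans ((congrArg Dφ hvw).trans h2)
    exact ⟨hinj, (LinearMap.injective_iff_surjective (f := (paramDeriv φ.symm u : R3 →ₗ[ℝ] R3))).1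
      hinj⟩
  refine ⟨φ.symm, φ x, φ.left_inv hx, ?_, ?_, ?_⟩
  · filter_upwards [φ.open_target.mem_nhds hu] with u hu using ⟨hsymm u hu, hbij u hu⟩
  · have := φ.continuousAt_symm hu
    rwa [ContinuousAt, φ.left_inv hx] at this
  · exact (φ.symm_map_nhds_eq hx).ge

/-- The inequality `|dε| ≤ c` is a closed condition. -/
theorem diffNormLE_of_frequently {F : X → Y} {ε : X → ℝ} {x : X} {c : ℝ}
    (hF : ∀ᶠ y in 𝓝 x, ContMDiffAt (𝓡 3) 𝓘(ℝ, C3) ∞ F y)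
    (hε : ∀ᶠ y in 𝓝 x, ContMDiffAt (𝓡 3) 𝓘(ℝ, ℝ) ∞ ε y)
    (h : ∃ᶠ y in 𝓝 x, DiffNormLE cy F ε y c) : DiffNormLE cy F ε x c := by
  obtain ⟨ψ, u₀, rfl, hψ, htend, hmap⟩ := exists_chart_param x
  intro w
  obtain ⟨v, rfl⟩ := hψ.self_of_nhds.2.2 w
  let H : R3 → Y := fun u => F (ψ u)
  let η : R3 → ℝ := fun u => ε (ψ u)
  have hev : ∀ᶠ u in 𝓝 u₀, ContMDiffAt 𝓘(ℝ, R3) (𝓡 3) ∞ ψ u ∧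
      ContMDiffAt (𝓡 3) 𝓘(ℝ, C3) ∞ F (ψ u) ∧ ContMDiffAt (𝓡 3) 𝓘(ℝ, ℝ) ∞ ε (ψ u) := by
    filter_upwards [hψ, htend.eventually hF, htend.eventually hε] with u h1 h2 h3
      using ⟨h1.1, h2, h3⟩
  -- With the vector held constant in the parametrization, both sides of the inequality become
  -- continuous functions of the point.
  let A : R3 → ℝ := fun u => |fderiv ℝ η u v|
  let G : R3 → ℝ := fun u => cy.g.inner (H u) (mfderiv 𝓘(ℝ, R3) 𝓘(ℝ, C3) H u v)
    (mfderiv 𝓘(ℝ, R3) 𝓘(ℝ, C3) H u v)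
  have hA : ∀ᶠ u in 𝓝 u₀, abs (α := ℝ) (mfderiv (𝓡 3) 𝓘(ℝ, ℝ) ε (ψ u)
      (mfderiv 𝓘(ℝ, R3) (𝓡 3) ψ u v)) = A u := by
    filter_upwards [hev] with u hu
    have h1 := mfderiv_comp u (hu.2.2.mdifferentiableAt (by simp))
      (hu.1.mdifferentiableAt (by simp))
    rw [mfderiv_eq_fderiv] at h1
    exact congrArg (fun L : R3 →L[ℝ] ℝ => |L v|) h1.symm
  have hG : ∀ᶠ u in 𝓝 u₀, pullbackMetric cy F (ψ u) (mfderiv 𝓘(ℝ, R3) (𝓡 3) ψ u v)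
      (mfderiv 𝓘(ℝ, R3) (𝓡 3) ψ u v) = G u := by
    filter_upwards [hev] with u hu
    have h1 := mfderiv_comp u (hu.2.1.mdifferentiableAt (by simp))
      (hu.1.mdifferentiableAt (by simp))
    exact congrArg (fun L : R3 →L[ℝ] C3 => cy.g.inner (H u) (L v) (L v)) h1.symm
  obtain ⟨e1, e2, e3⟩ := hev.self_of_nhds
  have cA : ContinuousAt A u₀ := by
    have h1 : ContDiffAt ℝ ∞ η u₀ := (ContMDiffAt.comp u₀ e3 e1).contDiffAt
    have h2 : ContDiffAt ℝ ∞ (fderiv ℝ η) u₀ := h1.fderiv_right (by simp)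
    exact (h2.clm_apply contDiffAt_const).continuousAt.abs
  have cG : ContinuousAt G u₀ := by
    have h1 : ContMDiffAt 𝓘(ℝ, R3) 𝓘(ℝ, C3) ∞ H u₀ := ContMDiffAt.comp u₀ e2 e1
    exact (contDiffAt_metric cy (G := H) (a := fun u => u) (v := fun _ => v) (w := fun _ => v) h1
      contDiffAt_id contDiffAt_const contDiffAt_const).continuousAt
  have hfreq : ∃ᶠ u in 𝓝 u₀, A u ≤ c * Real.sqrt (G u) := by
    have h1 : ∃ᶠ u in 𝓝 u₀, DiffNormLE cy F ε (ψ u) c := frequently_map.1 (h.filter_mono hmap)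
    refine (h1.and_eventually (hA.and hG)).mono fun u hu => ?_
    have := hu.1 (mfderiv 𝓘(ℝ, R3) (𝓡 3) ψ u v)
    rw [hu.2.2] at this
    exact hu.2.1.symm.trans_le this
  have hle : A u₀ ≤ c * Real.sqrt (G u₀) := by
    by_contra hcon
    have h2 : ∀ᶠ u in 𝓝 u₀, c * Real.sqrt (G u) < A u :=
      (continuousAt_const.mul cG.sqrt).eventually_lt cA (not_le.1 hcon)
    obtain ⟨u, hu1, hu2⟩ := (hfreq.and_eventually h2).exists
    exact absurd hu1 (not_le.2 hu2)
  refine hA.self_of_nhds.le.trans ?_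
  rw [hG.self_of_nhds]
  exact hle

end Closure

/-! ### The phase where the map is unperturbed. -/

section Unperturbed

variable {Y : Type*} [TopologicalSpace Y] [ChartedSpace C3 Y] [IsManifold 𝓘(ℂ, C3) ω Y]
  {cy : CalabiYau Y}
  {Z : Type*} [TopologicalSpace Z] [ChartedSpace R3 Z] [IsManifold (𝓡 3) ∞ Z] {ι : Z → Y}
  {X : Type*} [TopologicalSpace X] [ChartedSpace R3 X] [IsManifold (𝓡 3) ∞ X] [OrientedAtlas X]

omit [IsManifold (𝓡 3) ∞ Z] in
/-- The phase of a local diffeomorphism onto a special Lagrangian submanifold vanishes. -/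
theorem phase_specialLagrangian (hι : IsSpecialLagrangian cy ι) {f : X → Z}
    (hf : ContMDiff (𝓡 3) (𝓡 3) ∞ f) {D : X → Y} {x : X} (hD : ∀ᶠ y in 𝓝 x, D y = ι (f y))
    (hb : Function.Bijective (mfderiv (𝓡 3) (𝓡 3) f x)) :
    ContMDiffAt (𝓡 3) 𝓘(ℝ, C3) ∞ D x ∧ Function.Injective (mfderiv (𝓡 3) 𝓘(ℝ, C3) D x) ∧
    ContMDiffAt (𝓡 3) 𝓘(ℝ, ℝ) ∞ (phase cy D) x ∧ phase cy D x = 0 ∧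
    mfderiv (𝓡 3) 𝓘(ℝ, ℝ) (phase cy D) x = 0 := by
  obtain ⟨ψ, u₀, rfl, hψ, htend, -⟩ := exists_chart_param x
  let H : R3 → Y := fun u => ι (f (ψ u))
  let b : Fin 3 → R3 := fun i => EuclideanSpace.single i (1 : ℝ)
  have hbas : LinearIndependent ℝ b := by
    have h1 := (EuclideanSpace.basisFun (Fin 3) ℝ).toBasis.linearIndependent
    have h2 : b = (EuclideanSpace.basisFun (Fin 3) ℝ).toBasis := by
      funext i; simp [b]
    rw [h2]; exact h1
  have hι' : ∀ z, MDifferentiableAt (𝓡 3) 𝓘(ℝ, C3) ι z := fun z =>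
    hι.smooth.contMDiffAt.mdifferentiableAt (by simp)
  have hf' : ∀ x, MDifferentiableAt (𝓡 3) (𝓡 3) f x := fun x =>
    hf.contMDiffAt.mdifferentiableAt (by simp)
  have hd : ∀ᶠ u in 𝓝 u₀, ∀ v, (mfderiv 𝓘(ℝ, R3) 𝓘(ℝ, C3) H u v : C3)
      = baseDeriv ι (f (ψ u)) (paramDeriv (fun u => f (ψ u)) u v) := by
    filter_upwards [hψ] with u hu v
    have h1 := mfderiv_comp u (f := fun u => f (ψ u)) (hι' _)
      (MDifferentiableAt.comp u (hf' _) (hu.1.mdifferentiableAt (by simp)))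
    exact congrArg (fun L : R3 →L[ℝ] C3 => L v) h1
  have hz : ∀ᶠ u in 𝓝 u₀, frameAngle cy H b u = 0 := by
    filter_upwards [hd] with u hu
    refine angle_eq_zero ?_
    have h1 := hι.special (f (ψ u)) fun i => paramDeriv (fun u => f (ψ u)) u (b i)
    have : (fun i => mfderiv 𝓘(ℝ, R3) 𝓘(ℝ, C3) H u (b i) : Fin 3 → C3)
        = fun i => baseDeriv ι (f (ψ u)) (paramDeriv (fun u => f (ψ u)) u (b i)) :=
      funext fun i => hu (b i)
    exact (congrArg (fun v : Fin 3 → C3 => (cy.OmegaR (ι (f (ψ u))) v).im) this).trans h1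
  have hH : ContMDiffAt 𝓘(ℝ, R3) 𝓘(ℝ, C3) ∞ H u₀ :=
    ContMDiffAt.comp u₀ hι.smooth.contMDiffAt
      (ContMDiffAt.comp u₀ hf.contMDiffAt hψ.self_of_nhds.1)
  have hinj : Function.Injective (mfderiv 𝓘(ℝ, R3) 𝓘(ℝ, C3) H u₀) := by
    intro v v' hv
    have h1 := hd.self_of_nhds v
    have h2 := hd.self_of_nhds v'
    have h3 := hι.immersion _ (h1.symm.trans (hv.trans h2))
    have h4 := mfderiv_comp u₀ (hf' (ψ u₀)) (hψ.self_of_nhds.1.mdifferentiableAt (by simp))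
    have h5 : ∀ v, paramDeriv (fun u => f (ψ u)) u₀ v
        = mfderiv (𝓡 3) (𝓡 3) f (ψ u₀) (mfderiv 𝓘(ℝ, R3) (𝓡 3) ψ u₀ v) := fun v =>
      congrArg (fun L : R3 →L[ℝ] R3 => L v) h4
    exact hψ.self_of_nhds.2.1 (hb.1 ((h5 v).symm.trans (h3.trans (h5 v'))))
  obtain ⟨r1, r2, r3, r4, r5⟩ := phase_param cy hψ.self_of_nhds.1 hψ.self_of_nhds.2 hbas hH hinj
    (htend.eventually hD)
  refine ⟨r1, r2, r3, ?_, ?_⟩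
  · rw [hz.self_of_nhds, abs_zero, abs_eq_zero] at r4
    exact r4
  · have h1 := r5 0 fun v => by
      have : fderiv ℝ (frameAngle cy H b) u₀ = 0 :=
        (EventuallyEq.fderiv_eq hz).trans (by simp)
      rw [this]; simp
    refine ContinuousLinearMap.ext fun v => ?_
    have h2 := h1 v
    rw [zero_mul] at h2
    have h3 : ∀ r : ℝ, |r| ≤ 0 → r = 0 := fun r => abs_nonpos_iff.1
    exact h3 _ h2

end Unperturbed


/-! ### Powers of `t`. -/

section Amplitude

theorem amplitude_pos {m : ℕ} {a t : ℝ} (ha : 0 < a) (ht : 0 < t) : 0 < amplitude m a t :=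
  mul_pos (Real.rpow_pos_of_pos ht _) (Real.rpow_pos_of_pos ha _)

theorem tendsto_rpow_zero {α : ℝ} (hα : 0 < α) : Tendsto (fun t : ℝ => t ^ α) (𝓝[>] 0) (𝓝 0) := by
  have h : ContinuousAt (fun t : ℝ => t ^ α) 0 := Real.continuousAt_rpow_const 0 α (Or.inr hα.le)
  have h2 : Tendsto (fun t : ℝ => t ^ α) (𝓝 0) (𝓝 0) := by
    simpa [ContinuousAt, Real.zero_rpow hα.ne'] using h
  exact h2.mono_left nhdsWithin_le_nhds

theorem tendsto_amplitude {m : ℕ} (hm : 2 ≤ m) (a : ℝ) :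
    Tendsto (amplitude m a) (𝓝[>] 0) (𝓝 0) := by
  have hm' : (2 : ℝ) ≤ m := by exact_mod_cast hm
  have h := (tendsto_rpow_zero (α := ((m : ℝ) - 1) / m)
    (div_pos (by linarith) (by linarith))).mul_const (a ^ (1 / (m : ℝ)))
  rwa [zero_mul] at h

theorem amplitude_eq {m : ℕ} (hm : m ≠ 0) (a t : ℝ) :
    amplitude m a t = a ^ (1 / (m : ℝ)) * t ^ (1 - 1 / (m : ℝ)) := by
  have hm' : (m : ℝ) ≠ 0 := by exact_mod_cast hm
  rw [amplitude, mul_comm, sub_div, div_self hm']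

/-- The size of `A e^{-κ ρ}` for `e^ρ ≥ t^{c}`. -/
theorem amplitude_mul_exp_le {m : ℕ} (hm : m ≠ 0) {a t c κ r : ℝ} (ha : 0 < a) (ht : 0 < t)
    (hκ : κ ≤ 0) (hr : t ^ c ≤ Real.exp r) :
    amplitude m a t * Real.exp (κ * r) ≤
      a ^ (1 / (m : ℝ)) * t ^ ((1 - 1 / (m : ℝ)) + c * κ) := by
  have h1 : Real.exp (κ * r) ≤ t ^ (c * κ) := by
    rw [mul_comm, Real.exp_mul, Real.rpow_mul ht.le]
    exact Real.rpow_le_rpow_of_nonpos (Real.rpow_pos_of_pos ht _) hr hκ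
  rw [amplitude_eq hm, Real.rpow_add ht, mul_assoc]
  gcongr

end Amplitude

/-! ### The estimates in one tube, uniform in `t`. -/

section Estimates

variable {Y : Type*} [TopologicalSpace Y] [ChartedSpace C3 Y] [IsManifold 𝓘(ℂ, C3) ω Y]
  {cy : CalabiYau Y}
  {Z : Type*} [TopologicalSpace Z] [ChartedSpace R3 Z] [IsManifold (𝓡 3) ∞ Z] {ι : Z → Y}
  {U : Set (Cotangent Z)} {Φ : Cotangent Z → Y}
  {X : Type*} [TopologicalSpace X] [ChartedSpace R3 X] [IsManifold (𝓡 3) ∞ X] [OrientedAtlas X]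
  {f : X → Z} {n : ℕ} {B : BranchData X Z n} {R₀ : ℝ} {a : Fin n → ℝ} {χ : ℝ → ℝ → ℝ}
  {δ₀ c₁ c₂ : ℝ}

/-- Periodicity moves the point into the compact fundamental domain, over which the box estimates
hold. -/
theorem IsTube.exists_fundamental {M : Type*} [TopologicalSpace M] [ChartedSpace R3 M] {ρ l : ℝ}
    {ψ : ℂ × ℝ → M} (h : IsTube ρ l ψ) {w : ℂ × ℝ} (hw : w ∈ cyl ρ) :
    ∃ s ∈ Icc 0 l, ψ (w.1, s) = ψ w := by
  refine ⟨w.2 - ⌊w.2 / l⌋ * l, ⟨?_, ?_⟩, ?_⟩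
  · have := Int.floor_le (w.2 / l)
    rw [le_div_iff₀ h.length_pos] at this
    linarith
  · have := (Int.lt_floor_add_one (w.2 / l)).le
    rw [div_le_iff₀ h.length_pos] at this
    linarith
  · refine (h.eq_iff (w.1, w.2 - ⌊w.2 / l⌋ * l) hw w hw).2 ⟨rfl, -⌊w.2 / l⌋, ?_⟩
    push_cast
    ring

/-- Immersion and smoothness statements at a point. -/
def IsGoodAt (cy : CalabiYau Y) (U : Set (Cotangent Z)) (Φ : Cotangent Z → Y) (f : X → Z)
    (h : X → ℝ) (x : X) : Prop :=
  pushGraph f h x ∈ U ∧ ContMDiffAt (𝓡 3) 𝓘(ℝ, C3) ∞ (fun x => Φ (pushGraph f h x)) x ∧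
  Function.Injective (mfderiv (𝓡 3) 𝓘(ℝ, C3) (fun x => Φ (pushGraph f h x)) x) ∧
  ContMDiffAt (𝓡 3) 𝓘(ℝ, ℝ) ∞ (phase cy (fun x => Φ (pushGraph f h x))) x

/-- The estimates in one of the tubes. -/
theorem exists_tube_estimate (hι : IsSpecialLagrangian cy ι)
    (hΦ : IsLagrangianNeighbourhood cy ι U Φ)
    (hf : IsSimpleNormalizedBranchedCovering cy ι f B) (hR : ∀ j, R₀ < B.R j)
    (ha : ∀ j, 0 < a j) (hc₂ : 0 < c₂)
    (hχ : IsCutoffFamily δ₀ R₀ (fun t => t ^ c₁) (fun t => t ^ c₂) χ) (j : Fin n) :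
    ∃ C, 0 < C ∧ ∀ᶠ t in 𝓝[>] (0 : ℝ), t < δ₀ → ∀ w : ℂ × ℝ, ‖w.1‖ ^ B.m j ≤ t ^ c₂ →
      IsGoodAt cy U Φ f (potential B R₀ a χ t) (B.up j w) ∧
      (‖w.1‖ ^ B.m j < t ^ c₁ →
        |phase cy (deformation Φ f B R₀ a χ t) (B.up j w)|
          ≤ C * t ^ c₁ + C * t ^ ((1 - 1 / (B.m j : ℝ)) + c₁ / (B.m j : ℝ)) ∧
        DiffNormLE cy (deformation Φ f B R₀ a χ t) (phase cy (deformation Φ f B R₀ a χ t))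
          (B.up j w) C) ∧
      (t ^ c₁ ≤ ‖w.1‖ ^ B.m j →
        |phase cy (deformation Φ f B R₀ a χ t) (B.up j w)|
          ≤ C * t ^ ((1 - 1 / (B.m j : ℝ)) * (1 - c₁)) ∧
        DiffNormLE cy (deformation Φ f B R₀ a χ t) (phase cy (deformation Φ f B R₀ a χ t))
          (B.up j w) (C * t ^ ((1 - 1 / (B.m j : ℝ)) - c₁ * (2 - 1 / (B.m j : ℝ))))) := by
  have hm2 := hf.two_le j
  have hm := hf.m_ne_zero j
  have hm' : (2 : ℝ) ≤ B.m j := by exact_mod_cast hm2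
  have hmi : 1 / (B.m j : ℝ) ≤ 1 := (div_le_one (by linarith)).2 (by linarith)
  have hup := hf.tube_up j
  have hdown := hf.tube_down j
  obtain ⟨r₀, hr₀, hr₁, c, hc, hbox⟩ := exists_box hι hΦ hdown (hf.orthonormal j)
  obtain ⟨K, hK, t₀, ht₀, hbK⟩ := hχ.exists_bound_logCutoff
  obtain ⟨C₁, hC₁, h₁⟩ := exists_core_estimate (X := X) hι hΦ hdown (hf.orthonormal j) hr₀ hr₁ hc
    hbox hm2
  obtain ⟨C₂, hC₂, h₂⟩ := exists_log_estimate (X := X) hι hΦ hdown hr₀ hr₁ hc hbox hm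
    (K := K) (by linarith)
  set α := a j ^ (1 / (B.m j : ℝ)) with hα
  have hα0 : 0 < α := Real.rpow_pos_of_pos (ha j) _
  refine ⟨max (C₁ * (1 + α)) (max C₁ (C₂ * α)), by positivity, ?_⟩
  set C := max (C₁ * (1 + α)) (max C₁ (C₂ * α)) with hC
  have hC1 : C₁ * (1 + α) ≤ C := le_max_left _ _
  have hC2 : C₁ ≤ C := (le_max_left _ _).trans (le_max_right _ _)
  have hC3 : C₂ * α ≤ C := (le_max_right _ _).trans (le_max_right _ _)
  -- The amplitude tends to zero because `1 - 1/m > 0`. The factor `48 K` bounds the covector over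
  -- it, so the graph lies in the box for small `t`.
  have hsmall : ∀ᶠ t in 𝓝[>] (0 : ℝ), 48 * K * amplitude (B.m j) (a j) t < r₀ := by
    have h := (tendsto_amplitude hm2 (a j)).const_mul (48 * K)
    rw [mul_zero] at h
    exact h.eventually (gt_mem_nhds hr₀)
  filter_upwards [hsmall, (tendsto_rpow_zero hc₂).eventually (gt_mem_nhds hr₀),
    self_mem_nhdsWithin, nhdsWithin_le_nhds (gt_mem_nhds ht₀)] with t e1 e2 e3 e4 e5 w hw
  have ht : t ∈ Ioo 0 δ₀ := ⟨e3, e5⟩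
  have e3' : 0 < t := e3
  obtain ⟨b1, b12, b2⟩ := hχ.b_lt t ht
  have hA : 0 < amplitude (B.m j) (a j) t := amplitude_pos (ha j) e3
  have hAr : amplitude (B.m j) (a j) t ≤ r₀ := by
    have : 1 ≤ 48 * K := by linarith
    nlinarith
  have hwR : ‖w.1‖ ^ B.m j < R₀ := hw.trans_lt b2
  obtain ⟨s, hs, hsw⟩ := hup.exists_fundamental (mem_cyl_rpow hm (hwR.trans (hR j)))
  rw [← hsw]
  rcases lt_or_ge (‖w.1‖ ^ B.m j) (t ^ c₁) with hlt | hge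
  -- The strict inequality is an open condition, so the antiholomorphic formula holds in a whole
  -- neighbourhood and may be differentiated.
  · have hev : ∀ᶠ w' : ℂ × ℝ in 𝓝 (w.1, s), ‖w'.1‖ ^ B.m j < t ^ c₁ := by
      have : Continuous fun w' : ℂ × ℝ => ‖w'.1‖ ^ B.m j := by fun_prop
      exact (this.continuousAt (x := (w.1, s))).eventually (gt_mem_nhds hlt)
    have hp := hf.pushGraph_core (a := a) hR hχ ht (w := (w.1, s)) hlt
    have hw1 : ‖w.1‖ ≤ 1 := by
      by_contra hcon
      have := one_lt_pow₀ (not_le.1 hcon) hm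
      linarith
    have hbx : coreGraph (B.m j) (amplitude (B.m j) (a j) t) (w.1, s) ∈ box (B.l j) r₀ := by
      rw [mem_box]
      refine ⟨?_, hs, ?_⟩
      · simp only [coreGraph, norm_pow]; linarith
      · simp only [coreGraph, norm_mul, RCLike.norm_conj, Complex.norm_real, Real.norm_eq_abs,
          abs_of_pos hA]
        nlinarith [norm_nonneg w.1]
    have hcyl := mem_cyl_rpow (p := (w.1, s)) hm (hwR.trans (hR j))
    obtain ⟨r1, r2, r3, r4, r5⟩ := h₁ _ (B.up j) (w.1, s) (deformation Φ f B R₀ a χ t) hA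
      (hup.contMDiffAt hcyl) (hup.bijective _ hcyl) (by
        filter_upwards [hev] with w' hw'
        exact congrArg Φ (hf.pushGraph_core hR hχ ht hw')) hbx
    refine ⟨⟨?_, r1, r2, r3⟩, fun _ => ⟨?_, ?_⟩, fun h => absurd hlt (not_lt.2 h)⟩
    · rw [hp]; exact (hbox _ hbx).2.1
    · refine r4.trans ?_
      have f1 : amplitude (B.m j) (a j) t * ‖w.1‖
          ≤ α * t ^ ((1 - 1 / (B.m j : ℝ)) + c₁ / (B.m j : ℝ)) := by
        rw [amplitude_eq hm, Real.rpow_add e3', mul_assoc]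
        have : ‖w.1‖ ≤ t ^ (c₁ / (B.m j : ℝ)) := by
          rw [div_eq_mul_inv, Real.rpow_mul e3'.le]
          calc ‖w.1‖ = (‖w.1‖ ^ B.m j) ^ ((B.m j : ℝ)⁻¹) :=
                (Real.pow_rpow_inv_natCast (norm_nonneg _) hm).symm
            _ ≤ _ := Real.rpow_le_rpow (by positivity) hlt.le (by positivity)
        gcongr
      calc C₁ * (‖w.1‖ ^ B.m j + amplitude (B.m j) (a j) t * ‖w.1‖)
          ≤ C₁ * (t ^ c₁ + α * t ^ ((1 - 1 / (B.m j : ℝ)) + c₁ / (B.m j : ℝ))) := by gcongr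
        _ = C₁ * t ^ c₁ + (C₁ * α) * t ^ ((1 - 1 / (B.m j : ℝ)) + c₁ / (B.m j : ℝ)) := by ring
        _ ≤ _ := by
          have : C₁ * α ≤ C := by nlinarith
          gcongr
    · intro v
      exact (r5 v).trans (mul_le_mul_of_nonneg_right hC2 (Real.sqrt_nonneg _))
  · have hz : w.1 ≠ 0 := by
      intro h0
      rw [h0, norm_zero, zero_pow hm] at hge
      linarith
    -- Any branch of the logarithm serves: the parametrization by `ξ` is used only near this one
    -- point.
    let ξ : ℂ := (B.m j : ℝ) * Complex.log w.1
    have hξ : expParam (1 / (B.m j : ℝ)) (ξ, s) = (w.1, s) := by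
      have h0 : (B.m j : ℝ) ≠ 0 := by linarith
      have : (1 / B.m j : ℝ) * ξ = Complex.log w.1 := by
        simp only [ξ]
        rw [← mul_assoc, ← Complex.ofReal_mul, one_div, inv_mul_cancel₀ h0, Complex.ofReal_one,
          one_mul]
      rw [expParam, this, Complex.exp_log hz]
    have hξn : Real.exp ξ.re = ‖w.1‖ ^ B.m j := by
      rw [← norm_exp_pow hm]
      exact congrArg (fun p : ℂ × ℝ => ‖p.1‖ ^ B.m j) hξ
    have hξR : Real.exp ξ.re < R₀ := hξn.trans_lt hwR
    have hev : ∀ᶠ w' : ℂ × ℝ in 𝓝 (ξ, s), Real.exp w'.1.re < R₀ := by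
      have : Continuous fun w' : ℂ × ℝ => Real.exp w'.1.re := by fun_prop
      exact this.continuousAt.eventually (gt_mem_nhds hξR)
    have hev' : ∀ᶠ r in 𝓝 ξ.re, ContDiffAt ℝ ∞ (logCutoff χ t) r := by
      filter_upwards [Real.continuous_exp.continuousAt.eventually (gt_mem_nhds hξR)] with r hr
      exact hχ.contDiffAt_logCutoff ht hr
    obtain ⟨k0, k1, k2, k3⟩ := hbK t ht e4 ξ.re (hξn.trans_le hw)
    have hexp1 : Real.exp ξ.re ≤ 1 := by rw [hξn]; linarith
    have hre : ξ.re ≤ 0 := Real.exp_le_one_iff.1 hexp1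
    have hbx : logGraph (B.m j) (amplitude (B.m j) (a j) t) (logCutoff χ t) (ξ, s)
        ∈ box (B.l j) r₀ := by
      rw [mem_box]
      refine ⟨?_, hs, ?_⟩
      · change ‖Complex.exp ((1 : ℝ) * ξ)‖ ≤ r₀
        rw [Complex.norm_exp]
        simp only [Complex.ofReal_one, one_mul]
        rw [hξn]; linarith
      · refine ((norm_logCovec_le hm hA.le k0 k1 k2 k3).1).trans ?_
        have : Real.exp (ξ.re / B.m j) ≤ 1 :=
          Real.exp_le_one_iff.2 (div_nonpos_of_nonpos_of_nonneg hre (by positivity))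
        calc _ ≤ 48 * K * (amplitude (B.m j) (a j) t * 1) := by gcongr
          _ ≤ _ := by rw [mul_one]; exact e1.le
    have hD : ∀ w' : ℂ × ℝ, Real.exp w'.1.re < R₀ → pushGraph f (potential B R₀ a χ t)
        (B.up j (expParam (1 / (B.m j : ℝ)) w')) = cotangentLift (B.down j)
        (logGraph (B.m j) (amplitude (B.m j) (a j) t) (logCutoff χ t) w').1
        (pairing (logGraph (B.m j) (amplitude (B.m j) (a j) t) (logCutoff χ t) w').2) :=
      fun w' hw' => hf.pushGraph_log hR hχ ht hw'
    obtain ⟨r1, r2, r3, r4, r5⟩ := h₂ _ (logCutoff χ t)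
      (fun w => B.up j (expParam (1 / (B.m j : ℝ)) w)) (ξ, s) (deformation Φ f B R₀ a χ t) hA
      hev' k0 k1 k2 k3 (hf.contMDiffAt_up_exp hR hξR) (hf.bijective_up_exp hR hξR) (by
        filter_upwards [hev] with w' hw'
        exact congrArg Φ (hD w' hw')) hbx
    have hD0 := hD (ξ, s) hξR
    rw [← (congrArg (B.up j) hξ : B.up j (expParam (1 / (B.m j : ℝ)) (ξ, s)) = B.up j (w.1, s))]
    have hge' : t ^ c₁ ≤ Real.exp ξ.re := by rw [hξn]; exact hge
    refine ⟨⟨?_, r1, r2, r3⟩, fun h => absurd h (not_lt.2 hge), fun _ => ⟨?_, ?_⟩⟩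
    · rw [hD0]; exact (hbox _ hbx).2.1
    · refine r4.trans ?_
      -- The exponent `1/m - 1` is nonpositive, so the worst case is the inner edge `e^ρ = t^{c₁}`.
      have f1 := amplitude_mul_exp_le (κ := 1 / (B.m j : ℝ) - 1) hm (ha j) e3' (by linarith) hge'
      rw [(by ring : (1 / (B.m j : ℝ) - 1) * ξ.re = ξ.re / B.m j - ξ.re),
        (by ring : (1 - 1 / (B.m j : ℝ)) + c₁ * (1 / (B.m j : ℝ) - 1)
          = (1 - 1 / (B.m j : ℝ)) * (1 - c₁))] at f1
      calc _ ≤ C₂ * (α * t ^ ((1 - 1 / (B.m j : ℝ)) * (1 - c₁))) :=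
            mul_le_mul_of_nonneg_left f1 hC₂.le
        _ = C₂ * α * t ^ ((1 - 1 / (B.m j : ℝ)) * (1 - c₁)) := by ring
        _ ≤ _ := by gcongr
    · have f1 := amplitude_mul_exp_le (κ := 1 / (B.m j : ℝ) - 2) hm (ha j) e3' (by linarith) hge'
      rw [(by ring : (1 / (B.m j : ℝ) - 2) * ξ.re = ξ.re / B.m j - 2 * ξ.re),
        (by ring : (1 - 1 / (B.m j : ℝ)) + c₁ * (1 / (B.m j : ℝ) - 2)
          = (1 - 1 / (B.m j : ℝ)) - c₁ * (2 - 1 / (B.m j : ℝ)))] at f1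
      intro v
      refine (r5 v).trans (mul_le_mul_of_nonneg_right ?_ (Real.sqrt_nonneg _))
      calc _ ≤ C₂ * (α * t ^ ((1 - 1 / (B.m j : ℝ)) - c₁ * (2 - 1 / (B.m j : ℝ)))) :=
            mul_le_mul_of_nonneg_left f1 hC₂.le
        _ = C₂ * α * t ^ ((1 - 1 / (B.m j : ℝ)) - c₁ * (2 - 1 / (B.m j : ℝ))) := by ring
        _ ≤ _ := by gcongr

end Estimates


/-! ### The decomposition into `P_j`, `Q_j` and `K`. -/

section Pieces

variable {Y : Type*} [TopologicalSpace Y] [ChartedSpace C3 Y] [IsManifold 𝓘(ℂ, C3) ω Y]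
  {cy : CalabiYau Y}
  {Z : Type*} [TopologicalSpace Z] [ChartedSpace R3 Z] [IsManifold (𝓡 3) ∞ Z] {ι : Z → Y}
  {U : Set (Cotangent Z)} {Φ : Cotangent Z → Y}
  {X : Type*} [TopologicalSpace X] [ChartedSpace R3 X] [IsManifold (𝓡 3) ∞ X] [OrientedAtlas X]
  {f : X → Z} {n : ℕ} {B : BranchData X Z n} {R₀ : ℝ} {a : Fin n → ℝ} {χ : ℝ → ℝ → ℝ}
  {δ₀ t : ℝ} {b₁ b₂ : ℝ → ℝ}

theorem isCompact_setOf_norm_pow_le {m : ℕ} (hm : m ≠ 0) (b : ℝ) :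
    IsCompact {z : ℂ | ‖z‖ ^ m ≤ b} := by
  refine (isCompact_closedBall (0 : ℂ) (max 1 b)).of_isClosed_subset
    (isClosed_le (by fun_prop) continuous_const) fun z hz => ?_
  rw [mem_closedBall_zero_iff]
  rcases le_total ‖z‖ 1 with h | h
  · exact h.trans (le_max_left _ _)
  · exact ((le_self_pow₀ h hm).trans hz).trans (le_max_right _ _)

/-- Shrink the first coordinate by factors increasing to one. -/
theorem mem_closure_setOf_norm_pow_lt {m : ℕ} (hm : m ≠ 0) {b : ℝ} (hb : 0 < b) {w : ℂ × ℝ}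
    (hw : ‖w.1‖ ^ m ≤ b) : w ∈ closure {w : ℂ × ℝ | ‖w.1‖ ^ m < b} := by
  have hcont : Continuous fun r : ℝ => ((r * w.1, w.2) : ℂ × ℝ) := by fun_prop
  have htend : Tendsto (fun r : ℝ => ((r * w.1, w.2) : ℂ × ℝ)) (𝓝[<] 1) (𝓝 w) := by
    have h := (hcont.tendsto 1).mono_left (nhdsWithin_le_nhds (s := Iio (1 : ℝ)))
    simpa using h
  refine mem_closure_of_tendsto htend ?_
  filter_upwards [self_mem_nhdsWithin, nhdsWithin_le_nhds (lt_mem_nhds zero_lt_one)] with r h1 h0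
  have h2 : r ^ m < 1 := pow_lt_one₀ h0.le h1 hm
  simp only [norm_mul, Complex.norm_real, Real.norm_eq_abs, abs_of_pos h0, mul_pow]
  nlinarith [pow_pos h0 m, pow_nonneg (norm_nonneg w.1) m]

omit [TopologicalSpace Z] [ChartedSpace R3 Z] [IsManifold (𝓡 3) ∞ Z] [TopologicalSpace X]
  [ChartedSpace R3 X] [IsManifold (𝓡 3) ∞ X] [OrientedAtlas X] in
theorem partP_union_partQ {b₁ b₂ : ℝ} (h : b₁ ≤ b₂) (j : Fin n) :
    partP B b₁ j ∪ partQ B b₁ b₂ j = B.up j '' {p | ‖p.1‖ ^ B.m j ≤ b₂} := by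
  rw [partP, partQ, ← image_union]
  congr 1
  ext p
  simp only [mem_union, mem_ofPred_eq]
  constructor
  · rintro (h1 | h1)
    · exact h1.trans h
    · exact h1.2
  · intro h1
    rcases le_total (‖p.1‖ ^ B.m j) b₁ with h2 | h2
    · exact Or.inl h2
    · exact Or.inr ⟨h2, h1⟩

omit [TopologicalSpace Z] [ChartedSpace R3 Z] [IsManifold (𝓡 3) ∞ Z] [TopologicalSpace X]
  [ChartedSpace R3 X] [IsManifold (𝓡 3) ∞ X] [OrientedAtlas X] in
theorem mem_partK_iff {b₁ b₂ : ℝ} (h : b₁ ≤ b₂) {x : X} :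
    x ∈ partK B b₁ b₂ ↔ ∀ (j : Fin n) (p : ℂ × ℝ), ‖p.1‖ ^ B.m j ≤ b₂ → B.up j p ≠ x := by
  rw [partK, mem_compl_iff, mem_iUnion]
  simp only [partP_union_partQ h, mem_image, mem_ofPred_eq]
  push Not
  rfl

-- Each closed tube is the image of a compact piece of its universal covering, hence compact and
-- closed.
omit [IsManifold (𝓡 3) ∞ Z] [IsManifold (𝓡 3) ∞ X] [OrientedAtlas X] in
theorem isOpen_partK [T2Space X] (hf : IsSimpleNormalizedBranchedCovering cy ι f B)
    {b₁ b₂ : ℝ} (h : b₁ ≤ b₂) (hb : ∀ j, b₂ < B.R j) : IsOpen (partK B b₁ b₂) := by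
  rw [partK, isOpen_compl_iff]
  refine isClosed_iUnion_of_finite fun j => ?_
  rw [partP_union_partQ h]
  have hsub : {z : ℂ | ‖z‖ ^ B.m j ≤ b₂} ×ˢ Icc 0 (B.l j)
      ⊆ cyl (B.R j ^ (1 / (B.m j : ℝ))) := fun p hp =>
    mem_cyl_rpow (hf.m_ne_zero j) (lt_of_le_of_lt hp.1 (hb j))
  have himage : B.up j '' {p | ‖p.1‖ ^ B.m j ≤ b₂}
      = B.up j '' ({z : ℂ | ‖z‖ ^ B.m j ≤ b₂} ×ˢ Icc 0 (B.l j)) := by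
    refine Subset.antisymm ?_ (image_mono fun p hp => hp.1)
    rintro _ ⟨p, hp, rfl⟩
    obtain ⟨s, hs, hsp⟩ := (hf.tube_up j).exists_fundamental
      (mem_cyl_rpow (hf.m_ne_zero j) (lt_of_le_of_lt hp (hb j)))
    exact ⟨(p.1, s), ⟨hp, hs⟩, hsp⟩
  rw [himage]
  exact (((isCompact_setOf_norm_pow_le (hf.m_ne_zero j) b₂).prod isCompact_Icc).image_of_continuousOn
    ((hf.tube_up j).smooth.continuousOn.mono hsub)).isClosed

omit [TopologicalSpace Z] [ChartedSpace R3 Z] [IsManifold (𝓡 3) ∞ Z] [TopologicalSpace X]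
  [ChartedSpace R3 X] [IsManifold (𝓡 3) ∞ X] [OrientedAtlas X] in
theorem potential_eq_zero (hχ : IsCutoffFamily δ₀ R₀ b₁ b₂ χ) (ht : t ∈ Ioo 0 δ₀) {x : X}
    (hx : x ∈ partK B (b₁ t) (b₂ t)) : potential B R₀ a χ t x = 0 := by
  rw [mem_partK_iff (hχ.b_lt t ht).2.1.le] at hx
  rw [potential]
  split_ifs with h
  · obtain ⟨h1, h2⟩ := h.choose_spec
    have h3 : b₂ t ≤ ‖h.choose.2.1‖ ^ B.m h.choose.1 := by
      by_contra hcon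
      exact hx _ _ (not_le.1 hcon).le h2
    rw [localPotential, hχ.eq_zero t ht _ h3 h1, zero_mul]
  · rfl

omit [IsManifold (𝓡 3) ∞ Z] [IsManifold (𝓡 3) ∞ X] [OrientedAtlas X] in
theorem pushGraph_of_eventuallyEq_zero {h : X → ℝ} {x : X} (hx : h =ᶠ[𝓝 x] fun _ => 0) :
    pushGraph f h x = ⟨f x, 0⟩ := by
  have h0 : mfderiv (𝓡 3) 𝓘(ℝ, ℝ) h x = 0 := hx.mfderiv_eq.trans mfderiv_const
  rw [pushGraph]
  congr 1
  rw [h0]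
  exact ContinuousLinearMap.zero_comp _

/-- The deformation does not change `f` off the tubes. -/
theorem isGoodAt_of_mem_partK [T2Space X] (hι : IsSpecialLagrangian cy ι)
    (hΦ : IsLagrangianNeighbourhood cy ι U Φ)
    (hf : IsSimpleNormalizedBranchedCovering cy ι f B) (hR : ∀ j, R₀ < B.R j)
    (hχ : IsCutoffFamily δ₀ R₀ b₁ b₂ χ) (ht : t ∈ Ioo 0 δ₀) {x : X}
    (hx : x ∈ partK B (b₁ t) (b₂ t)) :
    IsGoodAt cy U Φ f (potential B R₀ a χ t) x ∧
    phase cy (deformation Φ f B R₀ a χ t) x = 0 ∧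
    mfderiv (𝓡 3) 𝓘(ℝ, ℝ) (phase cy (deformation Φ f B R₀ a χ t)) x = 0 := by
  obtain ⟨hb0, hb, hbR⟩ := hχ.b_lt t ht
  have hopen : IsOpen (partK B (b₁ t) (b₂ t)) :=
    isOpen_partK hf hb.le fun j => hbR.trans (hR j)
  have hpush : ∀ y ∈ partK B (b₁ t) (b₂ t),
      pushGraph f (potential B R₀ a χ t) y = ⟨f y, 0⟩ := fun y hy =>
    pushGraph_of_eventuallyEq_zero <| by
      filter_upwards [hopen.mem_nhds hy] with z hz using potential_eq_zero hχ ht hz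
  have hbij : Function.Bijective (mfderiv (𝓡 3) (𝓡 3) f x) := by
    refine hf.unramified x ?_
    rintro ⟨j, s, hjs⟩
    refine (mem_partK_iff hb.le).1 hx j (0, s) ?_ hjs
    rw [norm_zero, zero_pow (hf.m_ne_zero j)]
    exact hb0.le.trans hb.le
  have hD : ∀ᶠ y in 𝓝 x, deformation Φ f B R₀ a χ t y = ι (f y) := by
    filter_upwards [hopen.mem_nhds hx] with y hy
    rw [deformation, hpush y hy, hΦ.zero_section]
  obtain ⟨r1, r2, r3, r4, r5⟩ := phase_specialLagrangian hι hf.smooth hD hbij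
  exact ⟨⟨by rw [hpush x hx]; exact hΦ.zero_mem _, r1, r2, r3⟩, r4, r5⟩

omit [IsManifold (𝓡 3) ∞ X] [OrientedAtlas X] in
theorem DiffNormLE.mono {F : X → Y} {ε : X → ℝ} {x : X} {c c' : ℝ} (h : DiffNormLE cy F ε x c)
    (hc : c ≤ c') : DiffNormLE cy F ε x c' := fun v =>
  (h v).trans (mul_le_mul_of_nonneg_right hc (Real.sqrt_nonneg _))

omit [TopologicalSpace Z] [ChartedSpace R3 Z] [IsManifold (𝓡 3) ∞ Z] [OrientedAtlas X] in
/-- Estimates in the interior of `P_j` extend to `P_j`. -/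
theorem estimate_partP {b : ℝ} (hb : 0 < b) {j : Fin n} (hm : B.m j ≠ 0) {w : ℂ × ℝ}
    (hw : ‖w.1‖ ^ B.m j ≤ b) (hup : ContinuousAt (B.up j) w) {F : X → Y}
    (hF : ContMDiff (𝓡 3) 𝓘(ℝ, C3) ∞ F) (hε : ContMDiff (𝓡 3) 𝓘(ℝ, ℝ) ∞ (phase cy F)) {c c' : ℝ}
    (h : ∀ w : ℂ × ℝ, ‖w.1‖ ^ B.m j < b → |phase cy F (B.up j w)| ≤ c ∧
      DiffNormLE cy F (phase cy F) (B.up j w) c') :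
    |phase cy F (B.up j w)| ≤ c ∧ DiffNormLE cy F (phase cy F) (B.up j w) c' := by
  -- The cutoff need not be one on both sides of the boundary, so the boundary is reached as a limit
  -- of interior points; both inequalities are closed conditions.
  have hfreq : ∃ᶠ y in 𝓝 (B.up j w),
      |phase cy F y| ≤ c ∧ DiffNormLE cy F (phase cy F) y c' := by
    refine (mem_closure_iff_frequently.1
      (mem_closure_image hup (mem_closure_setOf_norm_pow_lt hm hb hw))).mono ?_
    rintro _ ⟨w, hw, rfl⟩
    exact h w hw
  exact ⟨le_of_tendsto_of_frequently hε.continuous.abs.continuousAt (hfreq.mono fun _ h => h.1),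
    diffNormLE_of_frequently (Eventually.of_forall fun y => hF.contMDiffAt)
      (Eventually.of_forall fun y => hε.contMDiffAt) (hfreq.mono fun _ h => h.2)⟩

end Pieces

end BranchedSL

end

theorem proposition3p2p4
    -- a Calabi-Yau threefold `Y`
    {Y : Type*} [TopologicalSpace Y] [T2Space Y] [SecondCountableTopology Y]
    [ChartedSpace BranchedSL.C3 Y] [IsManifold 𝓘(ℂ, BranchedSL.C3) ω Y]
    (cy : BranchedSL.CalabiYau Y)
    -- a special Lagrangian 3-sphere `ι : Z → Y` and its Lagrangian neighbourhood `Φ : U → Y`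
    {Z : Type*} [TopologicalSpace Z] [ChartedSpace BranchedSL.R3 Z] [IsManifold (𝓡 3) ∞ Z]
    (hS : Nonempty (Z ≃ₘ⟮𝓡 3, 𝓡 3⟯ (Metric.sphere (0 : EuclideanSpace ℝ (Fin 4)) 1)))
    (ι : Z → Y) (hι : BranchedSL.IsSpecialLagrangian cy ι)
    (U : Set (BranchedSL.Cotangent Z)) (Φ : BranchedSL.Cotangent Z → Y)
    (hΦ : BranchedSL.IsLagrangianNeighbourhood cy ι U Φ)
    -- a closed oriented 3-manifold `X` and a simple normalized branched covering `f : X → Z`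
    {X : Type*} [TopologicalSpace X] [T2Space X] [CompactSpace X]
    [ChartedSpace BranchedSL.R3 X] [IsManifold (𝓡 3) ∞ X] [BranchedSL.OrientedAtlas X]
    (f : X → Z) {n : ℕ} (B : BranchedSL.BranchData X Z n)
    (hf : BranchedSL.IsSimpleNormalizedBranchedCovering cy ι f B)
    -- the constants and the cutoff functions of the gluing construction
    (R₀ : ℝ) (hR₀ : 0 < R₀) (hR : ∀ j, R₀ < B.R j)
    (a : Fin n → ℝ) (ha : ∀ j, 0 < a j)
    (c₁ c₂ : ℝ) (hc₂ : 0 < c₂) (hc : c₂ < c₁)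
    (δ₀ : ℝ) (hδ₀ : 0 < δ₀) (χ : ℝ → ℝ → ℝ)
    (hχ : BranchedSL.IsCutoffFamily δ₀ R₀ (fun t => t ^ c₁) (fun t => t ^ c₂) χ) :
    ∃ δ, 0 < δ ∧ δ ≤ δ₀ ∧ ∃ C : ℝ, 0 < C ∧ ∀ t ∈ Ioo 0 δ,
      -- `f^t` is a well-defined smooth immersion, and `ε^t` is smooth
      (∀ x, BranchedSL.pushGraph f (BranchedSL.potential B R₀ a χ t) x ∈ U) ∧
      ContMDiff (𝓡 3) 𝓘(ℝ, BranchedSL.C3) ∞ (BranchedSL.deformation Φ f B R₀ a χ t) ∧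
      (∀ x, Function.Injective
        (mfderiv (𝓡 3) 𝓘(ℝ, BranchedSL.C3) (BranchedSL.deformation Φ f B R₀ a χ t) x)) ∧
      ContMDiff (𝓡 3) 𝓘(ℝ, ℝ) ∞
        (BranchedSL.phase cy (BranchedSL.deformation Φ f B R₀ a χ t)) ∧
      -- the estimates on `P_j^t`
      (∀ j, ∀ x ∈ BranchedSL.partP B (t ^ c₁) j,
        |BranchedSL.phase cy (BranchedSL.deformation Φ f B R₀ a χ t) x|
          ≤ C * t ^ c₁ + C * t ^ ((1 - 1 / (B.m j : ℝ)) + c₁ / (B.m j : ℝ)) ∧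
        BranchedSL.DiffNormLE cy (BranchedSL.deformation Φ f B R₀ a χ t)
          (BranchedSL.phase cy (BranchedSL.deformation Φ f B R₀ a χ t)) x
          (C + C * t ^ (((B.m j : ℝ) - 1) * (c₁ - 1) / (B.m j : ℝ)))) ∧
      -- the estimates on `Q_j^t`
      (∀ j, ∀ x ∈ BranchedSL.partQ B (t ^ c₁) (t ^ c₂) j,
        |BranchedSL.phase cy (BranchedSL.deformation Φ f B R₀ a χ t) x|
          ≤ C * t ^ (1 - 1 / (B.m j : ℝ) - 2 * c₂)
            + C * t ^ ((1 - 1 / (B.m j : ℝ)) * (1 - c₁)) ∧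
        BranchedSL.DiffNormLE cy (BranchedSL.deformation Φ f B R₀ a χ t)
          (BranchedSL.phase cy (BranchedSL.deformation Φ f B R₀ a χ t)) x
          (C * t ^ (1 - 1 / (B.m j : ℝ) - 3 * c₂)
            + C * t ^ ((1 - 1 / (B.m j : ℝ)) * (1 - c₁) - c₂)
            + C * t ^ ((1 - 1 / (B.m j : ℝ)) - c₁ * (2 - 1 / (B.m j : ℝ))))) ∧
      -- `ε^t` and `dε^t` vanish on `K^t`
      (∀ x ∈ BranchedSL.partK B (t ^ c₁) (t ^ c₂),
        BranchedSL.phase cy (BranchedSL.deformation Φ f B R₀ a χ t) x = 0 ∧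
        mfderiv (𝓡 3) 𝓘(ℝ, ℝ)
          (BranchedSL.phase cy (BranchedSL.deformation Φ f B R₀ a χ t)) x = 0) := by
  choose C hC hest using fun j =>
    BranchedSL.exists_tube_estimate (X := X) hι hΦ hf hR ha hc₂ hχ j
  obtain ⟨δ, hδ, hδest⟩ := mem_nhdsGT_iff_exists_Ioo_subset.1 (eventually_all.2 hest)
  -- The summand `1` keeps the constant positive when there are no branch circles.
  refine ⟨min δ δ₀, lt_min hδ hδ₀, min_le_right _ _, 1 + ∑ j, C j,
    add_pos_of_pos_of_nonneg one_pos (Finset.sum_nonneg fun j _ => (hC j).le), fun t ht => ?_⟩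
  have hCle : ∀ j, C j ≤ 1 + ∑ j, C j := fun j =>
    (Finset.single_le_sum (fun j _ => (hC j).le) (Finset.mem_univ j)).trans
      (le_add_of_nonneg_left zero_le_one)
  set C' := 1 + ∑ j, C j with hC'
  have hC0 : 0 ≤ C' := add_nonneg zero_le_one (Finset.sum_nonneg fun j _ => (hC j).le)
  have ht0 : 0 < t := ht.1
  have htδ : t < δ₀ := ht.2.trans_le (min_le_right _ _)
  have htube := fun j => hδest ⟨ht.1, ht.2.trans_le (min_le_left _ _)⟩ j htδ
  obtain ⟨hb0, hb, hbR⟩ := hχ.b_lt t ⟨ht0, htδ⟩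
  have hpart : ∀ x ∈ BranchedSL.partK B (t ^ c₁) (t ^ c₂), _ := fun x hx =>
    BranchedSL.isGoodAt_of_mem_partK (a := a) hι hΦ hf hR hχ ⟨ht0, htδ⟩ hx
  have hgood : ∀ x, BranchedSL.IsGoodAt cy U Φ f (BranchedSL.potential B R₀ a χ t) x := by
    intro x
    by_cases hx : x ∈ BranchedSL.partK B (t ^ c₁) (t ^ c₂)
    · exact (hpart x hx).1
    · rw [BranchedSL.mem_partK_iff hb.le] at hx
      push Not at hx
      obtain ⟨j, w, hw, rfl⟩ := hx
      exact (htube j w hw).1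
  have hF : ContMDiff (𝓡 3) 𝓘(ℝ, BranchedSL.C3) ∞ (BranchedSL.deformation Φ f B R₀ a χ t) :=
    fun x => (hgood x).2.1
  have hε : ContMDiff (𝓡 3) 𝓘(ℝ, ℝ) ∞
      (BranchedSL.phase cy (BranchedSL.deformation Φ f B R₀ a χ t)) := fun x => (hgood x).2.2.2
  have hpow : ∀ e : ℝ, 0 ≤ C' * t ^ e := fun e => mul_nonneg hC0 (Real.rpow_nonneg ht0.le e)
  have hmono : ∀ (j : Fin n) (e : ℝ), C j * t ^ e ≤ C' * t ^ e := fun j e =>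
    mul_le_mul_of_nonneg_right (hCle j) (Real.rpow_nonneg ht0.le e)
  refine ⟨fun x => (hgood x).1, hF, fun x => (hgood x).2.2.1, hε, ?_, ?_,
    fun x hx => (hpart x hx).2⟩
  · rintro j _ ⟨w, hw, rfl⟩
    have hcyl := BranchedSL.mem_cyl_rpow (hf.m_ne_zero j)
      ((lt_of_le_of_lt hw (hb.trans hbR)).trans (hR j))
    -- Points with `|z|^m = t^{c₁}` belong to `P_j` as well, but there the tube estimate yields only
    -- the bounds for `Q_j`.
    obtain ⟨h1, h2⟩ := BranchedSL.estimate_partP hb0 (hf.m_ne_zero j) hw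
      ((hf.tube_up j).contMDiffAt hcyl).continuousAt hF hε fun w hw =>
        (htube j w (hw.le.trans hb.le)).2.1 hw
    exact ⟨h1.trans (add_le_add (hmono j _) (hmono j _)),
      h2.mono ((hCle j).trans (le_add_of_nonneg_right (hpow _)))⟩
  · rintro j _ ⟨w, ⟨hw, hw'⟩, rfl⟩
    obtain ⟨h1, h2⟩ := (htube j w hw').2.2 hw
    -- The tube estimate gives the last summand of each bound; the other summands are nonnegative.
    refine ⟨(h1.trans (hmono j _)).trans (le_add_of_nonneg_left (hpow _)),
      h2.mono ((hmono j _).trans (le_add_of_nonneg_left (add_nonneg (hpow _) (hpow _))))⟩
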